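/- **Theorem 3.1.** Let $n\ge 1$, $D=\{(x,y): x>0,\ y\in\mathbb R^{n-1}\}$, $F:\mathbb R\to\mathbb R$ and $h:D\to\mathbb R$. Let $u$ be a classical solution of Problem 1, $$u_t-\Delta u=-F\Big(\int_0^t u_x(0,y,s)\,ds\Big)\ \ (x>0,\ y\in\mathbb R^{n-1},\ t>0),\qquad u(0,y,t)=0\ \ (t>0),\qquad u(x,y,0)=h(x,y)\ \ (x>0),$$ that is: $u$ is $C^2$ in $(x,y)$ and $C^1$ in $t$ for $x>0$, $t>0$, with jointly continuous derivatives; $u$ is continuous on $\{x\ge 0,\ t>0\}$; the flux $V(y,t)=u_x(0,y,t)$ (derivative from $x\ge0$) exists for $t>0$ and $V(y,\cdot)$ is integrable on $(0,t)$ for all $y$ and $t>0$; $u(x,y,t)\to u(x,y,0)$ as $t\to0^+$ for all $x>0$ and $y$; and the three equations hold. Write $\mathcal F(V(y,t))=F\big(\int_0^tV(y,s)\,ds\big)$. Assume that for all $a>0$ and $T>0$ there is a constant $C$ with $$|u(x,y,t)|\le C e^{a(x^2+\|y\|^2)},\qquad |\mathcal F(V(y,t))|\le C e^{a\|y\|^2}\qquad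 (x>0,\ y\in\mathbb R^{n-1},\ 0<t\le T).$$ Let $\operatorname{erf}(\zeta)=\frac2{\sqrt\pi}\int_0^\zeta e^{-X^2}dX$ and, for $t>\tau$, $$G_1(x,y,t;\xi,\eta,\tau)=\frac{e^{-\|y-\eta\|^2/4(t-\tau)}}{(2\sqrt{\pi(t-\tau)})^{n-1}}\cdot\frac{e^{-(x-\xi)^2/4(t-\tau)}-e^{-(x+\xi)^2/4(t-\tau)}}{2\sqrt{\pi(t-\tau)}}.$$ Then, for all $x>0$, $y\in\mathbb R^{n-1}$ and $t>0$, $$u(x,y,t)=u_0(x,y,t)-\int_0^t\frac{\operatorname{erf}\big(\frac{x}{2\sqrt{t-\tau}}\big)}{(2\sqrt{\pi(t-\tau)})^{n-1}}\Big[\int_{\mathbb R^{n-1}}e^{-\|y-\eta\|^2/4(t-\tau)}\mathcal F(V(\eta,\tau))\,d\eta\Big]d\tau,$$ where $u_0(x,y,t)=\int_D G_1(x,y,t;\xi,\eta,0)\,h(\xi,\eta)\,d\xi\,d\eta$, and the flux $V$ satisfies, for all $y\in\mathbb R^{n-1}$ and $t>0$, the Volterra integral equation $$V(y,t)=V_0(y,t)-2\int_0^t\frac1{(2\sqrt{\pi(t-\tau)})^{n}}\Big[\int_{\mathbb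 R^{n-1}}e^{-\|y-\eta\|^2/4(t-\tau)}\mathcal F(V(\eta,\tau))\,d\eta\Big]d\tau,$$ where $V_0(y,t)=\int_D \partial_xG_1(0,y,t;\xi,\eta,0)\,h(\xi,\eta)\,d\xi\,d\eta$. All these integrals (the inner ones, for $0<\tau<t$, and the outer ones) converge absolutely. -/

import Mathlib

open MeasureTheory Set Filter Topology

namespace NonclassicalHeat

/-- The space `ℝ^d` of tangential variables `y`. The space dimension is `n = d + 1`, so `d = n - 1`. -/
abbrev Tan (d : ℕ) : Type := EuclideanSpace ℝ (Fin d)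

/-- The open half-space `D = {(x, y) : x > 0, y ∈ ℝ^d}`. -/
def halfSpace (d : ℕ) : Set (ℝ × Tan d) := Ioi 0 ×ˢ univ

/-- The error function `erf ζ = (2 / √π) ∫₀^ζ e^{-X²} dX`. -/
noncomputable def erf (ζ : ℝ) : ℝ := 2 / √Real.pi * ∫ X in (0 : ℝ)..ζ, Real.exp (-X ^ 2)

/-- Green's function of the one-dimensional heat equation on the half-line, Dirichlet condition
at `0` (for `t > τ`). -/
noncomputable def green (x t ξ τ : ℝ) : ℝ :=
  (Real.exp (-(x - ξ) ^ 2 / (4 * (t - τ))) - Real.exp (-(x + ξ) ^ 2 / (4 * (t - τ)))) /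
    (2 * √(Real.pi * (t - τ)))

/-- Green's function `G₁(x, y, t; ξ, η, τ)` of the heat equation on the half-space, Dirichlet
condition on `x = 0` (for `t > τ`). -/
noncomputable def green₁ {d : ℕ} (x : ℝ) (y : Tan d) (t ξ : ℝ) (η : Tan d) (τ : ℝ) : ℝ :=
  Real.exp (-‖y - η‖ ^ 2 / (4 * (t - τ))) / (2 * √(Real.pi * (t - τ))) ^ d * green x t ξ τ

/-- `G₁,ₓ(x, y, t; ξ, η, τ)`, the partial derivative of `G₁` in `x`. -/
noncomputable def green₁x {d : ℕ} (x : ℝ) (y : Tan d) (t ξ : ℝ) (η : Tan d) (τ : ℝ) : ℝ :=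
  deriv (fun x' => green₁ x' y t ξ η τ) x

/-- `u₀(x, y, t) = ∫_D G₁(x, y, t; ξ, η, 0) h(ξ, η) dξ dη`. -/
noncomputable def u₀ {d : ℕ} (h : ℝ → Tan d → ℝ) (x : ℝ) (y : Tan d) (t : ℝ) : ℝ :=
  ∫ p in halfSpace d, green₁ x y t p.1 p.2 0 * h p.1 p.2

/-- `V₀(y, t) = ∫_D G₁,ₓ(0, y, t; ξ, η, 0) h(ξ, η) dξ dη`. -/
noncomputable def V₀ {d : ℕ} (h : ℝ → Tan d → ℝ) (y : Tan d) (t : ℝ) : ℝ :=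
  ∫ p in halfSpace d, green₁x 0 y t p.1 p.2 0 * h p.1 p.2

/-- The boundary heat flux `V(y, t) = u_x(0, y, t)`: the derivative at `x = 0` from inside the
half-space. -/
noncomputable def flux {d : ℕ} (u : ℝ → Tan d → ℝ → ℝ) (y : Tan d) (t : ℝ) : ℝ :=
  derivWithin (fun x => u x y t) (Ici 0) 0

/-- `𝓕(V)(y, t) = F(∫₀ᵗ V(y, s) ds)`. -/
noncomputable def source {d : ℕ} (F : ℝ → ℝ) (V : Tan d → ℝ → ℝ) (y : Tan d) (t : ℝ) : ℝ :=
  F (∫ s in (0 : ℝ)..t, V y s)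

/-- The Laplacian in the space variables `(x, y) ∈ ℝ × ℝ^d`. -/
noncomputable def spaceLaplacian {d : ℕ} (u : ℝ → Tan d → ℝ → ℝ) (x : ℝ) (y : Tan d) (t : ℝ) : ℝ :=
  iteratedDeriv 2 (fun x' => u x' y t) x + Laplacian.laplacian (fun y' => u x y' t) y

/-- `u` is of class `C^{2,1}` in `{(x, y, t) : x > 0, t > 0}`: twice continuously differentiable in
space, continuously differentiable in time, all these derivatives being jointly continuous. -/
structure IsC21 {d : ℕ} (u : ℝ → Tan d → ℝ → ℝ) : Prop where
  contDiffOn_space : ∀ t, 0 < t → ContDiffOn ℝ 2 (fun p : ℝ × Tan d => u p.1 p.2 t) (halfSpace d)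
  continuousOn_space : ∀ k : ℕ, k ≤ 2 → ContinuousOn
    (fun q : (ℝ × Tan d) × ℝ => iteratedFDeriv ℝ k (fun p : ℝ × Tan d => u p.1 p.2 q.2) q.1)
    (halfSpace d ×ˢ Ioi 0)
  differentiableAt_time : ∀ x y t, 0 < x → 0 < t → DifferentiableAt ℝ (fun s => u x y s) t
  continuousOn_time : ContinuousOn
    (fun q : (ℝ × Tan d) × ℝ => deriv (fun s => u q.1.1 q.1.2 s) q.2) (halfSpace d ×ˢ Ioi 0)

/-- `u` is a classical solution, for `x > 0`, `y ∈ ℝ^d` and `t > 0`, of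
`u_t - Δu = -F(∫₀ᵗ u_x(0, y, s) ds)`, `u(0, y, t) = 0`, `u(x, y, 0) = h(x, y)`.
No continuity is required at the corner `x = t = 0`, since `h` need not vanish on `x = 0`. -/
structure IsSolution {d : ℕ} (F : ℝ → ℝ) (h : ℝ → Tan d → ℝ) (u : ℝ → Tan d → ℝ → ℝ) : Prop where
  regular : IsC21 u
  /-- `u` is continuous up to the boundary `x = 0` for positive times. -/
  continuousOn_boundary : ContinuousOn (fun q : (ℝ × Tan d) × ℝ => u q.1.1 q.1.2 q.2)
    ((Ici 0 ×ˢ univ) ×ˢ Ioi 0)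
  /-- The boundary flux `u_x(0, y, t)` exists. -/
  flux_exists : ∀ y t, 0 < t → DifferentiableWithinAt ℝ (fun x => u x y t) (Ici 0) 0
  /-- The integral `∫₀ᵗ u_x(0, y, s) ds` exists. -/
  flux_integrable : ∀ y t, 0 < t → IntervalIntegrable (flux u y) volume 0 t
  equation : ∀ x y t, 0 < x → 0 < t →
    deriv (fun s => u x y s) t - spaceLaplacian u x y t = -source F (flux u) y t
  boundary : ∀ y t, 0 < t → u 0 y t = 0
  initial : ∀ x y, 0 < x → u x y 0 = h x y
  /-- The initial value is attained continuously. -/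
  continuous_initial : ∀ x y, 0 < x → Tendsto (fun t => u x y t) (𝓝[>] 0) (𝓝 (u x y 0))

end NonclassicalHeat

/-!
# Integral representation for a nonclassical heat problem on the half-space

Write `f = source F (flux u)`. Only the linear structure of the equation `u_t - Δu = -f` is used:
`f` is continuous for positive times, because it equals `Δu - u_t` on the plane `x = 1`, and its
growth is a hypothesis.

Fix a pole `(x, y, t)` and let `G(ξ, η, τ)` be Green's function, a solution of the backward heat
equation that vanishes at `ξ = 0`. Formally `d/dτ ∫_D G u = -∫_D G f`, and the representation
formula is the integral of this identity over `0 < τ < t`. No bound on the derivatives of `u` is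
available, neither near the boundary nor at infinity, so the identity is first tested with `φ = χ G`,
where `χ` is a cutoff with compact support in the open half-space. After Green's second identity
(`IsSolution.weak_formulation`) all derivatives fall on `φ`, and the commutator
`φ_τ + Δφ = 2 ∇χ · ∇G + G Δχ` multiplies `u` itself. Its part at infinity is dominated by a Gaussian
and carries a factor `1 / n`. Its part on the strip `1/n ≤ ξ ≤ 2/n` is of size `n`, because `G` vanishes
to first order, and after the substitution `ζ = n ξ` it tends to `0` since `u(ζ / n, η, τ) → 0`: only
the continuity of `u` up to the boundary matters (`exists_slice_bound`). This gives
`IsSolution.green_identity` on every interval `[s, r] ⊂ (0, t)`.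

As `s → 0` dominated convergence needs only the pointwise initial values
(`IsSolution.tendsto_integral_green_initial`). As `r → t` the kernel concentrates at the pole, while its
image term concentrates at `(-x, y)`, outside `D` (`IsSolution.tendsto_integral_green_terminal`). The
normal integral of `G` is an error function (`integral_dirichletKernel`), which yields the
representation formula (`IsSolution.eq_u₀_sub_integral`).

The equation for the flux follows by dividing the representation by `x` and letting `x → 0`: the
difference quotients of `u` converge to the flux by its definition, those of `u₀` to `V₀`, and
`|erf ζ| ≤ 2 |ζ| / √π` bounds the remaining integrand by the integrable weight `1 / √(π (t - τ))`.
-/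

namespace NonclassicalHeat

/-! ### Integration by parts against compactly supported functions -/

section IntegrationByParts

variable {E : Type*} [NormedAddCommGroup E]

theorem integrable_mul_of_tsupport_subset [MeasurableSpace E] [BorelSpace E]
    {μ : Measure E} [IsFiniteMeasureOnCompacts μ] {U : Set E} (hU : IsOpen U) {f ψ : E → ℝ}
    (hψ : Continuous ψ) (hc : HasCompactSupport ψ) (hs : tsupport ψ ⊆ U) (hf : ContinuousOn f U) :
    Integrable (fun p => ψ p * f p) μ := by
  have hsub : tsupport (fun p => ψ p * f p) ⊆ tsupport ψ := tsupport_mul_subset_left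
  have h1 : Continuous (fun p => ψ p * f p) :=
    (hψ.continuousOn.mul hf).continuous_of_tsupport_subset hU (hsub.trans hs)
  exact h1.integrable_of_hasCompactSupport hc.mul_right

/-- Second-order integration by parts. The function `w` need only be regular on an open set that
contains the support of `ψ`; its values elsewhere do not matter. -/
theorem integral_mul_fderiv_fderiv_comm [NormedSpace ℝ E] [FiniteDimensional ℝ E] [MeasurableSpace E] [BorelSpace E]
    {μ : Measure E} [μ.IsAddHaarMeasure] {U : Set E} (hU : IsOpen U) {w ψ : E → ℝ}
    (hw : ContDiffOn ℝ 2 w U) (hψ : ContDiff ℝ 2 ψ) (hc : HasCompactSupport ψ)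
    (hs : tsupport ψ ⊆ U) (v : E) :
    Integrable (fun p => ψ p * fderiv ℝ (fderiv ℝ w) p v v) μ ∧
    Integrable (fun p => fderiv ℝ (fderiv ℝ ψ) p v v * w p) μ ∧
    ∫ p, ψ p * fderiv ℝ (fderiv ℝ w) p v v ∂μ =
      ∫ p, fderiv ℝ (fderiv ℝ ψ) p v v * w p ∂μ := by
  have hw1 : ContDiffOn ℝ 1 (fderiv ℝ w) U := hw.fderiv_of_isOpen hU (by norm_num)
  have hw2 : ContinuousOn (fderiv ℝ (fderiv ℝ w)) U :=
    hw1.continuousOn_fderiv_of_isOpen hU (by norm_num)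
  have hψ1 : ContDiff ℝ 1 (fderiv ℝ ψ) := hψ.fderiv_right (by norm_num)
  have hψ2 : Continuous (fderiv ℝ (fderiv ℝ ψ)) := hψ1.continuous_fderiv (by norm_num)
  have t1 : tsupport (fun p => fderiv ℝ ψ p v) ⊆ tsupport ψ := tsupport_fderiv_apply_subset ℝ v
  have t2 : tsupport (fun p => fderiv ℝ (fderiv ℝ ψ) p v v) ⊆ tsupport ψ := by
    refine (closure_mono fun p hp => ?_).trans
      ((tsupport_fderiv_apply_subset ℝ (f := fderiv ℝ ψ) v).trans (tsupport_fderiv_subset ℝ))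
    intro h0
    apply hp
    simp only at h0 ⊢
    rw [h0]; rfl
  have c1 : HasCompactSupport (fun p => fderiv ℝ ψ p v) := hc.fderiv_apply ℝ v
  have c2 : HasCompactSupport (fun p => fderiv ℝ (fderiv ℝ ψ) p v v) :=
    hc.mono' (subset_closure.trans t2)
  have dw : ∀ x ∈ U, DifferentiableAt ℝ w x := fun x hx =>
    (hw.contDiffAt (hU.mem_nhds hx)).differentiableAt (by norm_num)
  have dw1 : ∀ x ∈ U, DifferentiableAt ℝ (fderiv ℝ w) x := fun x hx =>
    (hw1.contDiffAt (hU.mem_nhds hx)).differentiableAt (by norm_num)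
  have e1 : ∀ x ∈ U, fderiv ℝ (fun p => fderiv ℝ w p v) x v = fderiv ℝ (fderiv ℝ w) x v v := by
    intro x hx
    rw [fderiv_clm_apply (dw1 x hx) (differentiableAt_const v)]
    simp
  have e2 : ∀ x, fderiv ℝ (fun p => fderiv ℝ ψ p v) x v = fderiv ℝ (fderiv ℝ ψ) x v v := by
    intro x
    rw [fderiv_clm_apply ((hψ1.differentiable (by norm_num)) x) (differentiableAt_const v)]
    simp
  have hψv : Continuous (fun p => fderiv ℝ ψ p v) := hψ1.continuous.clm_apply continuous_const
  have hψvv : Continuous (fun p => fderiv ℝ (fderiv ℝ ψ) p v v) :=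
    (hψ2.clm_apply continuous_const).clm_apply continuous_const
  have hwv : ContinuousOn (fun p => fderiv ℝ w p v) U :=
    hw1.continuousOn.clm_apply continuousOn_const
  have hwvv : ContinuousOn (fun p => fderiv ℝ (fderiv ℝ w) p v v) U :=
    (hw2.clm_apply continuousOn_const).clm_apply continuousOn_const
  have i0 : Integrable (fun p => ψ p * fderiv ℝ (fderiv ℝ w) p v v) μ :=
    integrable_mul_of_tsupport_subset hU hψ.continuous hc hs hwvv
  have i2 : Integrable (fun p => fderiv ℝ (fderiv ℝ ψ) p v v * w p) μ :=
    integrable_mul_of_tsupport_subset hU hψvv c2 (t2.trans hs) hw.continuousOn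
  have i1 : Integrable (fun p => fderiv ℝ ψ p v * fderiv ℝ w p v) μ :=
    integrable_mul_of_tsupport_subset hU hψv c1 (t1.trans hs) hwv
  have j0 : Integrable (fun p => ψ p * fderiv ℝ w p v) μ :=
    integrable_mul_of_tsupport_subset hU hψ.continuous hc hs hwv
  have j1 : Integrable (fun p => fderiv ℝ ψ p v * w p) μ :=
    integrable_mul_of_tsupport_subset hU hψv c1 (t1.trans hs) hw.continuousOn
  refine ⟨i0, i2, ?_⟩
  -- outside the support of `ψ` the values of `fderiv w` are irrelevant
  have k0 : (fun p => ψ p * fderiv ℝ (fderiv ℝ w) p v v) =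
      fun p => ψ p * fderiv ℝ (fun q => fderiv ℝ w q v) p v := by
    funext p
    by_cases hp : p ∈ tsupport ψ
    · rw [e1 p (hs hp)]
    · rw [image_eq_zero_of_notMem_tsupport hp]; simp
  have k2 : (fun p => fderiv ℝ (fderiv ℝ ψ) p v v * w p) =
      fun p => fderiv ℝ (fun q => fderiv ℝ ψ q v) p v * w p := by
    funext p; rw [e2]
  have A := integral_mul_fderiv_eq_neg_fderiv_mul_of_integrable (𝕜 := ℝ) (μ := μ) (f := ψ)
    (g := fun q => fderiv ℝ w q v) (v := v) i1 (k0 ▸ i0) j0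
    (fun x _ => hψ.differentiable (by norm_num) x)
    (fun x hx => (dw1 x (hs hx)).clm_apply (differentiableAt_const v))
  have B := integral_mul_fderiv_eq_neg_fderiv_mul_of_integrable (𝕜 := ℝ) (μ := μ)
    (f := fun q => fderiv ℝ ψ q v) (g := w) (v := v) (k2 ▸ i2) i1 j1
    (fun x _ => (hψ1.differentiable (by norm_num) x).clm_apply (differentiableAt_const v))
    (fun x hx => dw x (hs (t1 hx)))
  rw [k0, k2, A, B, neg_neg]

end IntegrationByParts

/-! ### The Laplacian in the half-space -/

section Laplacian

variable {d : ℕ}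

theorem isOpen_halfSpace : IsOpen (halfSpace d) := isOpen_Ioi.prod isOpen_univ

/-- The standard basis vector of `ℝ^d`, as a tangential direction in `ℝ × ℝ^d`. -/
noncomputable def tanDir (i : Fin d) : ℝ × Tan d := (0, EuclideanSpace.basisFun (Fin d) ℝ i)

theorem spaceLaplacian_eq_fderiv {u : ℝ → Tan d → ℝ → ℝ} {x : ℝ} {y : Tan d} {t : ℝ}
    (hu : ContDiffAt ℝ 2 (fun p : ℝ × Tan d => u p.1 p.2 t) (x, y)) :
    spaceLaplacian u x y t =
      fderiv ℝ (fderiv ℝ (fun p : ℝ × Tan d => u p.1 p.2 t)) (x, y) (1, 0) (1, 0) +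
      ∑ i, fderiv ℝ (fderiv ℝ (fun p : ℝ × Tan d => u p.1 p.2 t)) (x, y) (tanDir i) (tanDir i) := by
  set w : ℝ × Tan d → ℝ := fun p => u p.1 p.2 t with hw
  have hev : ∀ᶠ p in 𝓝 (x, y), DifferentiableAt ℝ w p :=
    (hu.eventually (by simp)).mono fun p hp => hp.differentiableAt (by norm_num)
  have h1 : DifferentiableAt ℝ (fderiv ℝ w) (x, y) :=
    (hu.fderiv_right (m := 1) (by norm_num)).differentiableAt (by norm_num)
  unfold spaceLaplacian
  congr 1
  · have hc : Tendsto (fun x' : ℝ => (x', y)) (𝓝 x) (𝓝 (x, y)) :=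
      (Continuous.prodMk_left y).tendsto x
    have hd : ∀ x', HasDerivAt (fun x' : ℝ => (x', y)) ((1 : ℝ), (0 : Tan d)) x' := fun x' =>
      (hasDerivAt_id x').prodMk (hasDerivAt_const x' y)
    have e : deriv (fun x' => u x' y t) =ᶠ[𝓝 x] fun x' => fderiv ℝ w (x', y) (1, 0) := by
      filter_upwards [hc.eventually hev] with x' hx'
      exact (hx'.hasFDerivAt.comp_hasDerivAt x' (hd x')).deriv
    rw [iteratedDeriv_succ, iteratedDeriv_one, e.deriv_eq]
    have h2 : HasDerivAt (fun x' => fderiv ℝ w (x', y))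
        (fderiv ℝ (fderiv ℝ w) (x, y) (1, 0)) x :=
      h1.hasFDerivAt.comp_hasDerivAt x (hd x)
    have := h2.clm_apply (hasDerivAt_const x ((1 : ℝ), (0 : Tan d)))
    simpa using this.deriv
  · rw [InnerProductSpace.laplacian_eq_iteratedFDeriv_orthonormalBasis _
      (EuclideanSpace.basisFun (Fin d) ℝ)]
    refine Finset.sum_congr rfl fun i _ => ?_
    rw [iteratedFDeriv_two_apply]
    simp only [Matrix.cons_val_zero, Matrix.cons_val_one]
    have hc : Tendsto (fun y' : Tan d => (x, y')) (𝓝 y) (𝓝 (x, y)) :=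
      (Continuous.prodMk_right x).tendsto y
    have hd : ∀ y', HasFDerivAt (fun y' : Tan d => (x, y'))
        (ContinuousLinearMap.inr ℝ ℝ (Tan d)) y' := fun y' => hasFDerivAt_prodMk_right x y'
    have e : fderiv ℝ (fun y' => u x y' t) =ᶠ[𝓝 y]
        fun y' => (fderiv ℝ w (x, y')).comp (ContinuousLinearMap.inr ℝ ℝ (Tan d)) := by
      filter_upwards [hc.eventually hev] with y' hy'
      exact (hy'.hasFDerivAt.comp y' (hd y')).fderiv
    rw [e.fderiv_eq]
    have h2 : HasFDerivAt (fun y' => fderiv ℝ w (x, y'))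
        ((fderiv ℝ (fderiv ℝ w) (x, y)).comp (ContinuousLinearMap.inr ℝ ℝ (Tan d))) y :=
      h1.hasFDerivAt.comp y (hd y)
    have h3 := (h2.clm_comp (hasFDerivAt_const (ContinuousLinearMap.inr ℝ ℝ (Tan d)) y)).fderiv
    rw [h3]
    simp [tanDir]

theorem laplacian_radial {P P1 P2 : ℝ → ℝ} (h1 : ∀ s, HasDerivAt P (P1 s) s)
    (h2 : ∀ s, HasDerivAt P1 (P2 s) s) (y z : Tan d) :
    Laplacian.laplacian (fun z : Tan d => P (‖z - y‖ ^ 2)) z =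
      4 * ‖z - y‖ ^ 2 * P2 (‖z - y‖ ^ 2) + 2 * d * P1 (‖z - y‖ ^ 2) := by
  have hn : ∀ z : Tan d, HasFDerivAt (fun z : Tan d => ‖z - y‖ ^ 2)
      (2 • (innerSL ℝ (z - y))) z := by
    intro z
    have := ((hasFDerivAt_id z).sub_const y).norm_sq
    simpa using this
  have e1 : fderiv ℝ (fun z : Tan d => P (‖z - y‖ ^ 2)) =
      fun z => P1 (‖z - y‖ ^ 2) • (2 • (innerSL ℝ (z - y))) := by
    funext z
    exact ((h1 _).comp_hasFDerivAt z (hn z)).fderiv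
  rw [InnerProductSpace.laplacian_eq_iteratedFDeriv_orthonormalBasis _
      (EuclideanSpace.basisFun (Fin d) ℝ)]
  have hL : HasFDerivAt (fun z : Tan d => (2 • (innerSL ℝ (z - y)) : Tan d →L[ℝ] ℝ))
      ((2 : ℕ) • (innerSL ℝ : Tan d →L[ℝ] Tan d →L[ℝ] ℝ)) z := by
    have := ((innerSL ℝ : Tan d →L[ℝ] Tan d →L[ℝ] ℝ).hasFDerivAt.comp z
      ((hasFDerivAt_id z).sub_const y)).const_smul (2 : ℕ)
    exact this
  have h3 : fderiv ℝ (fun z : Tan d => P1 (‖z - y‖ ^ 2) • (2 • (innerSL ℝ (z - y)))) z = _ :=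
    (((h2 _).comp_hasFDerivAt z (hn z)).smul hL).fderiv
  have e2 : ∀ i, iteratedFDeriv ℝ 2 (fun z : Tan d => P (‖z - y‖ ^ 2)) z
      ![EuclideanSpace.basisFun (Fin d) ℝ i, EuclideanSpace.basisFun (Fin d) ℝ i] =
      4 * P2 (‖z - y‖ ^ 2) * ((z - y) i) ^ 2 + 2 * P1 (‖z - y‖ ^ 2) := by
    intro i
    rw [iteratedFDeriv_two_apply, e1]
    simp only [Matrix.cons_val_zero, Matrix.cons_val_one]
    rw [h3]
    have hin : (innerSL ℝ : Tan d →L[ℝ] Tan d →L[ℝ] ℝ) (EuclideanSpace.single i 1)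
        (EuclideanSpace.single i 1) = 1 := by
      change inner ℝ (EuclideanSpace.single i (1 : ℝ)) (EuclideanSpace.single i (1 : ℝ)) = 1
      simp
    simp [hin, EuclideanSpace.basisFun_apply, EuclideanSpace.inner_single_right, innerSL_apply_apply]
    ring
  simp only [e2]
  rw [ Finset.sum_add_distrib, ← Finset.mul_sum,
    ← EuclideanSpace.real_norm_sq_eq]
  simp
  ring

end Laplacian

instance isAddHaarMeasure_volume_prod (d : ℕ) :
    (volume : Measure (ℝ × Tan d)).IsAddHaarMeasure := by
  rw [Measure.volume_eq_prod]; infer_instance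

/-! ### The weak formulation -/

section WeakFormulation

variable {d : ℕ} {F : ℝ → ℝ} {h : ℝ → Tan d → ℝ} {u : ℝ → Tan d → ℝ → ℝ}

theorem IsC21.contDiffAt (hu : IsC21 u) {x : ℝ} {y : Tan d} {t : ℝ} (hx : 0 < x) (ht : 0 < t) :
    ContDiffAt ℝ 2 (fun p : ℝ × Tan d => u p.1 p.2 t) (x, y) :=
  (hu.contDiffOn_space t ht).contDiffAt (isOpen_halfSpace.mem_nhds ⟨hx, mem_univ _⟩)

theorem IsC21.continuousOn_spaceLaplacian (hu : IsC21 u) : ContinuousOn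
    (fun q : (ℝ × Tan d) × ℝ => spaceLaplacian u q.1.1 q.1.2 q.2) (halfSpace d ×ˢ Ioi 0) := by
  have key : ∀ v : ℝ × Tan d, ContinuousOn (fun q : (ℝ × Tan d) × ℝ =>
      fderiv ℝ (fderiv ℝ (fun p : ℝ × Tan d => u p.1 p.2 q.2)) q.1 v v)
      (halfSpace d ×ˢ Ioi 0) := by
    intro v
    have h2 := hu.continuousOn_space 2 le_rfl
    have h3 : Continuous fun L : (ℝ × Tan d) [×2]→L[ℝ] ℝ => L ![v, v] :=
      continuous_eval_const ![v, v]
    refine (h3.comp_continuousOn h2).congr fun q _ => ?_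
    simp [iteratedFDeriv_two_apply]
  refine ((key (1, 0)).add (continuousOn_finsetSum Finset.univ
    fun i _ => key (tanDir i))).congr fun q hq => ?_
  exact spaceLaplacian_eq_fderiv (hu.contDiffAt hq.1.1 hq.2)

/-- The source is continuous for positive times: by the equation it is `Δu - u_t` at `x = 1`. -/
theorem IsSolution.continuousOn_source (hsol : IsSolution F h u) :
    ContinuousOn (fun q : Tan d × ℝ => source F (flux u) q.1 q.2) (univ ×ˢ Ioi 0) := by
  have hm : ContinuousOn (fun q : Tan d × ℝ => (((1 : ℝ), q.1), q.2)) (univ ×ˢ Ioi 0) := by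
    fun_prop
  have hmaps : MapsTo (fun q : Tan d × ℝ => (((1 : ℝ), q.1), q.2)) (univ ×ˢ Ioi 0)
      (halfSpace d ×ˢ Ioi 0) := fun q hq => ⟨⟨one_pos (α := ℝ), mem_univ _⟩, hq.2⟩
  refine ((hsol.regular.continuousOn_spaceLaplacian.comp hm hmaps).sub
    (hsol.regular.continuousOn_time.comp hm hmaps)).congr fun q hq => ?_
  have := hsol.equation 1 q.1 q.2 one_pos hq.2
  change source F (flux u) q.1 q.2 = spaceLaplacian u 1 q.1 q.2 - deriv (fun s => u 1 q.1 s) q.2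
  linarith

theorem IsSolution.continuousOn_interior (hsol : IsSolution F h u) :
    ContinuousOn (fun q : (ℝ × Tan d) × ℝ => u q.1.1 q.1.2 q.2) (halfSpace d ×ˢ Ioi 0) :=
  hsol.continuousOn_boundary.mono
    (prod_mono (prod_mono Ioi_subset_Ici_self subset_rfl) subset_rfl)

/-- Green's second identity in the half-space against a compactly supported test function. -/
theorem integral_spaceLaplacian_mul_sub {φ : ℝ → Tan d → ℝ → ℝ} {t : ℝ} (ht : 0 < t)
    (hu : IsC21 u) {K : Set (ℝ × Tan d)} (hK : IsCompact K) (hKD : K ⊆ halfSpace d)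
    (hφ0 : ∀ p ∉ K, φ p.1 p.2 t = 0)
    (hφ2 : ContDiff ℝ 2 (fun p : ℝ × Tan d => φ p.1 p.2 t)) :
    IntegrableOn (fun p : ℝ × Tan d => spaceLaplacian φ p.1 p.2 t * u p.1 p.2 t -
        φ p.1 p.2 t * spaceLaplacian u p.1 p.2 t) (halfSpace d) ∧
    ∫ p in halfSpace d, (spaceLaplacian φ p.1 p.2 t * u p.1 p.2 t -
        φ p.1 p.2 t * spaceLaplacian u p.1 p.2 t) = 0 := by
  set ψ : ℝ × Tan d → ℝ := fun p => φ p.1 p.2 t with hψ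
  set w : ℝ × Tan d → ℝ := fun p => u p.1 p.2 t with hw
  have hts : tsupport ψ ⊆ K := closure_minimal
    (fun p hp => by by_contra hpK; exact hp (hφ0 p hpK)) hK.isClosed
  have hc : HasCompactSupport ψ := HasCompactSupport.intro hK hφ0
  have key := integral_mul_fderiv_fderiv_comm (μ := volume) isOpen_halfSpace
    (hu.contDiffOn_space t ht) hφ2 hc (hts.trans hKD)
  let R : ℝ × Tan d → ℝ × Tan d → ℝ := fun v p =>
    fderiv ℝ (fderiv ℝ ψ) p v v * w p - ψ p * fderiv ℝ (fderiv ℝ w) p v v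
  have hR : ∀ v, Integrable (R v) := fun v => (key v).2.1.sub (key v).1
  have hR0 : ∀ v, ∫ p, R v p = 0 := fun v => by
    simp only [R]
    rw [integral_sub (key v).2.1 (key v).1, (key v).2.2, sub_self]
  have hsum : Integrable (fun p => R (1, 0) p + ∑ i, R (tanDir i) p) :=
    (hR _).add (integrable_finsetSum _ fun i _ => hR _)
  have heq : ∀ p ∈ halfSpace d, spaceLaplacian φ p.1 p.2 t * u p.1 p.2 t -
      φ p.1 p.2 t * spaceLaplacian u p.1 p.2 t = R (1, 0) p + ∑ i, R (tanDir i) p := by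
    intro p hp
    rw [spaceLaplacian_eq_fderiv hφ2.contDiffAt, spaceLaplacian_eq_fderiv (hu.contDiffAt hp.1 ht)]
    simp only [R, Finset.sum_sub_distrib, ← Finset.sum_mul, ← Finset.mul_sum]
    simp only [hψ, hw, Prod.mk.eta]
    ring
  have hoff : ∀ p ∉ halfSpace d, R (1, 0) p + ∑ i, R (tanDir i) p = 0 := by
    intro p hp
    have hpK : p ∉ K := fun hh => hp (hKD hh)
    have e0 : ψ =ᶠ[𝓝 p] fun _ => 0 := by
      filter_upwards [hK.isClosed.isOpen_compl.mem_nhds hpK] with q hq using hφ0 q hq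
    have e1 : fderiv ℝ (fderiv ℝ ψ) p = 0 := by
      rw [e0.fderiv.fderiv_eq]; simp
    have e2 : ψ p = 0 := hφ0 p hpK
    simp [R, e1, e2]
  refine ⟨(hsum.integrableOn).congr_fun (fun p hp => (heq p hp).symm)
    isOpen_halfSpace.measurableSet, ?_⟩
  rw [setIntegral_congr_fun isOpen_halfSpace.measurableSet heq,
    setIntegral_eq_integral_of_forall_compl_eq_zero hoff,
    integral_add (hR _) (integrable_finsetSum _ fun i _ => hR _),
    integral_finsetSum _ fun i _ => hR _]
  simp [hR0]

/-- The heat equation tested against a function that is compactly supported in the open half-space: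
only `u` itself enters, and none of its derivatives. -/
theorem IsSolution.weak_formulation (hsol : IsSolution F h u) {s r : ℝ} (hs : 0 < s) (hsr : s ≤ r)
    {K : Set (ℝ × Tan d)} (hK : IsCompact K) (hKD : K ⊆ halfSpace d) {φ φ' : ℝ → Tan d → ℝ → ℝ}
    (hφ0 : ∀ p ∉ K, ∀ τ, φ p.1 p.2 τ = 0) (hφ'0 : ∀ p ∉ K, ∀ τ, φ' p.1 p.2 τ = 0)
    (hφ2 : ∀ τ ∈ Icc s r, ContDiff ℝ 2 (fun p : ℝ × Tan d => φ p.1 p.2 τ))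
    (hφ' : ∀ x y, ∀ τ ∈ Icc s r, HasDerivAt (fun τ => φ x y τ) (φ' x y τ) τ)
    (hφc : ContinuousOn (fun q : ℝ × (ℝ × Tan d) => φ q.2.1 q.2.2 q.1) (Icc s r ×ˢ univ))
    (hφ'c : ContinuousOn (fun q : ℝ × (ℝ × Tan d) => φ' q.2.1 q.2.2 q.1) (Icc s r ×ˢ univ)) :
    IntervalIntegrable (fun τ => ∫ p in halfSpace d,
      ((φ' p.1 p.2 τ + spaceLaplacian φ p.1 p.2 τ) * u p.1 p.2 τ -
        φ p.1 p.2 τ * source F (flux u) p.2 τ)) volume s r ∧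
    ∫ τ in s..r, ∫ p in halfSpace d,
      ((φ' p.1 p.2 τ + spaceLaplacian φ p.1 p.2 τ) * u p.1 p.2 τ -
        φ p.1 p.2 τ * source F (flux u) p.2 τ) =
      (∫ p in halfSpace d, φ p.1 p.2 r * u p.1 p.2 r) -
        ∫ p in halfSpace d, φ p.1 p.2 s * u p.1 p.2 s := by
  have hpos : ∀ τ ∈ Icc s r, 0 < τ := fun τ hτ => hs.trans_le hτ.1
  let Ψ : ℝ × (ℝ × Tan d) → ℝ := fun q => φ' q.2.1 q.2.2 q.1 * u q.2.1 q.2.2 q.1 +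
    φ q.2.1 q.2.2 q.1 * deriv (fun τ => u q.2.1 q.2.2 τ) q.1
  have hsw : ContinuousOn (fun q : ℝ × (ℝ × Tan d) => (q.2, q.1)) (Icc s r ×ˢ K) :=
    continuous_swap.continuousOn
  have hswm : MapsTo (fun q : ℝ × (ℝ × Tan d) => (q.2, q.1)) (Icc s r ×ˢ K)
      (halfSpace d ×ˢ Ioi 0) := fun q hq => ⟨hKD hq.2, hpos _ hq.1⟩
  have hsub : Icc s r ×ˢ K ⊆ Icc s r ×ˢ univ := prod_mono subset_rfl (subset_univ _)
  have huc : ContinuousOn (fun q : ℝ × (ℝ × Tan d) => u q.2.1 q.2.2 q.1) (Icc s r ×ˢ K) :=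
    hsol.continuousOn_interior.comp hsw hswm
  have hutc : ContinuousOn (fun q : ℝ × (ℝ × Tan d) => deriv (fun τ => u q.2.1 q.2.2 τ) q.1)
      (Icc s r ×ˢ K) := hsol.regular.continuousOn_time.comp hsw hswm
  have hΨc : ContinuousOn Ψ (Icc s r ×ˢ K) :=
    ((hφ'c.mono hsub).mul huc).add ((hφc.mono hsub).mul hutc)
  have hΨi : IntegrableOn Ψ (Icc s r ×ˢ K) :=
    hΨc.integrableOn_compact (isCompact_Icc.prod hK)
  have hΨi' : Integrable Ψ ((volume.restrict (Ioc s r)).prod (volume.restrict K)) := by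
    rw [Measure.prod_restrict]
    exact hΨi.mono_set (prod_mono Ioc_subset_Icc_self subset_rfl)
  have hKm := hK.measurableSet
  -- the slice integrals, first over `K`
  have hslice : ∀ τ ∈ Icc s r, ∫ p in halfSpace d,
      ((φ' p.1 p.2 τ + spaceLaplacian φ p.1 p.2 τ) * u p.1 p.2 τ -
        φ p.1 p.2 τ * source F (flux u) p.2 τ) = ∫ p in K, Ψ (τ, p) := by
    intro τ hτ
    obtain ⟨hi, h0⟩ := integral_spaceLaplacian_mul_sub (hpos τ hτ) hsol.regular hK hKD
      (fun p hp => hφ0 p hp τ) (hφ2 τ hτ)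
    have hz : ∀ p ∈ halfSpace d \ K, Ψ (τ, p) = 0 := by
      intro p hp
      simp [Ψ, hφ0 p hp.2 τ, hφ'0 p hp.2 τ]
    have hΨK : IntegrableOn (fun p => Ψ (τ, p)) K := by
      refine ContinuousOn.integrableOn_compact hK ?_
      exact hΨc.comp (by fun_prop) fun p hp => ⟨hτ, hp⟩
    have hΨD : IntegrableOn (fun p => Ψ (τ, p)) (halfSpace d) :=
      hΨK.of_forall_sdiff_eq_zero isOpen_halfSpace.measurableSet hz
    have hpt : ∀ p ∈ halfSpace d, ((φ' p.1 p.2 τ + spaceLaplacian φ p.1 p.2 τ) * u p.1 p.2 τ -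
        φ p.1 p.2 τ * source F (flux u) p.2 τ) = Ψ (τ, p) +
        (spaceLaplacian φ p.1 p.2 τ * u p.1 p.2 τ -
          φ p.1 p.2 τ * spaceLaplacian u p.1 p.2 τ) := by
      intro p hp
      have := hsol.equation p.1 p.2 τ hp.1 (hpos τ hτ)
      simp only [Ψ]
      linear_combination (-φ p.1 p.2 τ) * this
    rw [setIntegral_congr_fun isOpen_halfSpace.measurableSet hpt, integral_add hΨD hi, h0, add_zero]
    exact (setIntegral_eq_of_subset_of_forall_sdiff_eq_zero isOpen_halfSpace.measurableSet hKD hz)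
  have hFTC : ∀ p ∈ K, ∫ τ in Ioc s r, Ψ (τ, p) =
      φ p.1 p.2 r * u p.1 p.2 r - φ p.1 p.2 s * u p.1 p.2 s := by
    intro p hp
    rw [← intervalIntegral.integral_of_le hsr]
    refine intervalIntegral.integral_eq_sub_of_hasDerivAt
      (f := fun τ => φ p.1 p.2 τ * u p.1 p.2 τ) (fun τ hτ => ?_) ?_
    · rw [uIcc_of_le hsr] at hτ
      exact (hφ' p.1 p.2 τ hτ).mul
        (hsol.regular.differentiableAt_time p.1 p.2 τ (hKD hp).1 (hpos τ hτ)).hasDerivAt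
    · refine ContinuousOn.intervalIntegrable ?_
      rw [uIcc_of_le hsr]
      exact hΨc.comp (by fun_prop) fun τ hτ => ⟨hτ, hp⟩
  have hend : ∀ τ ∈ Icc s r, IntegrableOn (fun p : ℝ × Tan d => φ p.1 p.2 τ * u p.1 p.2 τ) K ∧
      ∫ p in K, φ p.1 p.2 τ * u p.1 p.2 τ = ∫ p in halfSpace d, φ p.1 p.2 τ * u p.1 p.2 τ := by
    intro τ hτ
    refine ⟨ContinuousOn.integrableOn_compact hK ?_, ?_⟩
    · have h1 : ContinuousOn (fun q : ℝ × (ℝ × Tan d) => φ q.2.1 q.2.2 q.1 * u q.2.1 q.2.2 q.1)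
        (Icc s r ×ˢ K) := (hφc.mono hsub).mul huc
      exact h1.comp (f := fun p : ℝ × Tan d => (τ, p)) (by fun_prop) fun p hp => ⟨hτ, hp⟩
    · refine (setIntegral_eq_of_subset_of_forall_sdiff_eq_zero isOpen_halfSpace.measurableSet hKD
        fun p hp => ?_).symm
      rw [hφ0 p hp.2 τ, zero_mul]
  constructor
  · rw [intervalIntegrable_iff_integrableOn_Ioc_of_le hsr]
    refine IntegrableOn.congr_fun (f := fun τ => ∫ p in K, Ψ (τ, p)) hΨi'.integral_prod_left
      (fun τ hτ => (hslice τ (Ioc_subset_Icc_self hτ)).symm) measurableSet_Ioc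
  · rw [intervalIntegral.integral_of_le hsr, setIntegral_congr_fun measurableSet_Ioc
      fun τ hτ => hslice τ (Ioc_subset_Icc_self hτ), integral_integral_swap hΨi',
      setIntegral_congr_fun hKm hFTC, integral_sub (hend r ⟨hsr, le_rfl⟩).1 (hend s ⟨le_rfl, hsr⟩).1,
      (hend r ⟨hsr, le_rfl⟩).2, (hend s ⟨le_rfl, hsr⟩).2]

end WeakFormulation

/-! ### Heat kernels and Gaussian bounds -/

section Kernels

/-- The heat kernel of `ℝ^m` at time `σ`, as a function of the squared distance `q`. -/
noncomputable def heatKernel (m : ℕ) (q σ : ℝ) : ℝ :=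
  Real.exp (-q / (4 * σ)) / (2 * √(Real.pi * σ)) ^ m

/-- The Dirichlet heat kernel of the half-line, as a function of the elapsed time `σ`. -/
noncomputable def dirichletKernel (x ξ σ : ℝ) : ℝ :=
  heatKernel 1 ((x - ξ) ^ 2) σ - heatKernel 1 ((x + ξ) ^ 2) σ

/-- The derivative of `dirichletKernel` in `ξ`. -/
noncomputable def dirichletKernelDeriv (x ξ σ : ℝ) : ℝ :=
  (x - ξ) / (2 * σ) * heatKernel 1 ((x - ξ) ^ 2) σ +
    (x + ξ) / (2 * σ) * heatKernel 1 ((x + ξ) ^ 2) σ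

/-- The second derivative of `dirichletKernel` in `ξ`, and its derivative in `σ`. -/
noncomputable def dirichletKernelDeriv₂ (x ξ σ : ℝ) : ℝ :=
  ((x - ξ) ^ 2 / (4 * σ ^ 2) - 1 / (2 * σ)) * heatKernel 1 ((x - ξ) ^ 2) σ -
    ((x + ξ) ^ 2 / (4 * σ ^ 2) - 1 / (2 * σ)) * heatKernel 1 ((x + ξ) ^ 2) σ

theorem green_eq (x t ξ τ : ℝ) : green x t ξ τ = dirichletKernel x ξ (t - τ) := by
  simp [green, dirichletKernel, heatKernel, sub_div]

theorem green₁_eq {d : ℕ} (x : ℝ) (y : Tan d) (t ξ : ℝ) (η : Tan d) (τ : ℝ) :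
    green₁ x y t ξ η τ = heatKernel d (‖η - y‖ ^ 2) (t - τ) * dirichletKernel x ξ (t - τ) := by
  rw [green₁, green_eq, heatKernel, norm_sub_rev]

theorem heatKernel_nonneg (m : ℕ) (q σ : ℝ) : 0 ≤ heatKernel m q σ := by
  unfold heatKernel; positivity

theorem hasDerivAt_heatKernel_space (m : ℕ) (q σ : ℝ) :
    HasDerivAt (fun q => heatKernel m q σ) (-(1 / (4 * σ)) * heatKernel m q σ) q := by
  unfold heatKernel
  have := (((hasDerivAt_id q).neg.div_const (4 * σ)).exp).div_const ((2 * √(Real.pi * σ)) ^ m)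
  refine this.congr_deriv ?_
  simp only [id, Pi.neg_apply]
  ring

theorem hasDerivAt_heatKernel_time (m : ℕ) (q : ℝ) {σ : ℝ} (hσ : 0 < σ) :
    HasDerivAt (fun σ => heatKernel m q σ)
      ((q / (4 * σ ^ 2) - m / (2 * σ)) * heatKernel m q σ) σ := by
  have hπ := Real.pi_pos
  have hs : 0 < √(Real.pi * σ) := by positivity
  have hs2 : √(Real.pi * σ) ^ 2 = Real.pi * σ := Real.sq_sqrt (by positivity)
  have h1 : HasDerivAt (fun σ => (2 * √(Real.pi * σ))⁻¹)
      (-(1 / (2 * σ)) * (2 * √(Real.pi * σ))⁻¹) σ := by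
    have := ((((hasDerivAt_id σ).const_mul Real.pi).sqrt (by simp; positivity)).const_mul 2).inv
      (by simp; positivity)
    refine this.congr_deriv ?_
    simp only [id]
    field_simp
    rw [hs2]
  have h2 : HasDerivAt (fun σ => -q / (4 * σ)) (q / (4 * σ ^ 2)) σ := by
    have := (hasDerivAt_const σ (-q)).div ((hasDerivAt_id σ).const_mul 4) (by simp; positivity)
    refine this.congr_deriv ?_
    simp only [id]
    field_simp
    ring
  have h3 := h2.exp.mul (h1.pow m)
  refine (h3.congr_deriv (g' := (q / (4 * σ ^ 2) - m / (2 * σ)) * heatKernel m q σ)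
    ?_).congr_of_eventuallyEq
    (Eventually.of_forall fun σ => by
      simp only [heatKernel, div_eq_mul_inv, Pi.mul_apply, Pi.pow_apply, inv_pow])
  unfold heatKernel
  rw [Pi.pow_apply, div_eq_mul_inv (Real.exp _), ← inv_pow]
  generalize (2 * √(Real.pi * σ))⁻¹ = z
  rcases m with _ | m
  · simp; ring
  · simp only [Nat.add_sub_cancel, pow_succ]
    ring

theorem continuousOn_heatKernel (m : ℕ) :
    ContinuousOn (fun q : ℝ × ℝ => heatKernel m q.1 q.2) (univ ×ˢ Ioi 0) := by
  unfold heatKernel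
  refine ContinuousOn.div ?_ (by fun_prop) ?_
  · refine Real.continuous_exp.comp_continuousOn (ContinuousOn.div (by fun_prop) (by fun_prop) ?_)
    intro q hq
    have : 0 < q.2 := hq.2
    positivity
  · intro q hq
    have : 0 < q.2 := hq.2
    have := Real.pi_pos
    positivity

theorem hasDerivAt_dirichletKernel_space (x ξ : ℝ) {σ : ℝ} (hσ : 0 < σ) :
    HasDerivAt (fun ξ => dirichletKernel x ξ σ) (dirichletKernelDeriv x ξ σ) ξ := by
  have h1 := (hasDerivAt_heatKernel_space 1 ((x - ξ) ^ 2) σ).comp ξ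
    (((hasDerivAt_id ξ).const_sub x).pow 2)
  have h2 := (hasDerivAt_heatKernel_space 1 ((x + ξ) ^ 2) σ).comp ξ
    (((hasDerivAt_id ξ).const_add x).pow 2)
  refine (h1.sub h2).congr_deriv ?_
  simp only [dirichletKernelDeriv, id]
  field_simp
  ring

theorem hasDerivAt_dirichletKernelDeriv (x ξ : ℝ) {σ : ℝ} (hσ : 0 < σ) :
    HasDerivAt (fun ξ => dirichletKernelDeriv x ξ σ) (dirichletKernelDeriv₂ x ξ σ) ξ := by
  have h1 := (hasDerivAt_heatKernel_space 1 ((x - ξ) ^ 2) σ).comp ξ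
    (((hasDerivAt_id ξ).const_sub x).pow 2)
  have h2 := (hasDerivAt_heatKernel_space 1 ((x + ξ) ^ 2) σ).comp ξ
    (((hasDerivAt_id ξ).const_add x).pow 2)
  have h3 := (((hasDerivAt_id ξ).const_sub x).div_const (2 * σ)).mul h1
  have h4 := (((hasDerivAt_id ξ).const_add x).div_const (2 * σ)).mul h2
  refine (h3.add h4).congr_deriv ?_
  simp only [dirichletKernelDeriv₂, id, Function.comp_def, Pi.pow_apply]
  field_simp
  ring

theorem hasDerivAt_dirichletKernel_time (x ξ : ℝ) {σ : ℝ} (hσ : 0 < σ) :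
    HasDerivAt (fun σ => dirichletKernel x ξ σ) (dirichletKernelDeriv₂ x ξ σ) σ := by
  refine ((hasDerivAt_heatKernel_time 1 ((x - ξ) ^ 2) hσ).sub
    (hasDerivAt_heatKernel_time 1 ((x + ξ) ^ 2) hσ)).congr_deriv ?_
  simp [dirichletKernelDeriv₂]

theorem dirichletKernel_comm (x ξ σ : ℝ) : dirichletKernel x ξ σ = dirichletKernel ξ x σ := by
  unfold dirichletKernel
  congr 2 <;> ring

theorem hasDerivAt_dirichletKernel_zero (ξ : ℝ) {σ : ℝ} (hσ : 0 < σ) :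
    HasDerivAt (fun x => dirichletKernel x ξ σ) (ξ / σ * heatKernel 1 (ξ ^ 2) σ) 0 := by
  have := hasDerivAt_dirichletKernel_space ξ 0 hσ
  simp only [dirichletKernel_comm ξ] at this
  refine this.congr_deriv ?_
  simp only [dirichletKernelDeriv, sub_zero, add_zero]
  field_simp
  ring

theorem dirichletKernel_nonneg {x ξ σ : ℝ} (hx : 0 ≤ x) (hξ : 0 ≤ ξ) (hσ : 0 < σ) :
    0 ≤ dirichletKernel x ξ σ := by
  unfold dirichletKernel heatKernel
  rw [← sub_div]
  refine div_nonneg (sub_nonneg.2 (Real.exp_le_exp.2 ?_)) (by positivity)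
  gcongr ?_ / _
  nlinarith [mul_nonneg hx hξ]

/-- The Dirichlet kernel vanishes to first order on the boundary. -/
theorem dirichletKernel_le {x ξ σ : ℝ} (hσ : 0 < σ) :
    dirichletKernel x ξ σ ≤ x * ξ / σ * heatKernel 1 ((x - ξ) ^ 2) σ := by
  unfold dirichletKernel heatKernel
  rw [← sub_div, ← mul_div_assoc]
  gcongr
  have h1 : Real.exp (-(x + ξ) ^ 2 / (4 * σ)) =
      Real.exp (-(x * ξ / σ)) * Real.exp (-(x - ξ) ^ 2 / (4 * σ)) := by
    rw [← Real.exp_add]; congr 1; field_simp; ring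
  rw [h1]
  nlinarith [Real.add_one_le_exp (-(x * ξ / σ)), Real.exp_pos (-(x - ξ) ^ 2 / (4 * σ))]

theorem one_add_mul_exp_le {s c : ℝ} (hs : 0 ≤ s) (hc : 0 < c) :
    (1 + s) * Real.exp (-(2 * c * s)) ≤ (1 + 1 / c) * Real.exp (-(c * s)) := by
  have h1 : Real.exp (-(2 * c * s)) = Real.exp (-(c * s)) * Real.exp (-(c * s)) := by
    rw [← Real.exp_add]; congr 1; ring
  have h2 : (1 + s) ≤ (1 + 1 / c) * Real.exp (c * s) := by
    calc (1 + s) ≤ (1 + 1 / c) * (c * s + 1) := by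
          have : (1 + 1 / c) * (c * s + 1) = 1 + s + c * s + 1 / c := by field_simp; ring
          rw [this]; have : 0 ≤ c * s + 1 / c := by positivity
          linarith
      _ ≤ _ := by gcongr; exact Real.add_one_le_exp _
  rw [h1, ← mul_assoc]
  gcongr
  calc (1 + s) * Real.exp (-(c * s))
      ≤ (1 + 1 / c) * Real.exp (c * s) * Real.exp (-(c * s)) := by gcongr
    _ = 1 + 1 / c := by rw [mul_assoc, ← Real.exp_add]; simp

theorem exp_neg_mul_sq_norm_sub_le {V : Type*} [NormedAddCommGroup V] {c : ℝ} (hc : 0 ≤ c)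
    (y η : V) :
    Real.exp (-(c * ‖η - y‖ ^ 2)) ≤ Real.exp (c * ‖y‖ ^ 2) * Real.exp (-(c / 2 * ‖η‖ ^ 2)) := by
  rw [← Real.exp_add]
  refine Real.exp_le_exp.2 ?_
  have h1 : ‖η‖ ≤ ‖η - y‖ + ‖y‖ := by simpa using norm_add_le (η - y) y
  have h2 : ‖η‖ ^ 2 ≤ 2 * ‖η - y‖ ^ 2 + 2 * ‖y‖ ^ 2 := by
    nlinarith [norm_nonneg η, norm_nonneg (η - y), norm_nonneg y, sq_nonneg (‖η - y‖ - ‖y‖)]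
  nlinarith

theorem heatKernel_le (m : ℕ) {q σ₀ σ₁ σ : ℝ} (hq : 0 ≤ q) (h0 : 0 < σ₀) (hσ : σ ∈ Icc σ₀ σ₁) :
    heatKernel m q σ ≤ ((2 * √(Real.pi * σ₀)) ^ m)⁻¹ * Real.exp (-(1 / (4 * σ₁) * q)) := by
  have hσ0 : 0 < σ := h0.trans_le hσ.1
  have hπ := Real.pi_pos
  unfold heatKernel
  rw [div_eq_inv_mul]
  have : 0 < √(Real.pi * σ₀) := by positivity
  gcongr
  · exact hσ.1
  · rw [neg_div, neg_le_neg_iff, one_div_mul_eq_div]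
    have := hσ.2
    gcongr

theorem one_add_mul_heatKernel_le (m : ℕ) {q σ₀ σ₁ σ : ℝ} (hq : 0 ≤ q) (h0 : 0 < σ₀)
    (hσ : σ ∈ Icc σ₀ σ₁) :
    (1 + q) * heatKernel m q σ ≤
      ((2 * √(Real.pi * σ₀)) ^ m)⁻¹ * (1 + 8 * σ₁) * Real.exp (-(1 / (8 * σ₁) * q)) := by
  have h1 : 0 < σ₁ := h0.trans_le (hσ.1.trans hσ.2)
  have h2 := one_add_mul_exp_le (c := 1 / (8 * σ₁)) hq (by positivity)
  have h3 : 2 * (1 / (8 * σ₁)) * q = 1 / (4 * σ₁) * q := by field_simp; ring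
  rw [h3, one_div_one_div] at h2
  calc (1 + q) * heatKernel m q σ
      ≤ (1 + q) * (((2 * √(Real.pi * σ₀)) ^ m)⁻¹ * Real.exp (-(1 / (4 * σ₁) * q))) := by
        gcongr; exact heatKernel_le m hq h0 hσ
    _ = ((2 * √(Real.pi * σ₀)) ^ m)⁻¹ * ((1 + q) * Real.exp (-(1 / (4 * σ₁) * q))) := by ring
    _ ≤ _ := by rw [mul_assoc]; gcongr

/-- A Gaussian bound for the heat kernel, uniform for times in a compact interval and for centres in
a ball. The factor `1 + ‖η - y‖²` absorbs the polynomials that derivatives produce. -/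
theorem exists_one_add_mul_heatKernel_le {V : Type*} [NormedAddCommGroup V] (m : ℕ) (R : ℝ)
    {σ₀ σ₁ : ℝ} (h0 : 0 < σ₀) :
    ∃ C, 0 ≤ C ∧ ∀ σ ∈ Icc σ₀ σ₁, ∀ y η : V, ‖y‖ ≤ R →
      (1 + ‖η - y‖ ^ 2) * heatKernel m (‖η - y‖ ^ 2) σ ≤
        C * Real.exp (-(1 / (16 * σ₁) * ‖η‖ ^ 2)) := by
  by_cases h1 : 0 < σ₁
  swap
  · exact ⟨0, le_rfl, fun σ hσ => absurd (h0.trans_le (hσ.1.trans hσ.2)) h1⟩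
  refine ⟨((2 * √(Real.pi * σ₀)) ^ m)⁻¹ * (1 + 8 * σ₁) * Real.exp (1 / (8 * σ₁) * R ^ 2),
    by positivity, fun σ hσ y η hy => ?_⟩
  refine (one_add_mul_heatKernel_le m (by positivity) h0 hσ).trans ?_
  rw [mul_assoc _ (Real.exp _)]
  gcongr
  refine (exp_neg_mul_sq_norm_sub_le (by positivity) y η).trans ?_
  have h3 : 1 / (8 * σ₁) / 2 = 1 / (16 * σ₁) := by field_simp; norm_num
  rw [h3]
  gcongr

theorem integrable_exp_neg_mul_sq_norm {d : ℕ} {c : ℝ} (hc : 0 < c) :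
    Integrable (fun η : Tan d => Real.exp (-(c * ‖η‖ ^ 2))) := by
  have := (GaussianFourier.integrable_cexp_neg_mul_sq_norm_add (V := Tan d) (b := c) (by simpa)
    0 0).norm
  refine this.congr (ae_of_all _ fun η => ?_)
  simp only [Complex.norm_exp, zero_mul, add_zero]
  norm_cast
  rw [neg_mul]

/-- A Gaussian weight on `ℝ × ℝ^d`. -/
noncomputable def gaussWeight {d : ℕ} (c : ℝ) (p : ℝ × Tan d) : ℝ :=
  Real.exp (-(c * (p.1 ^ 2 + ‖p.2‖ ^ 2)))

theorem gaussWeight_eq {d : ℕ} (c : ℝ) (p : ℝ × Tan d) :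
    gaussWeight c p = Real.exp (-(c * p.1 ^ 2)) * Real.exp (-(c * ‖p.2‖ ^ 2)) := by
  rw [gaussWeight, ← Real.exp_add]; congr 1; ring

theorem integrable_gaussWeight {d : ℕ} {c : ℝ} (hc : 0 < c) :
    Integrable (gaussWeight c : ℝ × Tan d → ℝ) := by
  have := (integrable_exp_neg_mul_sq hc).mul_prod (integrable_exp_neg_mul_sq_norm (d := d) hc)
  rw [Measure.volume_eq_prod]
  refine this.congr (ae_of_all _ fun p => ?_)
  rw [gaussWeight_eq]
  simp

theorem exists_dirichletKernel_le (x : ℝ) {σ₀ σ₁ : ℝ} (h0 : 0 < σ₀) :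
    ∃ C, 0 ≤ C ∧ ∀ σ ∈ Icc σ₀ σ₁, ∀ ξ,
      |dirichletKernel x ξ σ| ≤ C * Real.exp (-(1 / (16 * σ₁) * ξ ^ 2)) ∧
      |dirichletKernelDeriv x ξ σ| ≤ C * Real.exp (-(1 / (16 * σ₁) * ξ ^ 2)) := by
  obtain ⟨C, hC, H⟩ := exists_one_add_mul_heatKernel_le (V := ℝ) 1 |x| (σ₁ := σ₁) h0
  have key : ∀ σ ∈ Icc σ₀ σ₁, ∀ ξ, (1 + (x - ξ) ^ 2) * heatKernel 1 ((x - ξ) ^ 2) σ ≤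
      C * Real.exp (-(1 / (16 * σ₁) * ξ ^ 2)) ∧ (1 + (x + ξ) ^ 2) * heatKernel 1 ((x + ξ) ^ 2) σ ≤
      C * Real.exp (-(1 / (16 * σ₁) * ξ ^ 2)) := by
    intro σ hσ ξ
    have h1 := H σ hσ x ξ (by simp)
    have h2 := H σ hσ (-x) ξ (by simp)
    simp only [Real.norm_eq_abs, sq_abs] at h1 h2
    rw [show (x - ξ) ^ 2 = (ξ - x) ^ 2 by ring, show (x + ξ) ^ 2 = (ξ - -x) ^ 2 by ring]
    exact ⟨h1, h2⟩
  refine ⟨2 * C * (1 + 1 / (2 * σ₀)), by positivity, fun σ hσ ξ => ?_⟩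
  obtain ⟨k1, k2⟩ := key σ hσ ξ
  set e := Real.exp (-(1 / (16 * σ₁) * ξ ^ 2)) with he
  have hσ0 : 0 < σ := h0.trans_le hσ.1
  have n1 := heatKernel_nonneg 1 ((x - ξ) ^ 2) σ
  have n2 := heatKernel_nonneg 1 ((x + ξ) ^ 2) σ
  have hq : 0 ≤ C * e := by positivity
  have hq' : 0 ≤ 1 / (2 * σ₀) := by positivity
  have b1 : heatKernel 1 ((x - ξ) ^ 2) σ ≤ C * e := by nlinarith [sq_nonneg (x - ξ)]
  have b2 : heatKernel 1 ((x + ξ) ^ 2) σ ≤ C * e := by nlinarith [sq_nonneg (x + ξ)]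
  have aux : ∀ z K : ℝ, 0 ≤ K → (1 + z ^ 2) * K ≤ C * e →
      |z / (2 * σ) * K| ≤ 1 / (2 * σ₀) * (C * e) := by
    intro z K hK hz
    rw [abs_mul, abs_of_nonneg hK, abs_div, abs_of_pos (by positivity : 0 < 2 * σ)]
    have : |z| ≤ 1 + z ^ 2 := by
      rw [← sq_abs z]; nlinarith [sq_nonneg (|z| - 1), abs_nonneg z]
    calc |z| / (2 * σ) * K ≤ (1 + z ^ 2) / (2 * σ₀) * K := by gcongr; exact hσ.1
      _ = 1 / (2 * σ₀) * ((1 + z ^ 2) * K) := by ring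
      _ ≤ _ := by gcongr
  constructor
  · unfold dirichletKernel
    rw [abs_le]
    constructor <;> nlinarith [mul_nonneg hq hq']
  · unfold dirichletKernelDeriv
    refine (abs_add_le _ _).trans ?_
    have a1 := aux _ _ n1 k1
    have a2 := aux _ _ n2 k2
    nlinarith

/-- Near the boundary the Dirichlet kernel is bounded by a Gaussian times the distance. -/
theorem exists_dirichletKernel_le_mul {σ : ℝ} (hσ : 0 < σ) :
    ∃ C, 0 ≤ C ∧ ∀ x ∈ Icc (0 : ℝ) 1, ∀ ξ, 0 ≤ ξ →
      |dirichletKernel x ξ σ| ≤ x * (C * Real.exp (-(1 / (16 * σ) * ξ ^ 2))) := by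
  obtain ⟨C, hC, H⟩ := exists_one_add_mul_heatKernel_le (V := ℝ) 1 1 (σ₁ := σ) hσ
  refine ⟨2 * C / σ, by positivity, fun x hx ξ hξ => ?_⟩
  have h1 := H σ ⟨le_rfl, le_rfl⟩ x ξ (by simpa [abs_of_nonneg hx.1] using hx.2)
  simp only [Real.norm_eq_abs, sq_abs] at h1
  rw [show (ξ - x) ^ 2 = (x - ξ) ^ 2 by ring] at h1
  rw [abs_of_nonneg (dirichletKernel_nonneg hx.1 hξ hσ)]
  refine (dirichletKernel_le hσ).trans ?_
  have h2 : ξ ≤ 2 * (1 + (x - ξ) ^ 2) := by nlinarith [hx.2, sq_nonneg (x - ξ + 1)]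
  have hx0 := hx.1
  calc x * ξ / σ * heatKernel 1 ((x - ξ) ^ 2) σ
      ≤ x * (2 * (1 + (x - ξ) ^ 2)) / σ * heatKernel 1 ((x - ξ) ^ 2) σ := by
        have := heatKernel_nonneg 1 ((x - ξ) ^ 2) σ
        gcongr
    _ = x * (2 / σ * ((1 + (x - ξ) ^ 2) * heatKernel 1 ((x - ξ) ^ 2) σ)) := by ring
    _ ≤ x * (2 / σ * (C * Real.exp (-(1 / (16 * σ) * ξ ^ 2)))) := by gcongr
    _ = _ := by ring

end Kernels

/-! ### Cutoff functions -/

section Cutoff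

/-- A smooth cutoff on the line, equal to `1` on `(-∞, 1]` and to `0` on `[2, ∞)`. -/
noncomputable def cutoff (s : ℝ) : ℝ := Real.smoothTransition (2 - s)

theorem contDiff_cutoff : ContDiff ℝ 3 cutoff :=
  Real.smoothTransition.contDiff.comp (contDiff_const.sub contDiff_id)

theorem cutoff_of_le_one {s : ℝ} (hs : s ≤ 1) : cutoff s = 1 :=
  Real.smoothTransition.one_of_one_le (by linarith)

theorem cutoff_of_two_le {s : ℝ} (hs : 2 ≤ s) : cutoff s = 0 :=
  Real.smoothTransition.zero_of_nonpos (by linarith)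

theorem cutoff_nonneg (s : ℝ) : 0 ≤ cutoff s := Real.smoothTransition.nonneg _

theorem cutoff_le_one (s : ℝ) : cutoff s ≤ 1 := Real.smoothTransition.le_one _

theorem abs_cutoff_le_one (s : ℝ) : |cutoff s| ≤ 1 := by
  rw [abs_of_nonneg (cutoff_nonneg s)]; exact cutoff_le_one s

theorem contDiff_deriv_cutoff : ContDiff ℝ 2 (deriv cutoff) :=
  (contDiff_succ_iff_deriv.1 (contDiff_cutoff : ContDiff ℝ (2 + 1) cutoff)).2.2

theorem contDiff_deriv_deriv_cutoff : ContDiff ℝ 1 (deriv (deriv cutoff)) :=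
  (contDiff_succ_iff_deriv.1 (contDiff_deriv_cutoff : ContDiff ℝ (1 + 1) (deriv cutoff))).2.2

theorem hasDerivAt_cutoff (s : ℝ) : HasDerivAt cutoff (deriv cutoff s) s :=
  (contDiff_cutoff.differentiable (by norm_num) s).hasDerivAt

theorem hasDerivAt_deriv_cutoff (s : ℝ) : HasDerivAt (deriv cutoff) (deriv (deriv cutoff) s) s :=
  (contDiff_deriv_cutoff.differentiable (by norm_num) s).hasDerivAt

theorem deriv_cutoff_eq_zero {s : ℝ} (hs : s ∉ Icc (1 : ℝ) 2) :
    deriv cutoff s = 0 ∧ deriv (deriv cutoff) s = 0 := by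
  have : ∃ c : ℝ, cutoff =ᶠ[𝓝 s] fun _ => c := by
    rcases lt_or_ge s 1 with h | h
    · exact ⟨1, by filter_upwards [Iio_mem_nhds h] with z hz using cutoff_of_le_one (le_of_lt hz)⟩
    · have h2 : 2 < s := by by_contra h2; exact hs ⟨h, not_lt.1 h2⟩
      exact ⟨0, by filter_upwards [Ioi_mem_nhds h2] with z hz using cutoff_of_two_le (le_of_lt hz)⟩
  obtain ⟨c, hc⟩ := this
  refine ⟨by rw [hc.deriv_eq]; simp, ?_⟩
  rw [hc.deriv.deriv_eq]
  simp

theorem exists_deriv_cutoff_le :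
    ∃ M, 0 ≤ M ∧ ∀ s, |deriv cutoff s| ≤ M ∧ |deriv (deriv cutoff) s| ≤ M := by
  obtain ⟨M1, h1⟩ := (isCompact_Icc (a := (1 : ℝ)) (b := 2)).exists_bound_of_continuousOn
    contDiff_deriv_cutoff.continuous.continuousOn
  obtain ⟨M2, h2⟩ := (isCompact_Icc (a := (1 : ℝ)) (b := 2)).exists_bound_of_continuousOn
    contDiff_deriv_deriv_cutoff.continuous.continuousOn
  refine ⟨max 0 (max M1 M2), le_max_left _ _, fun s => ?_⟩
  by_cases hs : s ∈ Icc (1 : ℝ) 2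
  · exact ⟨(h1 s hs).trans ((le_max_left _ _).trans (le_max_right _ _)),
      (h2 s hs).trans ((le_max_right _ _).trans (le_max_right _ _))⟩
  · simp [deriv_cutoff_eq_zero hs]

/-- A smooth cutoff on the half-line, supported in `[1/n, 2n]` and tending to `1` on `(0, ∞)`. -/
noncomputable def halfLineCutoff (n ξ : ℝ) : ℝ := cutoff (ξ / n) - cutoff (n * ξ)

theorem abs_halfLineCutoff_le_one (n ξ : ℝ) : |halfLineCutoff n ξ| ≤ 1 := by
  unfold halfLineCutoff
  rw [abs_le]
  constructor <;> linarith [cutoff_nonneg (ξ / n), cutoff_nonneg (n * ξ), cutoff_le_one (ξ / n),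
    cutoff_le_one (n * ξ)]

theorem halfLineCutoff_eq_zero {n ξ : ℝ} (hn : 1 ≤ n) (hξ : ξ ∉ Icc (1 / n) (2 * n)) :
    halfLineCutoff n ξ = 0 := by
  have hn0 : 0 < n := by linarith
  unfold halfLineCutoff
  rcases lt_or_ge ξ (1 / n) with h | h
  · have h1 : n * ξ < 1 := by rw [lt_div_iff₀ hn0] at h; linarith
    have h2 : ξ / n ≤ 1 := by
      rw [div_le_one hn0]; exact h.le.trans ((div_le_one hn0).2 hn |>.trans hn)
    rw [cutoff_of_le_one h1.le, cutoff_of_le_one h2, sub_self]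
  · have h3 : 2 * n < ξ := by by_contra h3; exact hξ ⟨h, not_lt.1 h3⟩
    have h1 : 2 ≤ ξ / n := by rw [le_div_iff₀ hn0]; exact h3.le
    have h2 : 2 ≤ n * ξ := by nlinarith
    rw [cutoff_of_two_le h1, cutoff_of_two_le h2, sub_self]

theorem hasDerivAt_halfLineCutoff (n ξ : ℝ) : HasDerivAt (halfLineCutoff n)
    (deriv cutoff (ξ / n) / n - n * deriv cutoff (n * ξ)) ξ := by
  have h1 := (hasDerivAt_cutoff (ξ / n)).comp ξ ((hasDerivAt_id ξ).div_const n)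
  have h2 := (hasDerivAt_cutoff (n * ξ)).comp ξ ((hasDerivAt_id ξ).const_mul n)
  refine (h1.sub h2).congr_deriv ?_
  ring

theorem hasDerivAt_deriv_halfLineCutoff (n ξ : ℝ) :
    HasDerivAt (fun ξ => deriv cutoff (ξ / n) / n - n * deriv cutoff (n * ξ))
    (deriv (deriv cutoff) (ξ / n) / n ^ 2 - n ^ 2 * deriv (deriv cutoff) (n * ξ)) ξ := by
  have h1 := ((hasDerivAt_deriv_cutoff (ξ / n)).comp ξ ((hasDerivAt_id ξ).div_const n)).div_const n
  have h2 := ((hasDerivAt_deriv_cutoff (n * ξ)).comp ξ ((hasDerivAt_id ξ).const_mul n)).const_mul n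
  refine (h1.sub h2).congr_deriv ?_
  ring

theorem tendsto_halfLineCutoff {ξ : ℝ} (hξ : 0 < ξ) :
    Tendsto (fun n => halfLineCutoff n ξ) atTop (𝓝 1) := by
  refine tendsto_const_nhds.congr' ?_
  filter_upwards [eventually_ge_atTop ξ, eventually_ge_atTop (2 / ξ), eventually_gt_atTop 0]
    with n h1 h2 h3
  rw [halfLineCutoff, cutoff_of_le_one ((div_le_one h3).2 h1),
    cutoff_of_two_le (by rwa [div_le_iff₀ hξ] at h2), sub_zero]

theorem tendsto_cutoff_div (s : ℝ) : Tendsto (fun n => cutoff (s / n)) atTop (𝓝 1) := by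
  refine tendsto_const_nhds.congr' ?_
  filter_upwards [eventually_ge_atTop s, eventually_gt_atTop 0] with n h1 h3
  rw [cutoff_of_le_one ((div_le_one h3).2 h1)]

end Cutoff

/-! ### The truncated Green's function -/

section TestFunction

variable {d : ℕ}

theorem spaceLaplacian_mul_radial {φ : ℝ → Tan d → ℝ → ℝ} {t : ℝ} {y : Tan d}
    {α α1 α2 P P1 P2 : ℝ → ℝ} (hφ : ∀ x η, φ x η t = α x * P (‖η - y‖ ^ 2))
    (hα1 : ∀ x, HasDerivAt α (α1 x) x) (hα2 : ∀ x, HasDerivAt α1 (α2 x) x)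
    (hP1 : ∀ s, HasDerivAt P (P1 s) s) (hP2 : ∀ s, HasDerivAt P1 (P2 s) s) (x : ℝ) (η : Tan d) :
    spaceLaplacian φ x η t = α2 x * P (‖η - y‖ ^ 2) +
      α x * (4 * ‖η - y‖ ^ 2 * P2 (‖η - y‖ ^ 2) + 2 * d * P1 (‖η - y‖ ^ 2)) := by
  unfold spaceLaplacian
  congr 1
  · have e1 : (fun x' => φ x' η t) = fun x' => α x' * P (‖η - y‖ ^ 2) := by
      funext x'; exact hφ x' η
    have e2 : deriv (fun x' => α x' * P (‖η - y‖ ^ 2)) = fun x' => α1 x' * P (‖η - y‖ ^ 2) := by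
      funext x'; exact ((hα1 x').mul_const _).deriv
    rw [e1, iteratedDeriv_succ, iteratedDeriv_one, e2]
    exact ((hα2 x).mul_const _).deriv
  · have e1 : (fun η' => φ x η' t) = fun η' => α x * P (‖η' - y‖ ^ 2) := by
      funext x'; exact hφ x x'
    rw [e1, laplacian_radial (P := fun s => α x * P s) (fun s => (hP1 s).const_mul (α x))
      (fun s => (hP2 s).const_mul (α x))]
    ring

/-- The truncated Green's function, as a function of `(ξ, ‖η - y‖², σ)`. -/
noncomputable def testKernel (d : ℕ) (x n ξ q σ : ℝ) : ℝ :=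
  halfLineCutoff n ξ * dirichletKernel x ξ σ * (cutoff (q / n) * heatKernel d q σ)

/-- The part of the commutator of the backward heat operator with the cutoffs that comes from
infinity. -/
noncomputable def farError (d : ℕ) (x n ξ q σ : ℝ) : ℝ :=
  (deriv (deriv cutoff) (ξ / n) / n ^ 2 * dirichletKernel x ξ σ +
      2 * (deriv cutoff (ξ / n) / n) * dirichletKernelDeriv x ξ σ) *
    (cutoff (q / n) * heatKernel d q σ) +
  halfLineCutoff n ξ * dirichletKernel x ξ σ *
    ((4 * q * (deriv (deriv cutoff) (q / n) / n ^ 2 - deriv cutoff (q / n) / n / (2 * σ)) +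
      2 * d * (deriv cutoff (q / n) / n)) * heatKernel d q σ)

/-- The part of the commutator of the backward heat operator with the cutoffs that comes from the
boundary, in the stretched variable `ζ = n ξ` and divided by `n`. -/
noncomputable def nearError (d : ℕ) (x n ζ q σ : ℝ) : ℝ :=
  (n * deriv (deriv cutoff) ζ * dirichletKernel x (ζ / n) σ +
      2 * deriv cutoff ζ * dirichletKernelDeriv x (ζ / n) σ) * (cutoff (q / n) * heatKernel d q σ)

theorem contDiff_heatKernel (m : ℕ) (σ : ℝ) : ContDiff ℝ 2 (fun q => heatKernel m q σ) := by
  unfold heatKernel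
  exact ((contDiff_id.neg.div_const _).exp).div_const _

theorem contDiff_dirichletKernel (x σ : ℝ) : ContDiff ℝ 2 (fun ξ => dirichletKernel x ξ σ) := by
  unfold dirichletKernel
  exact ((contDiff_heatKernel 1 σ).comp ((contDiff_const.sub contDiff_id).pow 2)).sub
    ((contDiff_heatKernel 1 σ).comp ((contDiff_const.add contDiff_id).pow 2))

theorem contDiff_halfLineCutoff (n : ℝ) : ContDiff ℝ 2 (halfLineCutoff n) := by
  have h : ContDiff ℝ 2 cutoff := contDiff_cutoff.of_le (by norm_num)
  unfold halfLineCutoff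
  exact (h.comp (contDiff_id.div_const n)).sub (h.comp (contDiff_const.mul contDiff_id))

theorem contDiff_testKernel (x n σ : ℝ) (y : Tan d) :
    ContDiff ℝ 2 (fun p : ℝ × Tan d => testKernel d x n p.1 (‖p.2 - y‖ ^ 2) σ) := by
  have h : ContDiff ℝ 2 cutoff := contDiff_cutoff.of_le (by norm_num)
  have hq : ContDiff ℝ 2 (fun p : ℝ × Tan d => ‖p.2 - y‖ ^ 2) :=
    (contDiff_snd.sub contDiff_const).norm_sq ℝ
  unfold testKernel
  exact (((contDiff_halfLineCutoff n).comp contDiff_fst).mul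
    ((contDiff_dirichletKernel x σ).comp contDiff_fst)).mul
    ((h.comp (hq.div_const n)).mul ((contDiff_heatKernel d σ).comp hq))

/-- The last two terms are minus the time derivative of the truncated Green's function, so that only
the commutator errors remain in the weak formulation. -/
theorem spaceLaplacian_testKernel (x n : ℝ) (y : Tan d) {t τ : ℝ} (hτ : τ < t) (ξ : ℝ)
    (η : Tan d) :
    spaceLaplacian (fun ξ η τ => testKernel d x n ξ (‖η - y‖ ^ 2) (t - τ)) ξ η τ =
      farError d x n ξ (‖η - y‖ ^ 2) (t - τ) - n * nearError d x n (n * ξ) (‖η - y‖ ^ 2) (t - τ) +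
      halfLineCutoff n ξ * dirichletKernelDeriv₂ x ξ (t - τ) *
        (cutoff (‖η - y‖ ^ 2 / n) * heatKernel d (‖η - y‖ ^ 2) (t - τ)) +
      halfLineCutoff n ξ * dirichletKernel x ξ (t - τ) * (cutoff (‖η - y‖ ^ 2 / n) *
        ((‖η - y‖ ^ 2 / (4 * (t - τ) ^ 2) - d / (2 * (t - τ))) *
          heatKernel d (‖η - y‖ ^ 2) (t - τ))) := by
  have hσ : 0 < t - τ := sub_pos.2 hτ
  set σ := t - τ
  have hα1 : ∀ ξ, HasDerivAt (fun ξ => halfLineCutoff n ξ * dirichletKernel x ξ σ) _ ξ := fun ξ =>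
    (hasDerivAt_halfLineCutoff n ξ).mul (hasDerivAt_dirichletKernel_space x ξ hσ)
  have hα2 : ∀ ξ, HasDerivAt (fun ξ => (deriv cutoff (ξ / n) / n - n * deriv cutoff (n * ξ)) *
      dirichletKernel x ξ σ + halfLineCutoff n ξ * dirichletKernelDeriv x ξ σ) _ ξ := fun ξ =>
    ((hasDerivAt_deriv_halfLineCutoff n ξ).mul (hasDerivAt_dirichletKernel_space x ξ hσ)).add
      ((hasDerivAt_halfLineCutoff n ξ).mul (hasDerivAt_dirichletKernelDeriv x ξ hσ))
  have hB1 : ∀ s, HasDerivAt (fun s => cutoff (s / n)) (deriv cutoff (s / n) / n) s := by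
    intro s
    have := (hasDerivAt_cutoff (s / n)).comp s ((hasDerivAt_id s).div_const n)
    exact this.congr_deriv (by ring)
  have hB2 : ∀ s, HasDerivAt (fun s => deriv cutoff (s / n) / n)
      (deriv (deriv cutoff) (s / n) / n ^ 2) s := by
    intro s
    have := ((hasDerivAt_deriv_cutoff (s / n)).comp s ((hasDerivAt_id s).div_const n)).div_const n
    exact this.congr_deriv (by ring)
  have hK := fun s => hasDerivAt_heatKernel_space d s σ
  have hP1 : ∀ s, HasDerivAt (fun s => cutoff (s / n) * heatKernel d s σ) _ s := fun s =>
    (hB1 s).mul (hK s)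
  have hP2 : ∀ s, HasDerivAt (fun s => deriv cutoff (s / n) / n * heatKernel d s σ +
      cutoff (s / n) * (-(1 / (4 * σ)) * heatKernel d s σ)) _ s := fun s =>
    ((hB2 s).mul (hK s)).add ((hB1 s).mul ((hK s).const_mul _))
  rw [spaceLaplacian_mul_radial (φ := fun ξ η τ => testKernel d x n ξ (‖η - y‖ ^ 2) (t - τ))
    (fun _ _ => rfl) hα1 hα2 hP1 hP2]
  by_cases hn : n = 0
  · subst hn
    simp only [farError, nearError, halfLineCutoff, div_zero, zero_mul, sub_self]
    simp
  · simp only [farError, nearError, mul_div_cancel_left₀ ξ hn]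
    field_simp
    ring

end TestFunction

/-! ### The truncated identity and the stretching of the normal variable -/

section TruncatedIdentity

variable {d : ℕ} {F : ℝ → ℝ} {h : ℝ → Tan d → ℝ} {u : ℝ → Tan d → ℝ → ℝ}

theorem continuousOn_heatKernel_comp {X : Type*} [TopologicalSpace X] (m : ℕ) {S : Set X}
    {q σ : X → ℝ} (hq : ContinuousOn q S) (hσ : ContinuousOn σ S) (hpos : ∀ z ∈ S, 0 < σ z) :
    ContinuousOn (fun z => heatKernel m (q z) (σ z)) S :=
  (continuousOn_heatKernel m).comp (hq.prodMk hσ) fun z hz => ⟨mem_univ _, hpos z hz⟩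

/-- The weak formulation tested with the truncated Green's function. -/
theorem IsSolution.truncated_identity (hsol : IsSolution F h u) (x : ℝ) (y : Tan d) {s r t : ℝ}
    (hs : 0 < s) (hsr : s ≤ r) (hrt : r < t) {n : ℝ} (hn : 1 ≤ n) :
    IntervalIntegrable (fun τ => ∫ p in halfSpace d,
      ((farError d x n p.1 (‖p.2 - y‖ ^ 2) (t - τ) -
          n * nearError d x n (n * p.1) (‖p.2 - y‖ ^ 2) (t - τ)) * u p.1 p.2 τ -
        testKernel d x n p.1 (‖p.2 - y‖ ^ 2) (t - τ) * source F (flux u) p.2 τ)) volume s r ∧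
    ∫ τ in s..r, ∫ p in halfSpace d,
      ((farError d x n p.1 (‖p.2 - y‖ ^ 2) (t - τ) -
          n * nearError d x n (n * p.1) (‖p.2 - y‖ ^ 2) (t - τ)) * u p.1 p.2 τ -
        testKernel d x n p.1 (‖p.2 - y‖ ^ 2) (t - τ) * source F (flux u) p.2 τ) =
      (∫ p in halfSpace d, testKernel d x n p.1 (‖p.2 - y‖ ^ 2) (t - r) * u p.1 p.2 r) -
        ∫ p in halfSpace d, testKernel d x n p.1 (‖p.2 - y‖ ^ 2) (t - s) * u p.1 p.2 s := by
  have hn0 : 0 < n := by linarith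
  let φ : ℝ → Tan d → ℝ → ℝ := fun ξ η τ => testKernel d x n ξ (‖η - y‖ ^ 2) (t - τ)
  let φ' : ℝ → Tan d → ℝ → ℝ := fun ξ η τ =>
    -(halfLineCutoff n ξ * dirichletKernelDeriv₂ x ξ (t - τ) *
        (cutoff (‖η - y‖ ^ 2 / n) * heatKernel d (‖η - y‖ ^ 2) (t - τ)) +
      halfLineCutoff n ξ * dirichletKernel x ξ (t - τ) * (cutoff (‖η - y‖ ^ 2 / n) *
        ((‖η - y‖ ^ 2 / (4 * (t - τ) ^ 2) - d / (2 * (t - τ))) *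
          heatKernel d (‖η - y‖ ^ 2) (t - τ))))
  have hpos : ∀ τ ∈ Icc s r, 0 < t - τ := fun τ hτ => sub_pos.2 (hτ.2.trans_lt hrt)
  set K : Set (ℝ × Tan d) := Icc (1 / n) (2 * n) ×ˢ Metric.closedBall y (√(2 * n)) with hKdef
  have hK : IsCompact K := isCompact_Icc.prod (isCompact_closedBall y _)
  have hKD : K ⊆ halfSpace d := fun p hp =>
    ⟨(by positivity : 0 < 1 / n).trans_le hp.1.1, mem_univ _⟩
  have hoff : ∀ p ∉ K, halfLineCutoff n p.1 = 0 ∨ cutoff (‖p.2 - y‖ ^ 2 / n) = 0 := by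
    intro p hp
    by_cases h1 : p.1 ∈ Icc (1 / n) (2 * n)
    · right
      have h2 : p.2 ∉ Metric.closedBall y (√(2 * n)) := fun h2 => hp ⟨h1, h2⟩
      rw [Metric.mem_closedBall, dist_eq_norm, not_le, Real.sqrt_lt' ] at h2
      · exact cutoff_of_two_le ((le_div_iff₀ hn0).2 h2.le)
      · by_contra h3
        have : ‖p.2 - y‖ = 0 := le_antisymm (not_lt.1 h3) (norm_nonneg _)
        rw [this] at h2
        exact absurd h2 (not_lt.2 (Real.sqrt_nonneg _))
    · exact Or.inl (halfLineCutoff_eq_zero hn h1)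
  have key := hsol.weak_formulation (φ := φ) (φ' := φ') hs hsr hK hKD ?_ ?_ ?_ ?_ ?_ ?_
  · have hcongr : ∀ τ ∈ Icc s r, (∫ p in halfSpace d,
        ((φ' p.1 p.2 τ + spaceLaplacian φ p.1 p.2 τ) * u p.1 p.2 τ -
          φ p.1 p.2 τ * source F (flux u) p.2 τ)) = ∫ p in halfSpace d,
        ((farError d x n p.1 (‖p.2 - y‖ ^ 2) (t - τ) -
          n * nearError d x n (n * p.1) (‖p.2 - y‖ ^ 2) (t - τ)) * u p.1 p.2 τ -
          testKernel d x n p.1 (‖p.2 - y‖ ^ 2) (t - τ) * source F (flux u) p.2 τ) := by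
      intro τ hτ
      congr 1
      funext p
      rw [spaceLaplacian_testKernel x n y (hτ.2.trans_lt hrt)]
      simp only [φ, φ']
      ring
    refine ⟨key.1.congr fun τ hτ => ?_, ?_⟩
    · rw [uIoc_of_le hsr] at hτ
      exact hcongr τ (Ioc_subset_Icc_self hτ)
    · rw [← key.2]
      refine intervalIntegral.integral_congr fun τ hτ => ?_
      rw [uIcc_of_le hsr] at hτ
      exact (hcongr τ hτ).symm
  · intro p hp τ
    rcases hoff p hp with h0 | h0 <;> simp [φ, testKernel, h0]
  · intro p hp τ
    rcases hoff p hp with h0 | h0 <;> simp [φ', h0]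
  · exact fun τ _ => contDiff_testKernel x n (t - τ) y
  · intro ξ η τ hτ
    have hd : HasDerivAt (fun τ => t - τ) (-1) τ := (hasDerivAt_id τ).const_sub t
    have h1 := (hasDerivAt_dirichletKernel_time x ξ (hpos τ hτ)).comp τ hd
    have h2 := (hasDerivAt_heatKernel_time d (‖η - y‖ ^ 2) (hpos τ hτ)).comp τ hd
    refine ((h1.const_mul (halfLineCutoff n ξ)).mul
      (h2.const_mul (cutoff (‖η - y‖ ^ 2 / n)))).congr_deriv ?_
    simp only [φ', Function.comp_apply]
    ring
  all_goals
    have hpos' : ∀ z ∈ Icc s r ×ˢ (univ : Set (ℝ × Tan d)), 0 < t - z.1 := fun z hz => hpos _ hz.1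
    have hσ : ContinuousOn (fun z : ℝ × (ℝ × Tan d) => t - z.1) (Icc s r ×ˢ univ) := by fun_prop
    have hK0 := continuousOn_heatKernel_comp d (q := fun z : ℝ × (ℝ × Tan d) => ‖z.2.2 - y‖ ^ 2)
      (by fun_prop) hσ hpos'
    have hK1 := continuousOn_heatKernel_comp 1 (q := fun z : ℝ × (ℝ × Tan d) => (x - z.2.1) ^ 2)
      (by fun_prop) hσ hpos'
    have hK2 := continuousOn_heatKernel_comp 1 (q := fun z : ℝ × (ℝ × Tan d) => (x + z.2.1) ^ 2)
      (by fun_prop) hσ hpos'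
    have hA : Continuous (fun z : ℝ × (ℝ × Tan d) => halfLineCutoff n z.2.1) :=
      (contDiff_halfLineCutoff n).continuous.comp (by fun_prop)
    have hB : Continuous (fun z : ℝ × (ℝ × Tan d) => cutoff (‖z.2.2 - y‖ ^ 2 / n)) :=
      contDiff_cutoff.continuous.comp (by fun_prop)
    have hne : ∀ z ∈ Icc s r ×ˢ (univ : Set (ℝ × Tan d)), 4 * (t - z.1) ^ 2 ≠ 0 := fun z hz => by
      have := hpos' z hz
      positivity
    have hne2 : ∀ z ∈ Icc s r ×ˢ (univ : Set (ℝ × Tan d)), 2 * (t - z.1) ≠ 0 := fun z hz => by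
      have := hpos' z hz
      positivity
  · exact (hA.continuousOn.mul (hK1.sub hK2)).mul (hB.continuousOn.mul hK0)
  · have hd2 : ∀ q : ℝ × (ℝ × Tan d) → ℝ, Continuous q → ∀ c : ℝ, ContinuousOn
        (fun z => q z / (4 * (t - z.1) ^ 2) - c / (2 * (t - z.1))) (Icc s r ×ˢ univ) :=
      fun q hq c => (hq.continuousOn.div (by fun_prop) hne).sub
        (continuousOn_const.div (by fun_prop) hne2)
    refine (((hA.continuousOn.mul (((hd2 _ ?_ 1).mul hK1).sub ((hd2 _ ?_ 1).mul hK2))).mul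
      (hB.continuousOn.mul hK0)).add ((hA.continuousOn.mul (hK1.sub hK2)).mul
        (hB.continuousOn.mul ((hd2 _ ?_ d).mul hK0)))).neg <;> fun_prop

/-- Stretching the normal variable. -/
theorem integral_halfSpace_stretch {n : ℝ} (hn : 0 < n) (g : ℝ × Tan d → ℝ) :
    (IntegrableOn g (halfSpace d) →
      IntegrableOn (fun p : ℝ × Tan d => n * g (n * p.1, p.2)) (halfSpace d)) ∧
    ∫ p in halfSpace d, n * g (n * p.1, p.2) = ∫ p in halfSpace d, g p := by
  have hemb : MeasurableEmbedding (Prod.map (n * ·) id : ℝ × Tan d → ℝ × Tan d) :=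
    (measurableEmbedding_mulLeft₀ hn.ne').prodMap MeasurableEmbedding.id
  have hmap : Measure.map (Prod.map (n * ·) id : ℝ × Tan d → ℝ × Tan d) volume =
      ENNReal.ofReal n⁻¹ • volume := by
    rw [Measure.volume_eq_prod, ← Measure.map_prod_map _ _ (measurable_const_mul n) measurable_id,
      Real.map_volume_mul_left hn.ne', Measure.map_id, Measure.prod_smul_left,
      abs_of_pos (inv_pos.2 hn)]
  have hpre : (Prod.map (n * ·) id : ℝ × Tan d → ℝ × Tan d) ⁻¹' (halfSpace d) = halfSpace d := by
    ext p
    simp [halfSpace, hn]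
  refine ⟨fun hg => ?_, ?_⟩
  · have h1 : IntegrableOn g (halfSpace d) (Measure.map (Prod.map (n * ·) id) volume) := by
      rw [hmap, IntegrableOn, Measure.restrict_smul]
      exact hg.integrable.smul_measure ENNReal.ofReal_ne_top
    rw [hemb.integrableOn_map_iff, hpre] at h1
    exact h1.const_mul n
  have := hemb.setIntegral_map (μ := volume) g (halfSpace d)
  rw [hmap, hpre, Measure.restrict_smul, integral_smul_measure,
    ENNReal.toReal_ofReal (inv_nonneg.2 hn.le), smul_eq_mul] at this
  rw [integral_const_mul]
  change n * ∫ p in halfSpace d, g (Prod.map (n * ·) id p) = _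
  rw [← this, mul_inv_cancel_left₀ hn.ne']

end TruncatedIdentity

/-! ### Removal of the cutoffs -/

section SliceLimit

variable {d : ℕ}

/-- The commutator errors and the truncated kernel have a common Gaussian bound. The far error decays
in `n`; the near error stays bounded because the Dirichlet kernel vanishes to first order, and it
lives on `1 ≤ ζ ≤ 2`, where any Gaussian is bounded below. -/
theorem exists_error_bounds (d : ℕ) {x : ℝ} (hx : 0 ≤ x) (y : Tan d) {σ₀ σ₁ : ℝ} (h0 : 0 < σ₀) :
    ∃ C, 0 ≤ C ∧ ∀ σ ∈ Icc σ₀ σ₁, ∀ n : ℝ, 1 ≤ n → ∀ ξ : ℝ, 0 < ξ → ∀ η : Tan d,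
      |farError d x n ξ (‖η - y‖ ^ 2) σ| ≤ C / n *
        (Real.exp (-(1 / (16 * σ₁) * ξ ^ 2)) * Real.exp (-(1 / (16 * σ₁) * ‖η‖ ^ 2))) ∧
      |testKernel d x n ξ (‖η - y‖ ^ 2) σ| ≤ C *
        (Real.exp (-(1 / (16 * σ₁) * ξ ^ 2)) * Real.exp (-(1 / (16 * σ₁) * ‖η‖ ^ 2))) ∧
      |nearError d x n ξ (‖η - y‖ ^ 2) σ| ≤ C *
        (Real.exp (-(1 / (16 * σ₁) * ξ ^ 2)) * Real.exp (-(1 / (16 * σ₁) * ‖η‖ ^ 2))) := by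
  obtain ⟨C1, hC1, H1⟩ := exists_dirichletKernel_le x (σ₁ := σ₁) h0
  obtain ⟨C2, hC2, H2⟩ := exists_one_add_mul_heatKernel_le (V := Tan d) d ‖y‖ (σ₁ := σ₁) h0
  obtain ⟨M, hM, HM⟩ := exists_deriv_cutoff_le
  by_cases h1 : 0 < σ₁
  swap
  · exact ⟨0, le_rfl, fun σ hσ => absurd (h0.trans_le (hσ.1.trans hσ.2)) h1⟩
  set Mf : ℝ := 3 * M + (4 * M + 4 * (M / (2 * σ₀)) + 2 * d * M) with hMf
  set C3 : ℝ := ((2 * √(Real.pi * σ₀)) ^ 1)⁻¹ with hC3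
  set Mn : ℝ := M * (2 * x / σ₀ * C3) + 2 * M * C1 with hMn
  have hC30 : 0 ≤ C3 := by positivity
  refine ⟨Mf * C1 * C2 + C1 * C2 + Mn * Real.exp (1 / (16 * σ₁) * 4) * C2, by positivity,
    fun σ hσ n hn ξ hξ η => ?_⟩
  have hσ0 : 0 < σ := h0.trans_le hσ.1
  have hn0 : 0 < n := by linarith
  have hnn : (n ^ 2)⁻¹ ≤ n⁻¹ := inv_anti₀ hn0 (by nlinarith)
  set q := ‖η - y‖ ^ 2 with hq
  have hq0 : 0 ≤ q := by positivity
  set e1 := Real.exp (-(1 / (16 * σ₁) * ξ ^ 2)) with he1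
  set e2 := Real.exp (-(1 / (16 * σ₁) * ‖η‖ ^ 2)) with he2
  have e1p : 0 < e1 := Real.exp_pos _
  have e2p : 0 < e2 := Real.exp_pos _
  have hK := H2 σ hσ y η le_rfl
  rw [← hq, ← he2] at hK
  have hK0 := heatKernel_nonneg d q σ
  have hK1 : heatKernel d q σ ≤ C2 * e2 := by nlinarith
  have hBK : |cutoff (q / n) * heatKernel d q σ| ≤ C2 * e2 := by
    rw [abs_mul, abs_of_nonneg hK0]
    calc _ ≤ 1 * heatKernel d q σ := by gcongr; exact abs_cutoff_le_one _
      _ ≤ _ := by rwa [one_mul]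
  obtain ⟨D0, D1⟩ := H1 σ hσ ξ
  rw [← he1] at D0 D1
  have hAD : |halfLineCutoff n ξ * dirichletKernel x ξ σ| ≤ C1 * e1 := by
    rw [abs_mul]
    calc _ ≤ 1 * (C1 * e1) := by gcongr; exact abs_halfLineCutoff_le_one _ _
      _ = _ := one_mul _
  have hc1 : ∀ s, |deriv cutoff s / n| ≤ M / n := fun s => by
    rw [abs_div, abs_of_pos hn0]; gcongr; exact (HM s).1
  have hc2 : ∀ s, |deriv (deriv cutoff) s / n ^ 2| ≤ M / n := fun s => by
    rw [abs_div, abs_of_pos (by positivity : 0 < n ^ 2), div_eq_mul_inv, div_eq_mul_inv]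
    gcongr; exact (HM s).2
  refine ⟨?_, ?_, ?_⟩
  · have p1 : |deriv (deriv cutoff) (ξ / n) / n ^ 2 * dirichletKernel x ξ σ +
        2 * (deriv cutoff (ξ / n) / n) * dirichletKernelDeriv x ξ σ| ≤ 3 * M / n * (C1 * e1) := by
      calc _ ≤ |deriv (deriv cutoff) (ξ / n) / n ^ 2| * |dirichletKernel x ξ σ| +
            2 * |deriv cutoff (ξ / n) / n| * |dirichletKernelDeriv x ξ σ| := by
            refine (abs_add_le _ _).trans (le_of_eq ?_)
            rw [abs_mul, abs_mul, abs_mul, abs_two]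
        _ ≤ M / n * (C1 * e1) + 2 * (M / n) * (C1 * e1) := by
            gcongr
            · exact hc2 _
            · exact hc1 _
        _ = _ := by ring
    have p2 : |4 * q * (deriv (deriv cutoff) (q / n) / n ^ 2 - deriv cutoff (q / n) / n / (2 * σ)) +
        2 * d * (deriv cutoff (q / n) / n)| ≤
        (4 * M + 4 * (M / (2 * σ₀)) + 2 * d * M) / n * (1 + q) := by
      have p3 : |deriv cutoff (q / n) / n / (2 * σ)| ≤ M / n / (2 * σ₀) := by
        rw [abs_div, abs_of_pos (by positivity : 0 < 2 * σ)]
        gcongr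
        · exact hc1 _
        · exact hσ.1
      calc _ ≤ 4 * q * (|deriv (deriv cutoff) (q / n) / n ^ 2| +
              |deriv cutoff (q / n) / n / (2 * σ)|) + 2 * d * |deriv cutoff (q / n) / n| := by
            refine (abs_add_le _ _).trans ?_
            rw [abs_mul, abs_mul (2 * (d : ℝ)), abs_of_nonneg (by positivity : 0 ≤ 4 * q),
              abs_of_nonneg (by positivity : (0 : ℝ) ≤ 2 * d)]
            gcongr
            exact abs_sub _ _
        _ ≤ 4 * q * (M / n + M / n / (2 * σ₀)) + 2 * d * (M / n) := by
            gcongr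
            · exact hc2 _
            · exact hc1 _
        _ ≤ 4 * (1 + q) * (M / n + M / n / (2 * σ₀)) + 2 * d * (M / n) * (1 + q) := by
            have : 2 * d * (M / n) * 1 ≤ 2 * d * (M / n) * (1 + q) := by gcongr; linarith
            have h3 : 4 * q * (M / n + M / n / (2 * σ₀)) ≤
              4 * (1 + q) * (M / n + M / n / (2 * σ₀)) := by gcongr; linarith
            linarith
        _ = _ := by ring
    have p4 : |(4 * q * (deriv (deriv cutoff) (q / n) / n ^ 2 -
        deriv cutoff (q / n) / n / (2 * σ)) + 2 * d * (deriv cutoff (q / n) / n)) *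
          heatKernel d q σ| ≤ (4 * M + 4 * (M / (2 * σ₀)) + 2 * d * M) / n * (C2 * e2) := by
      rw [abs_mul, abs_of_nonneg hK0]
      calc _ ≤ (4 * M + 4 * (M / (2 * σ₀)) + 2 * d * M) / n * (1 + q) * heatKernel d q σ := by
            gcongr
        _ = (4 * M + 4 * (M / (2 * σ₀)) + 2 * d * M) / n * ((1 + q) * heatKernel d q σ) := by ring
        _ ≤ _ := by gcongr
    have p5 : |farError d x n ξ q σ| ≤ 3 * M / n * (C1 * e1) * (C2 * e2) +
        C1 * e1 * ((4 * M + 4 * (M / (2 * σ₀)) + 2 * d * M) / n * (C2 * e2)) := by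
      unfold farError
      refine (abs_add_le _ _).trans ?_
      rw [abs_mul, abs_mul (halfLineCutoff n ξ * _)]
      gcongr
    refine p5.trans ?_
    calc _ = Mf * C1 * C2 / n * (e1 * e2) := by rw [hMf]; ring
      _ ≤ _ := by
        gcongr
        have : 0 ≤ C1 * C2 + Mn * Real.exp (1 / (16 * σ₁) * 4) * C2 := by positivity
        linarith
  · have p5 : |testKernel d x n ξ q σ| ≤ C1 * e1 * (C2 * e2) := by
      unfold testKernel
      rw [abs_mul]
      gcongr
    refine p5.trans ?_
    calc _ = C1 * C2 * (e1 * e2) := by ring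
      _ ≤ _ := by
        gcongr
        have : 0 ≤ Mf * C1 * C2 + Mn * Real.exp (1 / (16 * σ₁) * 4) * C2 := by positivity
        linarith
  · by_cases hξ2 : ξ ∈ Icc (1 : ℝ) 2
    swap
    · rw [nearError, (deriv_cutoff_eq_zero hξ2).1, (deriv_cutoff_eq_zero hξ2).2]
      simp only [mul_zero, zero_mul, add_zero, abs_zero]
      positivity
    have p1 : n * |dirichletKernel x (ξ / n) σ| ≤ 2 * x / σ₀ * C3 := by
      rw [abs_of_nonneg (dirichletKernel_nonneg hx (by positivity) hσ0)]
      have k1 : heatKernel 1 ((x - ξ / n) ^ 2) σ ≤ C3 := by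
        refine (heatKernel_le 1 (sq_nonneg _) h0 hσ).trans ?_
        refine mul_le_of_le_one_right hC30 (Real.exp_le_one_iff.2 ?_)
        have : 0 ≤ 1 / (4 * σ₁) * (x - ξ / n) ^ 2 := by positivity
        linarith
      have k0 := heatKernel_nonneg 1 ((x - ξ / n) ^ 2) σ
      calc n * dirichletKernel x (ξ / n) σ
          ≤ n * (x * (ξ / n) / σ * heatKernel 1 ((x - ξ / n) ^ 2) σ) := by
            gcongr; exact dirichletKernel_le hσ0
        _ = ξ * x / σ * heatKernel 1 ((x - ξ / n) ^ 2) σ := by field_simp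
        _ ≤ _ := by
          gcongr
          · exact hξ2.2
          · exact hσ.1
    have p2 : |dirichletKernelDeriv x (ξ / n) σ| ≤ C1 := by
      refine (H1 σ hσ (ξ / n)).2.trans (mul_le_of_le_one_right hC1 (Real.exp_le_one_iff.2 ?_))
      have : 0 ≤ 1 / (16 * σ₁) * (ξ / n) ^ 2 := by positivity
      linarith
    have p3 : |n * deriv (deriv cutoff) ξ * dirichletKernel x (ξ / n) σ +
        2 * deriv cutoff ξ * dirichletKernelDeriv x (ξ / n) σ| ≤ Mn := by
      refine (abs_add_le _ _).trans ?_
      rw [abs_mul, abs_mul, abs_mul, abs_mul, abs_two, abs_of_pos hn0, hMn]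
      have m1 := (HM ξ).1
      have m2 := (HM ξ).2
      calc _ = |deriv (deriv cutoff) ξ| * (n * |dirichletKernel x (ξ / n) σ|) +
            2 * |deriv cutoff ξ| * |dirichletKernelDeriv x (ξ / n) σ| := by ring
        _ ≤ _ := by gcongr
    have p4 : 1 ≤ Real.exp (1 / (16 * σ₁) * 4) * e1 := by
      rw [he1, ← Real.exp_add]
      refine Real.one_le_exp ?_
      have : ξ ^ 2 ≤ 4 := by nlinarith [hξ2.2]
      have : 0 ≤ 1 / (16 * σ₁) * (4 - ξ ^ 2) := by
        have : 0 ≤ 4 - ξ ^ 2 := by linarith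
        positivity
      linarith
    have hMn0 : 0 ≤ Mn := by positivity
    have p5 : |nearError d x n ξ q σ| ≤ Mn * (C2 * e2) := by
      unfold nearError
      rw [abs_mul]
      gcongr
    refine p5.trans ?_
    calc Mn * (C2 * e2) = Mn * (C2 * e2) * 1 := by ring
      _ ≤ Mn * (C2 * e2) * (Real.exp (1 / (16 * σ₁) * 4) * e1) := by gcongr
      _ = Mn * Real.exp (1 / (16 * σ₁) * 4) * C2 * (e1 * e2) := by ring
      _ ≤ _ := by
        gcongr
        have : 0 ≤ Mf * C1 * C2 + C1 * C2 := by positivity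
        linarith

/-- Half of the decay of the kernels pays for the growth of the solution. -/
theorem exp_mul_exp_mul_exp_eq_gaussWeight {σ₁ : ℝ} (ξ : ℝ) (η : Tan d) :
    Real.exp (-(1 / (16 * σ₁) * ξ ^ 2)) * Real.exp (-(1 / (16 * σ₁) * ‖η‖ ^ 2)) *
      Real.exp (1 / (32 * σ₁) * (ξ ^ 2 + ‖η‖ ^ 2)) = gaussWeight (1 / (32 * σ₁)) (ξ, η) := by
  rw [gaussWeight, ← Real.exp_add, ← Real.exp_add]
  congr 1
  have : 1 / (16 * σ₁) = 2 * (1 / (32 * σ₁)) := by ring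
  rw [this]; ring

theorem continuous_dirichletKernel (x σ : ℝ) : Continuous (fun ξ => dirichletKernel x ξ σ) :=
  (contDiff_dirichletKernel x σ).continuous

theorem continuous_dirichletKernelDeriv (x σ : ℝ) :
    Continuous (fun ξ => dirichletKernelDeriv x ξ σ) := by
  unfold dirichletKernelDeriv
  have := (contDiff_heatKernel 1 σ).continuous
  exact ((by fun_prop : Continuous fun ξ : ℝ => (x - ξ) / (2 * σ)).mul
    (this.comp (by fun_prop))).add
    ((by fun_prop : Continuous fun ξ : ℝ => (x + ξ) / (2 * σ)).mul (this.comp (by fun_prop)))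

theorem continuous_farError (x n σ : ℝ) (y : Tan d) :
    Continuous (fun p : ℝ × Tan d => farError d x n p.1 (‖p.2 - y‖ ^ 2) σ) := by
  have c0 := contDiff_cutoff.continuous
  have c1 := contDiff_deriv_cutoff.continuous
  have c2 := contDiff_deriv_deriv_cutoff.continuous
  have k := (contDiff_heatKernel d σ).continuous
  have g0 := (continuous_dirichletKernel x σ).comp (continuous_fst (X := ℝ) (Y := Tan d))
  have g1 := (continuous_dirichletKernelDeriv x σ).comp (continuous_fst (X := ℝ) (Y := Tan d))
  have a := (contDiff_halfLineCutoff n).continuous.comp (continuous_fst (X := ℝ) (Y := Tan d))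
  have hq : Continuous (fun p : ℝ × Tan d => ‖p.2 - y‖ ^ 2) := by fun_prop
  have hqn := hq.div_const n
  have hξn : Continuous (fun p : ℝ × Tan d => p.1 / n) := by fun_prop
  unfold farError
  exact (((((c2.comp hξn).div_const _).mul g0).add
    ((((c1.comp hξn).div_const n).const_mul 2).mul g1)).mul
    ((c0.comp hqn).mul (k.comp hq))).add ((a.mul g0).mul
      ((((hq.const_mul 4).mul (((c2.comp hqn).div_const _).sub
        (((c1.comp hqn).div_const n).div_const _))).add
          (((c1.comp hqn).div_const n).const_mul _)).mul (k.comp hq)))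

theorem continuous_nearError (x n σ : ℝ) (y : Tan d) :
    Continuous (fun p : ℝ × Tan d => nearError d x n p.1 (‖p.2 - y‖ ^ 2) σ) := by
  have c0 := contDiff_cutoff.continuous
  have c1 := contDiff_deriv_cutoff.continuous.comp (continuous_fst (X := ℝ) (Y := Tan d))
  have c2 := contDiff_deriv_deriv_cutoff.continuous.comp (continuous_fst (X := ℝ) (Y := Tan d))
  have k := (contDiff_heatKernel d σ).continuous
  have hξn : Continuous (fun p : ℝ × Tan d => p.1 / n) := by fun_prop
  have g0 := (continuous_dirichletKernel x σ).comp hξn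
  have g1 := (continuous_dirichletKernelDeriv x σ).comp hξn
  have hq : Continuous (fun p : ℝ × Tan d => ‖p.2 - y‖ ^ 2) := by fun_prop
  unfold nearError
  exact (((c2.const_mul n).mul g0).add ((c1.const_mul 2).mul g1)).mul
    ((c0.comp (hq.div_const n)).mul (k.comp hq))

/-- Removing the cutoffs at a fixed time: the commutator errors tend to `0`, because `v` is
controlled at infinity and vanishes at the boundary. The bound is uniform in the time. -/
theorem exists_slice_bound (d : ℕ) {x : ℝ} (hx : 0 ≤ x) (y : Tan d) {σ₀ σ₁ Cu Cf : ℝ}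
    (h0 : 0 < σ₀) (h1 : 0 < σ₁) (hCu : 0 ≤ Cu) :
    ∃ C, ∀ σ ∈ Icc σ₀ σ₁, ∀ (v : ℝ → Tan d → ℝ) (g : ℝ → Tan d → ℝ),
      ContinuousOn (fun p : ℝ × Tan d => v p.1 p.2) (halfSpace d) →
      ContinuousOn (fun p : ℝ × Tan d => g p.1 p.2) (halfSpace d) →
      (∀ ξ η, 0 < ξ → |v ξ η| ≤ Cu * Real.exp (1 / (32 * σ₁) * (ξ ^ 2 + ‖η‖ ^ 2))) →
      (∀ ξ η, 0 < ξ → |g ξ η| ≤ Cf * Real.exp (1 / (32 * σ₁) * (ξ ^ 2 + ‖η‖ ^ 2))) →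
      (∀ η, Tendsto (fun ξ => v ξ η) (𝓝[>] 0) (𝓝 0)) →
      (∀ n : ℝ, 1 ≤ n → |∫ p in halfSpace d, ((farError d x n p.1 (‖p.2 - y‖ ^ 2) σ -
          n * nearError d x n (n * p.1) (‖p.2 - y‖ ^ 2) σ) * v p.1 p.2 -
        testKernel d x n p.1 (‖p.2 - y‖ ^ 2) σ * g p.1 p.2)| ≤ C) ∧
      Tendsto (fun n : ℝ => ∫ p in halfSpace d, ((farError d x n p.1 (‖p.2 - y‖ ^ 2) σ -
          n * nearError d x n (n * p.1) (‖p.2 - y‖ ^ 2) σ) * v p.1 p.2 -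
        testKernel d x n p.1 (‖p.2 - y‖ ^ 2) σ * g p.1 p.2)) atTop
        (𝓝 (-∫ p in halfSpace d, dirichletKernel x p.1 σ * heatKernel d (‖p.2 - y‖ ^ 2) σ *
          g p.1 p.2)) := by
  obtain ⟨C, hC, H⟩ := exists_error_bounds d hx y (σ₁ := σ₁) h0
  set W : ℝ × Tan d → ℝ := gaussWeight (1 / (32 * σ₁)) with hW
  have hWi : IntegrableOn W (halfSpace d) := (integrable_gaussWeight (by positivity)).integrableOn
  have hW0 : ∀ p, 0 ≤ W p := fun p => (Real.exp_pos _).le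
  have hD : MeasurableSet (halfSpace d) := isOpen_halfSpace.measurableSet
  refine ⟨(∫ p in halfSpace d, (C * Cu + C * Cf) * W p) + ∫ p in halfSpace d, C * Cu * W p, ?_⟩
  intro σ hσ v g hv hg hvb hgb hv0
  have hσ0 : 0 < σ := h0.trans_le hσ.1
  -- the part from infinity together with the source, and the stretched boundary part
  let I : ℝ → ℝ × Tan d → ℝ := fun n p => farError d x n p.1 (‖p.2 - y‖ ^ 2) σ * v p.1 p.2 -
    testKernel d x n p.1 (‖p.2 - y‖ ^ 2) σ * g p.1 p.2
  let J : ℝ → ℝ × Tan d → ℝ := fun n p => nearError d x n p.1 (‖p.2 - y‖ ^ 2) σ * v (p.1 / n) p.2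
  have hfar : ∀ n : ℝ, 1 ≤ n → ∀ p ∈ halfSpace d,
      |farError d x n p.1 (‖p.2 - y‖ ^ 2) σ * v p.1 p.2| ≤ C * Cu / n * W p := by
    intro n hn p hp
    have hn0 : 0 < n := by linarith
    rw [abs_mul]
    calc _ ≤ C / n * (Real.exp (-(1 / (16 * σ₁) * p.1 ^ 2)) *
            Real.exp (-(1 / (16 * σ₁) * ‖p.2‖ ^ 2))) *
          (Cu * Real.exp (1 / (32 * σ₁) * (p.1 ^ 2 + ‖p.2‖ ^ 2))) := by
          gcongr
          · exact (H σ hσ n hn p.1 hp.1 p.2).1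
          · exact hvb p.1 p.2 hp.1
      _ = C * Cu / n * (Real.exp (-(1 / (16 * σ₁) * p.1 ^ 2)) *
            Real.exp (-(1 / (16 * σ₁) * ‖p.2‖ ^ 2)) *
            Real.exp (1 / (32 * σ₁) * (p.1 ^ 2 + ‖p.2‖ ^ 2))) := by ring
      _ = _ := by rw [exp_mul_exp_mul_exp_eq_gaussWeight]
  have htest : ∀ n : ℝ, 1 ≤ n → ∀ p ∈ halfSpace d,
      |testKernel d x n p.1 (‖p.2 - y‖ ^ 2) σ * g p.1 p.2| ≤ C * Cf * W p := by
    intro n hn p hp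
    have hCf : 0 ≤ Cf := by
      by_contra hneg
      have := (abs_nonneg _).trans (hgb 1 0 one_pos)
      have h2 := Real.exp_pos (1 / (32 * σ₁) * (1 ^ 2 + ‖(0 : Tan d)‖ ^ 2))
      nlinarith
    rw [abs_mul]
    calc _ ≤ C * (Real.exp (-(1 / (16 * σ₁) * p.1 ^ 2)) *
            Real.exp (-(1 / (16 * σ₁) * ‖p.2‖ ^ 2))) *
          (Cf * Real.exp (1 / (32 * σ₁) * (p.1 ^ 2 + ‖p.2‖ ^ 2))) := by
          gcongr
          · exact (H σ hσ n hn p.1 hp.1 p.2).2.1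
          · exact hgb p.1 p.2 hp.1
      _ = C * Cf * (Real.exp (-(1 / (16 * σ₁) * p.1 ^ 2)) *
            Real.exp (-(1 / (16 * σ₁) * ‖p.2‖ ^ 2)) *
            Real.exp (1 / (32 * σ₁) * (p.1 ^ 2 + ‖p.2‖ ^ 2))) := by ring
      _ = _ := by rw [exp_mul_exp_mul_exp_eq_gaussWeight]
  have hnear : ∀ n : ℝ, 1 ≤ n → ∀ p ∈ halfSpace d, |J n p| ≤ C * Cu * W p := by
    intro n hn p hp
    have hn0 : 0 < n := by linarith
    have hp0 : 0 < p.1 := hp.1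
    simp only [J]
    rw [abs_mul]
    calc _ ≤ C * (Real.exp (-(1 / (16 * σ₁) * p.1 ^ 2)) *
            Real.exp (-(1 / (16 * σ₁) * ‖p.2‖ ^ 2))) *
          (Cu * Real.exp (1 / (32 * σ₁) * (p.1 ^ 2 + ‖p.2‖ ^ 2))) := by
          gcongr
          · exact (H σ hσ n hn p.1 hp.1 p.2).2.2
          · refine (hvb (p.1 / n) p.2 (by positivity)).trans ?_
            gcongr
            exact div_le_self hp0.le hn
      _ = C * Cu * (Real.exp (-(1 / (16 * σ₁) * p.1 ^ 2)) *
            Real.exp (-(1 / (16 * σ₁) * ‖p.2‖ ^ 2)) *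
            Real.exp (1 / (32 * σ₁) * (p.1 ^ 2 + ‖p.2‖ ^ 2))) := by ring
      _ = _ := by rw [exp_mul_exp_mul_exp_eq_gaussWeight]
  have hIb : ∀ n : ℝ, 1 ≤ n → ∀ p ∈ halfSpace d, |I n p| ≤ (C * Cu + C * Cf) * W p := by
    intro n hn p hp
    refine (abs_sub _ _).trans ?_
    have h3 := hfar n hn p hp
    have h4 : C * Cu / n * W p ≤ C * Cu * W p := by
      have := hW0 p
      gcongr
      exact div_le_self (by positivity) hn
    linarith [htest n hn p hp]
  have hIm : ∀ n : ℝ, AEStronglyMeasurable (I n) (volume.restrict (halfSpace d)) := fun n =>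
    (((continuous_farError x n σ y).continuousOn.mul hv).sub
      ((contDiff_testKernel x n σ y).continuous.continuousOn.mul hg)).aestronglyMeasurable hD
  have hJm : ∀ n : ℝ, 1 ≤ n → AEStronglyMeasurable (J n) (volume.restrict (halfSpace d)) := by
    intro n hn
    have hn0 : 0 < n := by linarith
    refine ContinuousOn.aestronglyMeasurable ?_ hD
    refine (continuous_nearError x n σ y).continuousOn.mul ?_
    refine hv.comp (f := fun p : ℝ × Tan d => (p.1 / n, p.2)) (by fun_prop) fun p hp => ?_
    exact ⟨div_pos hp.1 hn0, mem_univ _⟩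
  have hIi : ∀ n : ℝ, 1 ≤ n → IntegrableOn (I n) (halfSpace d) := fun n hn =>
    Integrable.mono' (hWi.const_mul _) (hIm n)
      ((ae_restrict_iff' hD).2 (ae_of_all _ fun p hp => hIb n hn p hp))
  have hJi : ∀ n : ℝ, 1 ≤ n → IntegrableOn (J n) (halfSpace d) := fun n hn =>
    Integrable.mono' (hWi.const_mul _) (hJm n hn)
      ((ae_restrict_iff' hD).2 (ae_of_all _ fun p hp => hnear n hn p hp))
  have hsplit : ∀ n : ℝ, 1 ≤ n →
      ∫ p in halfSpace d, ((farError d x n p.1 (‖p.2 - y‖ ^ 2) σ -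
          n * nearError d x n (n * p.1) (‖p.2 - y‖ ^ 2) σ) * v p.1 p.2 -
        testKernel d x n p.1 (‖p.2 - y‖ ^ 2) σ * g p.1 p.2) =
      (∫ p in halfSpace d, I n p) - ∫ p in halfSpace d, J n p := by
    intro n hn
    have hn0 : 0 < n := by linarith
    obtain ⟨s1, s2⟩ := integral_halfSpace_stretch hn0 (J n)
    rw [← s2, ← integral_sub (hIi n hn) (s1 (hJi n hn))]
    refine integral_congr_ae (ae_of_all _ fun p => ?_)
    simp only [I, J, mul_div_cancel_left₀ p.1 hn0.ne']
    ring
  constructor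
  · intro n hn
    rw [hsplit n hn]
    refine (abs_sub _ _).trans (add_le_add ?_ ?_)
    · exact norm_integral_le_of_norm_le (f := I n) (hWi.const_mul (C * Cu + C * Cf))
        ((ae_restrict_iff' hD).2 (ae_of_all _ fun p hp => hIb n hn p hp))
    · exact norm_integral_le_of_norm_le (f := J n) (hWi.const_mul (C * Cu))
        ((ae_restrict_iff' hD).2 (ae_of_all _ fun p hp => hnear n hn p hp))
  · have tI : Tendsto (fun n => ∫ p in halfSpace d, I n p) atTop (𝓝 (∫ p in halfSpace d,
        -(dirichletKernel x p.1 σ * heatKernel d (‖p.2 - y‖ ^ 2) σ * g p.1 p.2))) := by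
      refine tendsto_integral_filter_of_dominated_convergence
        (fun p => (C * Cu + C * Cf) * W p) (Eventually.of_forall hIm) ?_ (hWi.const_mul _) ?_
      · filter_upwards [eventually_ge_atTop 1] with n hn
        exact (ae_restrict_iff' hD).2 (ae_of_all _ fun p hp => hIb n hn p hp)
      · refine (ae_restrict_iff' hD).2 (ae_of_all _ fun p hp => ?_)
        have t1 : Tendsto (fun n : ℝ => farError d x n p.1 (‖p.2 - y‖ ^ 2) σ * v p.1 p.2) atTop
            (𝓝 0) := by
          have : Tendsto (fun n : ℝ => C * Cu / n * W p) atTop (𝓝 0) := by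
            simpa using (tendsto_const_nhds.div_atTop tendsto_id).mul_const (W p)
          refine squeeze_zero_norm' ?_ this
          filter_upwards [eventually_ge_atTop 1] with n hn using hfar n hn p hp
        have t2 : Tendsto (fun n : ℝ => testKernel d x n p.1 (‖p.2 - y‖ ^ 2) σ * g p.1 p.2) atTop
            (𝓝 (1 * dirichletKernel x p.1 σ * (1 * heatKernel d (‖p.2 - y‖ ^ 2) σ) * g p.1 p.2)) :=
          (((tendsto_halfLineCutoff hp.1).mul_const _).mul
            ((tendsto_cutoff_div _).mul_const _)).mul_const _
        simpa [I] using t1.sub t2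
    have tJ : Tendsto (fun n => ∫ p in halfSpace d, J n p) atTop (𝓝 (∫ p in halfSpace d, 0)) := by
      refine tendsto_integral_filter_of_dominated_convergence
        (fun p => C * Cu * W p) ?_ ?_ (hWi.const_mul _) ?_
      · filter_upwards [eventually_ge_atTop 1] with n hn using hJm n hn
      · filter_upwards [eventually_ge_atTop 1] with n hn
        exact (ae_restrict_iff' hD).2 (ae_of_all _ fun p hp => hnear n hn p hp)
      · refine (ae_restrict_iff' hD).2 (ae_of_all _ fun p hp => ?_)
        have t0 : Tendsto (fun n : ℝ => p.1 / n) atTop (𝓝[>] 0) := by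
          refine tendsto_nhdsWithin_iff.2 ⟨tendsto_const_nhds.div_atTop tendsto_id, ?_⟩
          filter_upwards [eventually_gt_atTop 0] with n hn using div_pos hp.1 hn
        have t1 := ((hv0 p.2).comp t0).norm.const_mul (C *
          (Real.exp (-(1 / (16 * σ₁) * p.1 ^ 2)) * Real.exp (-(1 / (16 * σ₁) * ‖p.2‖ ^ 2))))
        rw [norm_zero, mul_zero] at t1
        refine squeeze_zero_norm' ?_ t1
        filter_upwards [eventually_ge_atTop 1] with n hn
        simp only [J, Function.comp_apply]
        rw [norm_mul]
        gcongr
        exact (H σ hσ n hn p.1 hp.1 p.2).2.2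
    have := tI.sub tJ
    rw [integral_zero, sub_zero, integral_neg] at this
    refine this.congr' ?_
    filter_upwards [eventually_ge_atTop 1] with n hn using (hsplit n hn).symm

end SliceLimit

/-! ### Green's identity -/

section GreenIdentity

variable {d : ℕ} {F : ℝ → ℝ} {h : ℝ → Tan d → ℝ} {u : ℝ → Tan d → ℝ → ℝ}

/-- Green's identity on `0 < s ≤ τ ≤ r < t`, after removal of the cutoffs. -/
theorem IsSolution.green_identity (hsol : IsSolution F h u)
    (hu : ∀ a > 0, ∀ T > 0, ∃ C : ℝ, ∀ (x : ℝ) (y : Tan d) (t : ℝ), 0 < x → 0 < t → t ≤ T →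
      |u x y t| ≤ C * Real.exp (a * (x ^ 2 + ‖y‖ ^ 2)))
    (hF : ∀ a > 0, ∀ T > 0, ∃ C : ℝ, ∀ (y : Tan d) (t : ℝ), 0 < t → t ≤ T →
      |source F (flux u) y t| ≤ C * Real.exp (a * ‖y‖ ^ 2))
    {x : ℝ} (hx : 0 ≤ x) (y : Tan d) {s r t : ℝ} (hs : 0 < s) (hsr : s ≤ r) (hrt : r < t) :
    ∫ τ in s..r, ∫ p in halfSpace d, dirichletKernel x p.1 (t - τ) *
      heatKernel d (‖p.2 - y‖ ^ 2) (t - τ) * source F (flux u) p.2 τ =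
    (∫ p in halfSpace d, dirichletKernel x p.1 (t - s) *
      heatKernel d (‖p.2 - y‖ ^ 2) (t - s) * u p.1 p.2 s) -
    ∫ p in halfSpace d, dirichletKernel x p.1 (t - r) *
      heatKernel d (‖p.2 - y‖ ^ 2) (t - r) * u p.1 p.2 r := by
  have ht : 0 < t := (hs.trans_le hsr).trans hrt
  obtain ⟨Cu, HCu⟩ := hu (1 / (32 * t)) (by positivity) t ht
  obtain ⟨Cf, HCf⟩ := hF (1 / (32 * t)) (by positivity) t ht
  have hCf : 0 ≤ Cf := by
    by_contra hneg
    have := (abs_nonneg _).trans (HCf 0 t ht le_rfl)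
    have h2 := Real.exp_pos (1 / (32 * t) * ‖(0 : Tan d)‖ ^ 2)
    nlinarith
  have hCu : 0 ≤ Cu := by
    by_contra hneg
    have := (abs_nonneg _).trans (HCu 1 0 t one_pos ht le_rfl)
    have h2 := Real.exp_pos (1 / (32 * t) * (1 ^ 2 + ‖(0 : Tan d)‖ ^ 2))
    nlinarith
  have h0 : 0 < t - r := sub_pos.2 hrt
  have hmem : ∀ τ ∈ Icc s r, t - τ ∈ Icc (t - r) t := fun τ hτ =>
    ⟨by linarith [hτ.2], by linarith [hτ.1]⟩
  have hpos : ∀ τ ∈ Icc s r, 0 < τ := fun τ hτ => hs.trans_le hτ.1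
  have huc : ∀ τ ∈ Icc s r, ContinuousOn (fun p : ℝ × Tan d => u p.1 p.2 τ) (halfSpace d) :=
    fun τ hτ => (hsol.regular.contDiffOn_space τ (hpos τ hτ)).continuousOn
  have hub : ∀ τ ∈ Icc s r, ∀ ξ η, 0 < ξ →
      |u ξ η τ| ≤ Cu * Real.exp (1 / (32 * t) * (ξ ^ 2 + ‖η‖ ^ 2)) := fun τ hτ ξ η hξ =>
    HCu ξ η τ hξ (hpos τ hτ) (hτ.2.trans hrt.le)
  obtain ⟨C, HC⟩ := exists_slice_bound d hx y (Cu := Cu) (Cf := Cf) h0 ht hCu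
  -- the two sides of the truncated identity, in the limit
  have hslice : ∀ τ ∈ Icc s r, _ := fun τ hτ => HC (t - τ) (hmem τ hτ) (fun ξ η => u ξ η τ)
    (fun _ η => source F (flux u) η τ) (huc τ hτ)
    (by
      refine ContinuousOn.comp (t := univ ×ˢ Ioi 0) (f := fun p : ℝ × Tan d => (p.2, τ))
        hsol.continuousOn_source (by fun_prop) fun p _ => ⟨mem_univ _, hpos τ hτ⟩)
    (hub τ hτ)
    (fun ξ η _ => (HCf η τ (hpos τ hτ) (hτ.2.trans hrt.le)).trans (by
      gcongr
      exact le_add_of_nonneg_left (sq_nonneg ξ)))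
    (fun η => by
      have hc := hsol.continuousOn_boundary ((0, η), τ) ⟨⟨self_mem_Ici, mem_univ _⟩, hpos τ hτ⟩
      have hm : Tendsto (fun ξ : ℝ => ((ξ, η), τ)) (𝓝[>] 0)
          (𝓝[(Ici 0 ×ˢ univ) ×ˢ Ioi 0] ((0, η), τ)) := by
        refine tendsto_nhdsWithin_iff.2 ⟨?_, ?_⟩
        · have : Continuous (fun ξ : ℝ => ((ξ, η), τ)) := by fun_prop
          exact (this.tendsto 0).mono_left nhdsWithin_le_nhds
        · filter_upwards [self_mem_nhdsWithin] with ξ hξ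
          exact ⟨⟨mem_Ici.2 (le_of_lt hξ), mem_univ _⟩, hpos τ hτ⟩
      have := hc.tendsto.comp hm
      simpa [Function.comp_def, hsol.boundary η τ (hpos τ hτ)] using this)
  have hend : ∀ τ ∈ Icc s r, Tendsto (fun n : ℝ => ∫ p in halfSpace d,
      testKernel d x n p.1 (‖p.2 - y‖ ^ 2) (t - τ) * u p.1 p.2 τ) atTop
      (𝓝 (∫ p in halfSpace d, dirichletKernel x p.1 (t - τ) *
        heatKernel d (‖p.2 - y‖ ^ 2) (t - τ) * u p.1 p.2 τ)) := by
    intro τ hτ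
    obtain ⟨C', HC'⟩ := exists_slice_bound d hx y (Cu := 0) (Cf := Cu) h0 ht le_rfl
    have := (HC' (t - τ) (hmem τ hτ) (fun _ _ => 0) (fun ξ η => u ξ η τ) continuousOn_const
      (huc τ hτ) (by simp) (hub τ hτ) (fun _ => tendsto_const_nhds)).2.neg
    simpa [integral_neg] using this
  have hL : Tendsto (fun n : ℝ => ∫ τ in s..r, ∫ p in halfSpace d,
      ((farError d x n p.1 (‖p.2 - y‖ ^ 2) (t - τ) -
          n * nearError d x n (n * p.1) (‖p.2 - y‖ ^ 2) (t - τ)) * u p.1 p.2 τ -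
        testKernel d x n p.1 (‖p.2 - y‖ ^ 2) (t - τ) * source F (flux u) p.2 τ)) atTop
      (𝓝 (∫ τ in s..r, -∫ p in halfSpace d, dirichletKernel x p.1 (t - τ) *
        heatKernel d (‖p.2 - y‖ ^ 2) (t - τ) * source F (flux u) p.2 τ)) := by
    refine intervalIntegral.tendsto_integral_filter_of_dominated_convergence (fun _ => C) ?_ ?_
      intervalIntegrable_const ?_
    · filter_upwards [eventually_ge_atTop 1] with n hn
      have := (hsol.truncated_identity x y hs hsr hrt hn).1.aestronglyMeasurable
      rwa [uIoc_of_le hsr]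
    · filter_upwards [eventually_ge_atTop 1] with n hn
      refine ae_of_all _ fun τ hτ => ?_
      rw [uIoc_of_le hsr] at hτ
      exact (hslice τ (Ioc_subset_Icc_self hτ)).1 n hn
    · refine ae_of_all _ fun τ hτ => ?_
      rw [uIoc_of_le hsr] at hτ
      exact (hslice τ (Ioc_subset_Icc_self hτ)).2
  have hR := (hend r ⟨hsr, le_rfl⟩).sub (hend s ⟨le_rfl, hsr⟩)
  have hLR := tendsto_nhds_unique (hL.congr' (by
    filter_upwards [eventually_ge_atTop 1] with n hn
    exact (hsol.truncated_identity x y hs hsr hrt hn).2)) hR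
  rw [intervalIntegral.integral_neg] at hLR
  linarith

end GreenIdentity

/-! ### Concentration of the heat kernel -/

section Concentration

variable {d : ℕ}

theorem integral_exp_neg_mul_sq_norm (d : ℕ) {b : ℝ} (hb : 0 < b) :
    ∫ η : Tan d, Real.exp (-(b * ‖η‖ ^ 2)) = √(Real.pi / b) ^ d := by
  have := GaussianFourier.integral_rexp_neg_mul_sq_norm (V := Tan d) hb
  simp only [neg_mul, finrank_euclideanSpace, Fintype.card_fin] at this
  rw [this, Real.sqrt_eq_rpow, ← Real.rpow_natCast, ← Real.rpow_mul (by positivity)]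
  congr 1
  ring

theorem integral_gaussWeight_one :
    ∫ p : ℝ × Tan d, gaussWeight 1 p = √Real.pi ^ (d + 1) := by
  simp only [gaussWeight_eq]
  rw [Measure.volume_eq_prod, integral_prod_mul (fun x : ℝ => Real.exp (-(1 * x ^ 2)))
    (fun η : Tan d => Real.exp (-(1 * ‖η‖ ^ 2))), integral_exp_neg_mul_sq_norm d one_pos]
  have := integral_gaussian 1
  simp only [neg_mul] at this
  rw [this, div_one, pow_succ, mul_comm]

/-- The parabolic substitution `p = (c, y) + 2 √σ z`. -/
theorem integral_heatKernel_mul_eq {σ : ℝ} (hσ : 0 < σ) (c : ℝ) (y : Tan d) (w : ℝ × Tan d → ℝ) :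
    ∫ p : ℝ × Tan d, heatKernel 1 ((c - p.1) ^ 2) σ * heatKernel d (‖p.2 - y‖ ^ 2) σ * w p =
      (√Real.pi ^ (d + 1))⁻¹ *
        ∫ z : ℝ × Tan d, gaussWeight 1 z * w ((c, y) + (2 * √σ) • z) := by
  have hs : 0 < √σ := Real.sqrt_pos.2 hσ
  have hs2 : √σ ^ 2 = σ := Real.sq_sqrt hσ.le
  have hfin : Module.finrank ℝ (ℝ × Tan d) = d + 1 := by
    rw [Module.finrank_prod]; simp [add_comm]
  set G : ℝ × Tan d → ℝ := fun p =>
    heatKernel 1 ((c - p.1) ^ 2) σ * heatKernel d (‖p.2 - y‖ ^ 2) σ * w p with hG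
  have h1 : ∫ p, G p = ∫ p, G ((c, y) + p) := (integral_add_left_eq_self G (c, y)).symm
  have h2 := Measure.integral_comp_smul (μ := (volume : Measure (ℝ × Tan d)))
    (fun p => G ((c, y) + p)) (2 * √σ)
  rw [hfin, abs_of_pos (by positivity), smul_eq_mul, ← h1] at h2
  have h3 : ∀ z : ℝ × Tan d, G ((c, y) + (2 * √σ) • z) =
      ((2 * √σ) ^ (d + 1))⁻¹ * (√Real.pi ^ (d + 1))⁻¹ *
        (gaussWeight 1 z * w ((c, y) + (2 * √σ) • z)) := by
    intro z
    have e1 : (c - ((c, y) + (2 * √σ) • z).1) ^ 2 = 4 * σ * z.1 ^ 2 := by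
      simp only [Prod.fst_add, Prod.smul_fst, smul_eq_mul]
      linear_combination 4 * z.1 ^ 2 * hs2
    have e2 : ‖((c, y) + (2 * √σ) • z).2 - y‖ ^ 2 = 4 * σ * ‖z.2‖ ^ 2 := by
      simp only [Prod.snd_add, Prod.smul_snd, add_sub_cancel_left, norm_smul, Real.norm_eq_abs]
      rw [abs_of_pos (by positivity), mul_pow, mul_pow, hs2]; ring
    have e3 : 2 * √(Real.pi * σ) = 2 * √σ * √Real.pi := by
      rw [Real.sqrt_mul Real.pi_pos.le]; ring
    simp only [hG]
    rw [e1, e2, gaussWeight_eq, heatKernel, heatKernel, e3]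
    have e4 : -(4 * σ * z.1 ^ 2) / (4 * σ) = -(1 * z.1 ^ 2) := by field_simp
    have e5 : -(4 * σ * ‖z.2‖ ^ 2) / (4 * σ) = -(1 * ‖z.2‖ ^ 2) := by field_simp
    rw [e4, e5]
    have := Real.sqrt_pos.2 Real.pi_pos
    field_simp
    ring
  simp only [h3] at h2
  rw [integral_const_mul] at h2
  have h4 : ((2 * √σ) ^ (d + 1))⁻¹ ≠ 0 := by positivity
  rw [mul_assoc] at h2
  exact (mul_left_cancel₀ h4 h2).symm

/-- The heat kernel concentrates at its centre, also against functions of Gaussian growth. -/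
theorem tendsto_integral_heatKernel_mul (c : ℝ) (y : Tan d) (w : ℝ × Tan d → ℝ → ℝ) {L C δ : ℝ}
    (hδ : 0 < δ) (hm : ∀ σ ∈ Ioo 0 δ, AEStronglyMeasurable (fun p => w p σ))
    (hb : ∀ σ ∈ Ioo 0 δ, ∀ p, |w p σ| ≤ C * Real.exp (p.1 ^ 2 + ‖p.2‖ ^ 2))
    (hw : Tendsto (fun q : (ℝ × Tan d) × ℝ => w q.1 q.2) (𝓝 (c, y) ×ˢ 𝓝[>] 0) (𝓝 L)) :
    Tendsto (fun σ => ∫ p : ℝ × Tan d, heatKernel 1 ((c - p.1) ^ 2) σ *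
      heatKernel d (‖p.2 - y‖ ^ 2) σ * w p σ) (𝓝[>] 0) (𝓝 L) := by
  have hC : 0 ≤ C := by
    by_contra hneg
    have := (abs_nonneg _).trans (hb (δ / 2) ⟨by linarith, by linarith⟩ 0)
    have h2 := Real.exp_pos ((0 : ℝ × Tan d).1 ^ 2 + ‖(0 : ℝ × Tan d).2‖ ^ 2)
    nlinarith
  have hsmall : ∀ᶠ σ : ℝ in 𝓝[>] 0, σ ∈ Ioo 0 (min δ (1 / 16)) :=
    Ioo_mem_nhdsGT (lt_min hδ (by norm_num))
  have key : Tendsto (fun σ => ∫ z : ℝ × Tan d, gaussWeight 1 z * w ((c, y) + (2 * √σ) • z) σ)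
      (𝓝[>] 0) (𝓝 (∫ z : ℝ × Tan d, gaussWeight 1 z * L)) := by
    refine tendsto_integral_filter_of_dominated_convergence
      (fun z => C * Real.exp (2 * (c ^ 2 + ‖y‖ ^ 2)) * gaussWeight (1 / 2) z) ?_ ?_
      ((integrable_gaussWeight (by norm_num)).const_mul _) ?_
    · filter_upwards [hsmall] with σ hσ
      have hσ' : σ ∈ Ioo 0 δ := ⟨hσ.1, hσ.2.trans_le (min_le_left _ _)⟩
      have hs : 0 < √σ := Real.sqrt_pos.2 hσ.1
      refine (integrable_gaussWeight one_pos).aestronglyMeasurable.mul ?_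
      have hq1 : Measure.QuasiMeasurePreserving
          (fun z : ℝ × Tan d => (2 * √σ) • z) volume volume := by
        refine ⟨measurable_const_smul _, ?_⟩
        rw [Measure.map_addHaar_smul _ (by positivity)]
        exact Measure.smul_absolutelyContinuous
      have hq2 := (measurePreserving_add_left (volume : Measure (ℝ × Tan d))
        (c, y)).quasiMeasurePreserving.comp hq1
      exact (hm σ hσ').comp_quasiMeasurePreserving hq2
    · filter_upwards [hsmall] with σ hσ
      have hσ' : σ ∈ Ioo 0 δ := ⟨hσ.1, hσ.2.trans_le (min_le_left _ _)⟩
      have hσ16 : σ < 1 / 16 := hσ.2.trans_le (min_le_right _ _)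
      have hs2 : √σ ^ 2 = σ := Real.sq_sqrt hσ.1.le
      refine ae_of_all _ fun z => ?_
      rw [norm_mul, Real.norm_eq_abs, Real.norm_eq_abs, abs_of_pos (a := gaussWeight 1 z) (Real.exp_pos _)]
      calc gaussWeight 1 z * |w ((c, y) + (2 * √σ) • z) σ|
          ≤ gaussWeight 1 z * (C * Real.exp (2 * (c ^ 2 + ‖y‖ ^ 2) +
              1 / 2 * (z.1 ^ 2 + ‖z.2‖ ^ 2))) := by
            refine mul_le_mul_of_nonneg_left ((hb σ hσ' _).trans ?_) (Real.exp_pos _).le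
            refine mul_le_mul_of_nonneg_left (Real.exp_le_exp.2 ?_) hC
            simp only [Prod.fst_add, Prod.snd_add, Prod.smul_fst, Prod.smul_snd, smul_eq_mul]
            have b1 : (c + 2 * √σ * z.1) ^ 2 ≤ 2 * c ^ 2 + 8 * σ * z.1 ^ 2 := by
              have e : 8 * σ * z.1 ^ 2 = 8 * √σ ^ 2 * z.1 ^ 2 := by rw [hs2]
              rw [e]; nlinarith [sq_nonneg (c - 2 * √σ * z.1)]
            have b2 : ‖y + (2 * √σ) • z.2‖ ^ 2 ≤ 2 * ‖y‖ ^ 2 + 8 * σ * ‖z.2‖ ^ 2 := by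
              have n1 := norm_add_le y ((2 * √σ) • z.2)
              have n2 : ‖(2 * √σ) • z.2‖ = 2 * √σ * ‖z.2‖ := by
                rw [norm_smul, Real.norm_eq_abs, abs_of_nonneg (by positivity)]
              rw [n2] at n1
              have n3 : ‖y + (2 * √σ) • z.2‖ ^ 2 ≤ (‖y‖ + 2 * √σ * ‖z.2‖) ^ 2 := by gcongr
              refine n3.trans ?_
              have e : 8 * σ * ‖z.2‖ ^ 2 = 8 * √σ ^ 2 * ‖z.2‖ ^ 2 := by rw [hs2]
              rw [e]
              nlinarith [sq_nonneg (‖y‖ - 2 * √σ * ‖z.2‖)]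
            have b3 : 8 * σ * z.1 ^ 2 ≤ 1 / 2 * z.1 ^ 2 := by
              have : 8 * σ ≤ 1 / 2 := by linarith
              gcongr
            have b4 : 8 * σ * ‖z.2‖ ^ 2 ≤ 1 / 2 * ‖z.2‖ ^ 2 := by
              have : 8 * σ ≤ 1 / 2 := by linarith
              gcongr
            linarith
        _ = C * Real.exp (2 * (c ^ 2 + ‖y‖ ^ 2)) * (Real.exp (-(1 * (z.1 ^ 2 + ‖z.2‖ ^ 2))) *
              Real.exp (1 / 2 * (z.1 ^ 2 + ‖z.2‖ ^ 2))) := by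
            rw [Real.exp_add, gaussWeight]; ring
        _ = _ := by
            rw [← Real.exp_add, gaussWeight]; congr 2; ring
    · refine ae_of_all _ fun z => Tendsto.const_mul _ ?_
      refine hw.comp (Tendsto.prodMk ?_ tendsto_id : Tendsto (fun σ : ℝ => ((c, y) + (2 * √σ) • z, σ))
        (𝓝[>] 0) (𝓝 (c, y) ×ˢ 𝓝[>] 0))
      have hc : Continuous (fun σ : ℝ => (c, y) + (2 * √σ) • z) := by fun_prop
      have := (hc.tendsto 0).mono_left (nhdsWithin_le_nhds (s := Ioi 0))
      simpa using this
  have hfin := key.const_mul (√Real.pi ^ (d + 1))⁻¹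
  rw [integral_mul_const, integral_gaussWeight_one, ← mul_assoc, inv_mul_cancel₀ (by
    have := Real.sqrt_pos.2 Real.pi_pos; positivity), one_mul] at hfin
  refine hfin.congr' ?_
  filter_upwards [self_mem_nhdsWithin] with σ hσ
  exact (integral_heatKernel_mul_eq hσ c y (fun p => w p σ)).symm

end Concentration

/-! ### The error function -/

section ErrorFunction

theorem continuous_erf : Continuous erf := by
  unfold erf
  refine continuous_const.mul (intervalIntegral.continuous_primitive (fun a b => ?_) 0)
  exact (by fun_prop : Continuous fun X : ℝ => Real.exp (-X ^ 2)).intervalIntegrable a b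

theorem hasDerivAt_erf_zero : HasDerivAt erf (2 / √Real.pi) 0 := by
  have hc : Continuous fun X : ℝ => Real.exp (-X ^ 2) := by fun_prop
  have := (intervalIntegral.integral_hasDerivAt_right (hc.intervalIntegrable 0 0)
    (hc.stronglyMeasurableAtFilter _ _) hc.continuousAt).const_mul (2 / √Real.pi)
  exact this.congr_deriv (by simp)

theorem abs_erf_le (ζ : ℝ) : |erf ζ| ≤ 2 / √Real.pi * |ζ| := by
  unfold erf
  rw [abs_mul, abs_of_nonneg (by positivity : 0 ≤ 2 / √Real.pi)]
  refine mul_le_mul_of_nonneg_left ?_ (by positivity)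
  have := intervalIntegral.norm_integral_le_of_norm_le_const (a := 0) (b := ζ)
    (f := fun X : ℝ => Real.exp (-X ^ 2)) (C := 1) (fun X _ => by
      rw [Real.norm_eq_abs, abs_of_pos (Real.exp_pos _), Real.exp_le_one_iff]
      nlinarith [sq_nonneg X])
  simpa using this

/-- Up to shifts, the two Gaussians cancel outside `(-x, x)`. -/
theorem integral_dirichletKernel {x σ : ℝ} (hx : 0 ≤ x) (hσ : 0 < σ) :
    ∫ ξ in Ioi 0, dirichletKernel x ξ σ = erf (x / (2 * √σ)) := by
  have hs : 0 < √σ := Real.sqrt_pos.2 hσ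
  have hs2 : √σ ^ 2 = σ := Real.sq_sqrt hσ.le
  have hπ := Real.sqrt_pos.2 Real.pi_pos
  set k : ℝ → ℝ := fun z => heatKernel 1 (z ^ 2) σ with hk
  have hki : Integrable k := by
    have := (integrable_exp_neg_mul_sq (b := 1 / (4 * σ)) (by positivity)).div_const
      ((2 * √(Real.pi * σ)) ^ 1)
    refine this.congr (ae_of_all _ fun z => ?_)
    simp only [hk, heatKernel]
    congr 2
    ring
  have hshift : ∀ c : ℝ, ∫ ξ in Ioi 0, k (ξ + c) = ∫ z in Ioi c, k z := by
    intro c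
    have := (measurePreserving_add_right volume c).setIntegral_preimage_emb
      (measurableEmbedding_addRight c) k (Ioi c)
    rw [← this]
    simp
  have h1 : ∀ ξ, dirichletKernel x ξ σ = k (ξ + -x) - k (ξ + x) := by
    intro ξ
    simp only [hk, dirichletKernel]
    rw [show ξ + -x = -(x - ξ) by ring, neg_sq, add_comm ξ x]
  simp only [h1]
  rw [integral_sub (hki.comp_add_right _).integrableOn (hki.comp_add_right _).integrableOn,
    hshift, hshift, intervalIntegral.integral_Ioi_sub_Ioi hki.integrableOn (by linarith)]
  have heven : ∫ z in -x..0, k z = ∫ z in (0 : ℝ)..x, k z := by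
    have := intervalIntegral.integral_comp_neg (a := 0) (b := x) k
    rw [neg_zero] at this
    rw [← this]
    refine intervalIntegral.integral_congr fun z _ => ?_
    simp [hk]
  rw [← intervalIntegral.integral_add_adjacent_intervals (b := 0) hki.intervalIntegrable
    hki.intervalIntegrable, heven]
  have h2 : ∀ z, k z = (2 * √(Real.pi * σ))⁻¹ * Real.exp (-((2 * √σ)⁻¹ * z) ^ 2) := by
    intro z
    simp only [hk, heatKernel]
    rw [pow_one, div_eq_inv_mul]
    congr 2
    rw [mul_pow, inv_pow, mul_pow, hs2]
    field_simp
    norm_num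
  simp only [h2]
  rw [intervalIntegral.integral_const_mul,
    intervalIntegral.integral_comp_mul_left (fun X => Real.exp (-X ^ 2)) (by positivity), mul_zero,
    inv_inv, smul_eq_mul, erf, Real.sqrt_mul Real.pi_pos.le, inv_mul_eq_div (2 * √σ) x]
  field_simp
  rw [one_add_one_eq_two, mul_comm]

end ErrorFunction

/-! ### The tangential heat semigroup -/

section TangentialMean

variable {d : ℕ}

/-- The tangential heat semigroup at time `t - τ` applied to `f(·, τ)`. -/
noncomputable def heatMean (f : Tan d → ℝ → ℝ) (y : Tan d) (t τ : ℝ) : ℝ :=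
  ∫ η, heatKernel d (‖η - y‖ ^ 2) (t - τ) * f η τ

theorem heatMean_eq (f : Tan d → ℝ → ℝ) (y : Tan d) (t τ : ℝ) :
    heatMean f y t τ = ((2 * √(Real.pi * (t - τ))) ^ d)⁻¹ *
      ∫ η : Tan d, Real.exp (-‖y - η‖ ^ 2 / (4 * (t - τ))) * f η τ := by
  rw [heatMean, ← integral_const_mul]
  refine integral_congr_ae (ae_of_all _ fun η => ?_)
  simp only [heatKernel, norm_sub_rev y η]
  ring

variable {f : Tan d → ℝ → ℝ} {C t : ℝ}

/-- The growth rate `1 / (32 t)` costs at most half of the Gaussian exponent `1 / (4 σ)`, for all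
`σ ≤ t`. -/
theorem heatKernel_mul_exp_le (y : Tan d) {σ : ℝ} (hσ : 0 < σ) (hσt : σ ≤ t) :
    ∀ η : Tan d, heatKernel d (‖η - y‖ ^ 2) σ * Real.exp (1 / (32 * t) * ‖η‖ ^ 2) ≤
      Real.exp (1 / (16 * t) * ‖y‖ ^ 2) * (((2 * √(Real.pi * σ)) ^ d)⁻¹ *
        Real.exp (-(1 / (8 * σ) * ‖η - y‖ ^ 2))) := by
  intro η
  have ht : 0 < t := hσ.trans_le hσt
  have h1 : 1 / (32 * t) * ‖η‖ ^ 2 ≤ 1 / (16 * t) * ‖y‖ ^ 2 + 1 / (8 * σ) * ‖η - y‖ ^ 2 := by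
    have n1 : ‖η‖ ≤ ‖η - y‖ + ‖y‖ := by simpa using norm_add_le (η - y) y
    have n2 : ‖η‖ ^ 2 ≤ 2 * ‖y‖ ^ 2 + 2 * ‖η - y‖ ^ 2 := by
      nlinarith [norm_nonneg η, norm_nonneg (η - y), norm_nonneg y, sq_nonneg (‖η - y‖ - ‖y‖)]
    calc 1 / (32 * t) * ‖η‖ ^ 2 ≤ 1 / (32 * t) * (2 * ‖y‖ ^ 2 + 2 * ‖η - y‖ ^ 2) := by gcongr
      _ = 1 / (16 * t) * ‖y‖ ^ 2 + 1 / (16 * t) * ‖η - y‖ ^ 2 := by ring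
      _ ≤ _ := by gcongr; norm_num
  have h2 : heatKernel d (‖η - y‖ ^ 2) σ * Real.exp (1 / (32 * t) * ‖η‖ ^ 2) =
      ((2 * √(Real.pi * σ)) ^ d)⁻¹ *
        Real.exp (-(1 / (4 * σ) * ‖η - y‖ ^ 2) + 1 / (32 * t) * ‖η‖ ^ 2) := by
    rw [heatKernel, Real.exp_add,
      show -‖η - y‖ ^ 2 / (4 * σ) = -(1 / (4 * σ) * ‖η - y‖ ^ 2) by ring]
    ring
  have h3 : Real.exp (1 / (16 * t) * ‖y‖ ^ 2) * (((2 * √(Real.pi * σ)) ^ d)⁻¹ *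
        Real.exp (-(1 / (8 * σ) * ‖η - y‖ ^ 2))) = ((2 * √(Real.pi * σ)) ^ d)⁻¹ *
        Real.exp (1 / (16 * t) * ‖y‖ ^ 2 + -(1 / (8 * σ) * ‖η - y‖ ^ 2)) := by
    rw [Real.exp_add]; ring
  rw [h2, h3]
  refine mul_le_mul_of_nonneg_left (Real.exp_le_exp.2 ?_) (by positivity)
  have h4 : 1 / (4 * σ) * ‖η - y‖ ^ 2 = 2 * (1 / (8 * σ) * ‖η - y‖ ^ 2) := by ring
  linarith

theorem continuous_slice (hf : ContinuousOn (fun q : Tan d × ℝ => f q.1 q.2) (univ ×ˢ Ioi 0))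
    {τ : ℝ} (hτ : 0 < τ) : Continuous (fun η => f η τ) :=
  continuousOn_univ.1 (hf.comp (f := fun η : Tan d => (η, τ)) (by fun_prop)
    fun η _ => ⟨mem_univ η, hτ⟩)

/-- Gaussian growth is compatible with the heat semigroup, with bounds uniform up to `τ = t`. -/
theorem integrable_heatKernel_mul_and_abs_heatMean_le
    (hf : ContinuousOn (fun q : Tan d × ℝ => f q.1 q.2) (univ ×ˢ Ioi 0))
    (hC : ∀ η τ, 0 < τ → τ ≤ t → |f η τ| ≤ C * Real.exp (1 / (32 * t) * ‖η‖ ^ 2))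
    (y : Tan d) {τ : ℝ} (hτ : 0 < τ) (hτt : τ < t) :
    Integrable (fun η => heatKernel d (‖η - y‖ ^ 2) (t - τ) * f η τ) ∧
    |heatMean f y t τ| ≤ C * Real.exp (1 / (16 * t) * ‖y‖ ^ 2) * √2 ^ d := by
  have hσ : 0 < t - τ := sub_pos.2 hτt
  have ht : 0 < t := hτ.trans hτt
  set σ := t - τ with hσdef
  have hC0 : 0 ≤ C := by
    by_contra hneg
    have := (abs_nonneg _).trans (hC 0 t ht le_rfl)
    have h2 := Real.exp_pos (1 / (32 * t) * ‖(0 : Tan d)‖ ^ 2)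
    nlinarith
  have hb : ∀ η, ‖heatKernel d (‖η - y‖ ^ 2) σ * f η τ‖ ≤
      C * (Real.exp (1 / (16 * t) * ‖y‖ ^ 2) * (((2 * √(Real.pi * σ)) ^ d)⁻¹ *
        Real.exp (-(1 / (8 * σ) * ‖η - y‖ ^ 2)))) := by
    intro η
    rw [norm_mul, Real.norm_eq_abs, Real.norm_eq_abs, abs_of_nonneg (heatKernel_nonneg _ _ _)]
    have h0 := heatKernel_nonneg d (‖η - y‖ ^ 2) σ
    calc _ ≤ heatKernel d (‖η - y‖ ^ 2) σ * (C * Real.exp (1 / (32 * t) * ‖η‖ ^ 2)) := by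
          gcongr; exact hC η τ hτ hτt.le
      _ = C * (heatKernel d (‖η - y‖ ^ 2) σ * Real.exp (1 / (32 * t) * ‖η‖ ^ 2)) := by ring
      _ ≤ _ := by
          exact mul_le_mul_of_nonneg_left
            (heatKernel_mul_exp_le y hσ (hσdef ▸ sub_le_self t hτ.le) η) hC0
  have hgi : Integrable (fun η : Tan d => Real.exp (-(1 / (8 * σ) * ‖η - y‖ ^ 2))) :=
    (integrable_exp_neg_mul_sq_norm (d := d) (c := 1 / (8 * σ)) (by positivity)).comp_sub_right y
  have hBi := ((hgi.const_mul ((2 * √(Real.pi * σ)) ^ d)⁻¹).const_mul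
    (Real.exp (1 / (16 * t) * ‖y‖ ^ 2))).const_mul C
  constructor
  · refine Integrable.mono' hBi ?_ (ae_of_all _ hb)
    exact (((contDiff_heatKernel d σ).continuous.comp (by fun_prop)).mul
      (continuous_slice hf hτ)).aestronglyMeasurable
  · refine (norm_integral_le_of_norm_le hBi (ae_of_all _ hb)).trans (le_of_eq ?_)
    rw [integral_const_mul, integral_const_mul, integral_const_mul,
      integral_sub_right_eq_self (fun η : Tan d => Real.exp (-(1 / (8 * σ) * ‖η‖ ^ 2))) y,
      integral_exp_neg_mul_sq_norm d (by positivity), ← inv_pow, ← mul_pow, mul_assoc]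
    congr 3
    have hs := Real.sqrt_pos.2 (mul_pos Real.pi_pos hσ)
    have e : √(Real.pi / (1 / (8 * σ))) = 2 * (√2 * √(Real.pi * σ)) := by
      rw [show Real.pi / (1 / (8 * σ)) = 2 ^ 2 * (2 * (Real.pi * σ)) by field_simp; norm_num,
        Real.sqrt_mul (x := 2 ^ 2) (by norm_num), Real.sqrt_sq (by norm_num),
        Real.sqrt_mul (x := 2) (by norm_num)]
    rw [e]
    field_simp

theorem aestronglyMeasurable_heatMean
    (hf : ContinuousOn (fun q : Tan d × ℝ => f q.1 q.2) (univ ×ˢ Ioi 0)) (y : Tan d) :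
    AEStronglyMeasurable (heatMean f y t) (volume.restrict (Ioo 0 t)) := by
  have h1 : ContinuousOn (fun q : ℝ × Tan d => heatKernel d (‖q.2 - y‖ ^ 2) (t - q.1) * f q.2 q.1)
      (Ioo 0 t ×ˢ univ) := by
    refine (continuousOn_heatKernel_comp d (by fun_prop) (by fun_prop)
      fun q hq => sub_pos.2 hq.1.2).mul ?_
    exact hf.comp (f := fun q : ℝ × Tan d => (q.2, q.1)) (by fun_prop)
      fun q hq => ⟨mem_univ _, hq.1.1⟩
  have h2 := h1.aestronglyMeasurable (μ := volume) (measurableSet_Ioo.prod MeasurableSet.univ)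
  rw [Measure.volume_eq_prod, ← Measure.prod_restrict, Measure.restrict_univ] at h2
  exact h2.integral_prod_right'

theorem intervalIntegrable_inv_sqrt_sub {t : ℝ} (ht : 0 ≤ t) :
    IntervalIntegrable (fun τ => (√(Real.pi * (t - τ)))⁻¹) volume 0 t := by
  have h1 : IntervalIntegrable (fun σ : ℝ => σ ^ (-(1 / 2) : ℝ)) volume t 0 :=
    intervalIntegral.intervalIntegrable_rpow' (by norm_num)
  have h2 := (h1.comp_sub_left t).const_mul (√Real.pi)⁻¹
  simp only [sub_self, sub_zero] at h2
  refine h2.congr fun τ hτ => ?_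
  rw [uIoc_of_le ht] at hτ
  rw [Real.sqrt_mul Real.pi_pos.le, mul_inv, Real.rpow_neg (sub_nonneg.2 hτ.2), Real.sqrt_eq_rpow
    (t - τ)]

end TangentialMean

/-! ### Initial and terminal limits -/

section Endpoints

variable {d : ℕ} {F : ℝ → ℝ} {h : ℝ → Tan d → ℝ} {u : ℝ → Tan d → ℝ → ℝ}

theorem integrable_heatKernel_mul (c : ℝ) (y : Tan d) {σ C : ℝ} (hσ : 0 < σ) {v : ℝ × Tan d → ℝ}
    (hm : AEStronglyMeasurable v)
    (hb : ∀ p, |v p| ≤ C * Real.exp (1 / (32 * σ) * (p.1 ^ 2 + ‖p.2‖ ^ 2))) :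
    Integrable (fun p : ℝ × Tan d =>
      heatKernel 1 ((c - p.1) ^ 2) σ * heatKernel d (‖p.2 - y‖ ^ 2) σ * v p) := by
  obtain ⟨C1, hC1, H1⟩ := exists_one_add_mul_heatKernel_le (V := ℝ) 1 |c| (σ₁ := σ) hσ
  obtain ⟨C2, hC2, H2⟩ := exists_one_add_mul_heatKernel_le (V := Tan d) d ‖y‖ (σ₁ := σ) hσ
  have hσm : σ ∈ Icc σ σ := ⟨le_rfl, le_rfl⟩
  have hW : Integrable (fun p : ℝ × Tan d => C1 * C2 * C * gaussWeight (1 / (32 * σ)) p) :=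
    (integrable_gaussWeight (by positivity)).const_mul _
  refine hW.mono' ?_ (ae_of_all _ fun p => ?_)
  · refine (Continuous.aestronglyMeasurable ?_).mul hm
    exact ((contDiff_heatKernel 1 σ).continuous.comp (by fun_prop)).mul
      ((contDiff_heatKernel d σ).continuous.comp (by fun_prop))
  · have k1 := H1 σ hσm c p.1 le_rfl
    have k2 := H2 σ hσm y p.2 le_rfl
    rw [Real.norm_eq_abs, Real.norm_eq_abs, sq_abs, sq_abs,
      show (p.1 - c) ^ 2 = (c - p.1) ^ 2 by ring] at k1
    have n1 := heatKernel_nonneg 1 ((c - p.1) ^ 2) σ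
    have n2 := heatKernel_nonneg d (‖p.2 - y‖ ^ 2) σ
    have k1' : heatKernel 1 ((c - p.1) ^ 2) σ ≤ C1 * Real.exp (-(1 / (16 * σ) * p.1 ^ 2)) := by
      nlinarith [mul_nonneg (sq_nonneg (c - p.1)) n1]
    have k2' : heatKernel d (‖p.2 - y‖ ^ 2) σ ≤ C2 * Real.exp (-(1 / (16 * σ) * ‖p.2‖ ^ 2)) := by
      nlinarith [mul_nonneg (sq_nonneg ‖p.2 - y‖) n2]
    rw [norm_mul, norm_mul, Real.norm_eq_abs, Real.norm_eq_abs, Real.norm_eq_abs,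
      abs_of_nonneg n1, abs_of_nonneg n2]
    have hvb := hb p
    calc _ ≤ C1 * Real.exp (-(1 / (16 * σ) * p.1 ^ 2)) *
            (C2 * Real.exp (-(1 / (16 * σ) * ‖p.2‖ ^ 2))) *
          (C * Real.exp (1 / (32 * σ) * (p.1 ^ 2 + ‖p.2‖ ^ 2))) := by gcongr
      _ = C1 * C2 * C * (Real.exp (-(1 / (16 * σ) * p.1 ^ 2)) *
            Real.exp (-(1 / (16 * σ) * ‖p.2‖ ^ 2)) *
            Real.exp (1 / (32 * σ) * (p.1 ^ 2 + ‖p.2‖ ^ 2))) := by ring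
      _ = _ := by rw [exp_mul_exp_mul_exp_eq_gaussWeight]

/-- Tested against Green's function with pole `(x, y, t)`, the solution is recovered as the time
approaches `t`. The image term concentrates at `(-x, y)`, outside the half-space. -/
theorem IsSolution.tendsto_integral_green_terminal (hsol : IsSolution F h u)
    (hu : ∀ a > 0, ∀ T > 0, ∃ C : ℝ, ∀ (x : ℝ) (y : Tan d) (t : ℝ), 0 < x → 0 < t → t ≤ T →
      |u x y t| ≤ C * Real.exp (a * (x ^ 2 + ‖y‖ ^ 2)))
    {x : ℝ} (hx : 0 < x) (y : Tan d) {t : ℝ} (ht : 0 < t) :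
    Tendsto (fun r => ∫ p in halfSpace d, dirichletKernel x p.1 (t - r) *
      heatKernel d (‖p.2 - y‖ ^ 2) (t - r) * u p.1 p.2 r) (𝓝[<] t) (𝓝 (u x y t)) := by
  have hD : MeasurableSet (halfSpace d) := isOpen_halfSpace.measurableSet
  let w : ℝ × Tan d → ℝ → ℝ := fun p σ => (halfSpace d).indicator (fun p => u p.1 p.2 (t - σ)) p
  have hwm : ∀ σ ∈ Ioo 0 t, AEStronglyMeasurable (fun p => w p σ) := by
    intro σ hσ
    refine (aestronglyMeasurable_indicator_iff hD).2 ?_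
    exact (hsol.regular.contDiffOn_space (t - σ)
      (sub_pos.2 hσ.2)).continuousOn.aestronglyMeasurable hD
  have hwb : ∀ a > 0, ∃ C, ∀ σ ∈ Ioo 0 t, ∀ p,
      |w p σ| ≤ C * Real.exp (a * (p.1 ^ 2 + ‖p.2‖ ^ 2)) := by
    intro a ha
    obtain ⟨C, hC⟩ := hu a ha t ht
    refine ⟨|C|, fun σ hσ p => ?_⟩
    by_cases hp : p ∈ halfSpace d
    · simp only [w, indicator_of_mem hp]
      refine (hC p.1 p.2 (t - σ) hp.1 (sub_pos.2 hσ.2) (by linarith [hσ.1])).trans ?_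
      gcongr
      exact le_abs_self C
    · simp only [w, indicator_of_notMem hp, abs_zero]
      positivity
  obtain ⟨C, hC⟩ := hwb 1 one_pos
  simp only [one_mul] at hC
  have lim1 : Tendsto (fun q : (ℝ × Tan d) × ℝ => w q.1 q.2) (𝓝 (x, y) ×ˢ 𝓝[>] 0)
      (𝓝 (u x y t)) := by
    have hc : ContinuousAt (fun q : (ℝ × Tan d) × ℝ => u q.1.1 q.1.2 q.2) ((x, y), t) :=
      hsol.continuousOn_interior.continuousAt
        ((isOpen_halfSpace.prod isOpen_Ioi).mem_nhds ⟨⟨hx, mem_univ _⟩, ht⟩)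
    have hm : Tendsto (fun q : (ℝ × Tan d) × ℝ => (q.1, t - q.2)) (𝓝 (x, y) ×ˢ 𝓝[>] 0)
        (𝓝 ((x, y), t)) := by
      have : Tendsto (fun σ : ℝ => t - σ) (𝓝[>] 0) (𝓝 t) := by
        have hh : Continuous (fun σ : ℝ => t - σ) := by fun_prop
        simpa using (hh.tendsto 0).mono_left (nhdsWithin_le_nhds (s := Ioi 0))
      exact tendsto_fst.prodMk_nhds (this.comp tendsto_snd)
    refine (hc.tendsto.comp hm).congr' ?_
    have hin : ∀ᶠ p in 𝓝 (x, y), p ∈ halfSpace d := isOpen_halfSpace.mem_nhds ⟨hx, mem_univ _⟩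
    filter_upwards [tendsto_fst.eventually hin] with q hq
    simp [w, indicator_of_mem hq]
  have lim2 : Tendsto (fun q : (ℝ × Tan d) × ℝ => w q.1 q.2) (𝓝 (-x, y) ×ˢ 𝓝[>] 0) (𝓝 0) := by
    refine tendsto_const_nhds.congr' ?_
    have hin : ∀ᶠ p : ℝ × Tan d in 𝓝 (-x, y), p.1 < 0 :=
      (continuous_fst.tendsto (-x, y)).eventually (Iio_mem_nhds (by simpa using hx))
    filter_upwards [tendsto_fst.eventually hin] with q hq
    have : q.1 ∉ halfSpace d := fun hh => absurd hh.1 (not_lt.2 hq.le)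
    simp [w, indicator_of_notMem this]
  have key := (tendsto_integral_heatKernel_mul x y w ht hwm hC lim1).sub
    (tendsto_integral_heatKernel_mul (-x) y w ht hwm hC lim2)
  rw [sub_zero] at key
  have hsub : Tendsto (fun r => t - r) (𝓝[<] t) (𝓝[>] 0) := by
    refine tendsto_nhdsWithin_iff.2 ⟨?_, ?_⟩
    · have hh : Continuous (fun r : ℝ => t - r) := by fun_prop
      simpa using (hh.tendsto t).mono_left (nhdsWithin_le_nhds (s := Iio t))
    · filter_upwards [self_mem_nhdsWithin] with r hr using mem_Ioi.2 (sub_pos.2 (mem_Iio.1 hr))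
  refine (key.comp hsub).congr' ?_
  filter_upwards [Ioo_mem_nhdsLT ht] with r hr
  have hσ : t - r ∈ Ioo 0 t := ⟨sub_pos.2 hr.2, by linarith [hr.1]⟩
  obtain ⟨C', hC'⟩ := hwb (1 / (32 * (t - r))) (by have := hσ.1; positivity)
  have i1 := integrable_heatKernel_mul x y hσ.1 (hwm _ hσ) (hC' _ hσ)
  have i2 := integrable_heatKernel_mul (-x) y hσ.1 (hwm _ hσ) (hC' _ hσ)
  simp only [Function.comp_apply]
  rw [← integral_sub i1 i2, ← integral_indicator hD]
  refine integral_congr_ae (ae_of_all _ fun p => ?_)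
  by_cases hp : p ∈ halfSpace d
  · simp only [w, indicator_of_mem hp, dirichletKernel, sub_sub_cancel]
    rw [show (-x - p.1) ^ 2 = (x + p.1) ^ 2 by ring]
    ring
  · simp [w, indicator_of_notMem hp]

theorem IsSolution.aestronglyMeasurable_initial_and_bound (hsol : IsSolution F h u)
    (hu : ∀ a > 0, ∀ T > 0, ∃ C : ℝ, ∀ (x : ℝ) (y : Tan d) (t : ℝ), 0 < x → 0 < t → t ≤ T →
      |u x y t| ≤ C * Real.exp (a * (x ^ 2 + ‖y‖ ^ 2))) :
    AEStronglyMeasurable (fun p : ℝ × Tan d => h p.1 p.2) (volume.restrict (halfSpace d)) ∧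
    ∀ a > 0, ∃ C, ∀ p ∈ halfSpace d, |h p.1 p.2| ≤ C * Real.exp (a * (p.1 ^ 2 + ‖p.2‖ ^ 2)) := by
  have hD : MeasurableSet (halfSpace d) := isOpen_halfSpace.measurableSet
  have hlim : ∀ p ∈ halfSpace d, Tendsto (fun s => u p.1 p.2 s) (𝓝[>] 0) (𝓝 (h p.1 p.2)) := by
    intro p hp
    rw [← hsol.initial p.1 p.2 hp.1]
    exact hsol.continuous_initial p.1 p.2 hp.1
  constructor
  · have t0 : Tendsto (fun n : ℕ => 1 / ((n : ℝ) + 1)) atTop (𝓝[>] 0) :=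
      tendsto_nhdsWithin_iff.2 ⟨tendsto_one_div_add_atTop_nhds_zero_nat,
        Eventually.of_forall fun n => by simp only [mem_Ioi]; positivity⟩
    refine aestronglyMeasurable_of_tendsto_ae atTop
      (f := fun (n : ℕ) (p : ℝ × Tan d) => u p.1 p.2 (1 / ((n : ℝ) + 1))) (fun n => ?_)
      ((ae_restrict_iff' hD).2 (ae_of_all _ fun p hp => (hlim p hp).comp t0))
    exact (hsol.regular.contDiffOn_space _ (by positivity)).continuousOn.aestronglyMeasurable hD
  · intro a ha
    obtain ⟨C, hC⟩ := hu a ha 1 one_pos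
    refine ⟨C, fun p hp => le_of_tendsto (hlim p hp).abs ?_⟩
    filter_upwards [Ioo_mem_nhdsGT (one_pos (α := ℝ))] with s hs
    exact hC p.1 p.2 s hp.1 hs.1 hs.2.le

theorem exists_green_bound (d : ℕ) (x : ℝ) (y : Tan d) {σ₀ σ₁ : ℝ} (h0 : 0 < σ₀) :
    ∃ C, 0 ≤ C ∧ ∀ σ ∈ Icc σ₀ σ₁, ∀ p : ℝ × Tan d, ∀ B v : ℝ, 0 ≤ B →
      |v| ≤ B * Real.exp (1 / (32 * σ₁) * (p.1 ^ 2 + ‖p.2‖ ^ 2)) →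
      |dirichletKernel x p.1 σ * heatKernel d (‖p.2 - y‖ ^ 2) σ * v| ≤
        C * B * gaussWeight (1 / (32 * σ₁)) p := by
  obtain ⟨C1, hC1, H1⟩ := exists_dirichletKernel_le x (σ₁ := σ₁) h0
  obtain ⟨C2, hC2, H2⟩ := exists_one_add_mul_heatKernel_le (V := Tan d) d ‖y‖ (σ₁ := σ₁) h0
  refine ⟨C1 * C2, by positivity, fun σ hσ p B v hB hv => ?_⟩
  have k1 := (H1 σ hσ p.1).1
  have k2 := H2 σ hσ y p.2 le_rfl
  have n2 := heatKernel_nonneg d (‖p.2 - y‖ ^ 2) σ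
  have k2' : heatKernel d (‖p.2 - y‖ ^ 2) σ ≤ C2 * Real.exp (-(1 / (16 * σ₁) * ‖p.2‖ ^ 2)) := by
    nlinarith [mul_nonneg (sq_nonneg ‖p.2 - y‖) n2]
  rw [abs_mul, abs_mul, abs_of_nonneg n2]
  calc _ ≤ C1 * Real.exp (-(1 / (16 * σ₁) * p.1 ^ 2)) *
          (C2 * Real.exp (-(1 / (16 * σ₁) * ‖p.2‖ ^ 2))) *
        (B * Real.exp (1 / (32 * σ₁) * (p.1 ^ 2 + ‖p.2‖ ^ 2))) := by gcongr
    _ = C1 * C2 * B * (Real.exp (-(1 / (16 * σ₁) * p.1 ^ 2)) *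
          Real.exp (-(1 / (16 * σ₁) * ‖p.2‖ ^ 2)) *
          Real.exp (1 / (32 * σ₁) * (p.1 ^ 2 + ‖p.2‖ ^ 2))) := by ring
    _ = _ := by rw [exp_mul_exp_mul_exp_eq_gaussWeight]

theorem continuous_green (x : ℝ) (y : Tan d) (σ : ℝ) :
    Continuous (fun p : ℝ × Tan d => dirichletKernel x p.1 σ * heatKernel d (‖p.2 - y‖ ^ 2) σ) :=
  ((continuous_dirichletKernel x σ).comp continuous_fst).mul
    ((contDiff_heatKernel d σ).continuous.comp (by fun_prop))

/-- The initial values enter through their pointwise limit only: the growth condition is uniform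
in time. -/
theorem IsSolution.tendsto_integral_green_initial (hsol : IsSolution F h u)
    (hu : ∀ a > 0, ∀ T > 0, ∃ C : ℝ, ∀ (x : ℝ) (y : Tan d) (t : ℝ), 0 < x → 0 < t → t ≤ T →
      |u x y t| ≤ C * Real.exp (a * (x ^ 2 + ‖y‖ ^ 2)))
    (x : ℝ) (y : Tan d) {t : ℝ} (ht : 0 < t) :
    IntegrableOn (fun p : ℝ × Tan d => green₁ x y t p.1 p.2 0 * h p.1 p.2) (halfSpace d) ∧
    Tendsto (fun s => ∫ p in halfSpace d, dirichletKernel x p.1 (t - s) *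
      heatKernel d (‖p.2 - y‖ ^ 2) (t - s) * u p.1 p.2 s) (𝓝[>] 0) (𝓝 (u₀ h x y t)) := by
  have hD : MeasurableSet (halfSpace d) := isOpen_halfSpace.measurableSet
  obtain ⟨hm, hb⟩ := hsol.aestronglyMeasurable_initial_and_bound hu
  obtain ⟨B, hB⟩ := hb (1 / (32 * t)) (by positivity)
  obtain ⟨B', hB'⟩ := hu (1 / (32 * t)) (by positivity) t ht
  obtain ⟨C, hC, H⟩ := exists_green_bound d x y (σ₀ := t / 2) (σ₁ := t) (by positivity)
  have hW : ∀ K : ℝ, IntegrableOn (fun p : ℝ × Tan d => K * gaussWeight (1 / (32 * t)) p)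
      (halfSpace d) := fun K => ((integrable_gaussWeight (by positivity)).const_mul K).integrableOn
  have hg : (fun p : ℝ × Tan d => green₁ x y t p.1 p.2 0 * h p.1 p.2) =
      fun p => dirichletKernel x p.1 t * heatKernel d (‖p.2 - y‖ ^ 2) t * h p.1 p.2 := by
    funext p
    rw [green₁_eq, sub_zero]; ring
  constructor
  · rw [hg]
    refine (hW (C * |B|)).mono' ((continuous_green x y t).aestronglyMeasurable.mul hm)
      ((ae_restrict_iff' hD).2 (ae_of_all _ fun p hp => ?_))
    refine H t ⟨by linarith, le_rfl⟩ p |B| _ (abs_nonneg B) ((hB p hp).trans ?_)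
    gcongr
    exact le_abs_self B
  · unfold u₀
    rw [hg]
    have hsm : ∀ᶠ s : ℝ in 𝓝[>] 0, s ∈ Ioo 0 (t / 2) := Ioo_mem_nhdsGT (by positivity)
    refine tendsto_integral_filter_of_dominated_convergence
      (fun p => C * |B'| * gaussWeight (1 / (32 * t)) p) ?_ ?_ (hW _) ?_
    · filter_upwards [hsm] with s hs
      exact ((continuous_green x y (t - s)).continuousOn.mul
        (hsol.regular.contDiffOn_space s hs.1).continuousOn).aestronglyMeasurable hD
    · filter_upwards [hsm] with s hs
      refine (ae_restrict_iff' hD).2 (ae_of_all _ fun p hp => ?_)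
      refine H (t - s) ⟨by linarith [hs.2], by linarith [hs.1]⟩ p |B'| _ (abs_nonneg B')
        ((hB' p.1 p.2 s hp.1 hs.1 (by linarith [hs.2])).trans ?_)
      gcongr
      exact le_abs_self B'
    · refine (ae_restrict_iff' hD).2 (ae_of_all _ fun p hp => ?_)
      have hts : Tendsto (fun s : ℝ => t - s) (𝓝[>] 0) (𝓝 t) := by
        have hh : Continuous (fun s : ℝ => t - s) := by fun_prop
        simpa using (hh.tendsto 0).mono_left (nhdsWithin_le_nhds (s := Ioi 0))
      have hu0 : Tendsto (fun s => u p.1 p.2 s) (𝓝[>] 0) (𝓝 (h p.1 p.2)) := by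
        rw [← hsol.initial p.1 p.2 hp.1]
        exact hsol.continuous_initial p.1 p.2 hp.1
      exact (((hasDerivAt_dirichletKernel_time x p.1 ht).continuousAt.tendsto.comp hts).mul
        ((hasDerivAt_heatKernel_time d (‖p.2 - y‖ ^ 2) ht).continuousAt.tendsto.comp hts)).mul hu0

theorem green₁x_zero (y : Tan d) {t : ℝ} (ht : 0 < t) (ξ : ℝ) (η : Tan d) :
    green₁x 0 y t ξ η 0 =
      heatKernel d (‖η - y‖ ^ 2) t * (ξ / t * heatKernel 1 (ξ ^ 2) t) := by
  unfold green₁x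
  simp only [green₁_eq, sub_zero]
  exact ((hasDerivAt_dirichletKernel_zero ξ ht).const_mul _).deriv

/-- The initial layer of the flux is the limit of the difference quotients of `u₀`. -/
theorem IsSolution.tendsto_u₀_div (hsol : IsSolution F h u)
    (hu : ∀ a > 0, ∀ T > 0, ∃ C : ℝ, ∀ (x : ℝ) (y : Tan d) (t : ℝ), 0 < x → 0 < t → t ≤ T →
      |u x y t| ≤ C * Real.exp (a * (x ^ 2 + ‖y‖ ^ 2)))
    (y : Tan d) {t : ℝ} (ht : 0 < t) :
    IntegrableOn (fun p : ℝ × Tan d => green₁x 0 y t p.1 p.2 0 * h p.1 p.2) (halfSpace d) ∧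
    Tendsto (fun x => x⁻¹ * u₀ h x y t) (𝓝[>] 0) (𝓝 (V₀ h y t)) := by
  have hD : MeasurableSet (halfSpace d) := isOpen_halfSpace.measurableSet
  obtain ⟨hm, hb⟩ := hsol.aestronglyMeasurable_initial_and_bound hu
  obtain ⟨B, hB⟩ := hb (1 / (32 * t)) (by positivity)
  obtain ⟨C1, hC1, H1⟩ := exists_dirichletKernel_le_mul ht
  obtain ⟨C2, hC2, H2⟩ := exists_one_add_mul_heatKernel_le (V := Tan d) d ‖y‖ (σ₁ := t) ht
  let G : ℝ → ℝ × Tan d → ℝ := fun x p => x⁻¹ * (green₁ x y t p.1 p.2 0 * h p.1 p.2)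
  let G0 : ℝ × Tan d → ℝ := fun p => green₁x 0 y t p.1 p.2 0 * h p.1 p.2
  have hW : IntegrableOn (fun p : ℝ × Tan d => C1 * C2 * B * gaussWeight (1 / (32 * t)) p)
      (halfSpace d) := ((integrable_gaussWeight (by positivity)).const_mul _).integrableOn
  have hlim : ∀ p ∈ halfSpace d, Tendsto (fun x => G x p) (𝓝[>] 0) (𝓝 (G0 p)) := by
    intro p hp
    have h1 := (hasDerivAt_dirichletKernel_zero p.1 ht).hasDerivWithinAt (s := Ioi 0)
    rw [hasDerivWithinAt_iff_tendsto_slope' self_notMem_Ioi] at h1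
    have h2 := (h1.const_mul (heatKernel d (‖p.2 - y‖ ^ 2) t)).mul_const (h p.1 p.2)
    simp only [G0, green₁x_zero y ht]
    refine h2.congr fun x => ?_
    have h3 : dirichletKernel 0 p.1 t = 0 := by simp [dirichletKernel]
    simp only [G, green₁_eq, slope_def_field, sub_zero, h3]
    ring
  have hbd : ∀ᶠ x : ℝ in 𝓝[>] 0, ∀ p ∈ halfSpace d,
      ‖G x p‖ ≤ C1 * C2 * B * gaussWeight (1 / (32 * t)) p := by
    filter_upwards [Ioo_mem_nhdsGT (one_pos (α := ℝ))] with x hx p hp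
    have hx0 : 0 < x := hx.1
    have k1 := H1 x ⟨hx.1.le, hx.2.le⟩ p.1 (le_of_lt hp.1)
    have k2 := H2 t ⟨le_rfl, le_rfl⟩ y p.2 le_rfl
    have n2 := heatKernel_nonneg d (‖p.2 - y‖ ^ 2) t
    have k2' : heatKernel d (‖p.2 - y‖ ^ 2) t ≤ C2 * Real.exp (-(1 / (16 * t) * ‖p.2‖ ^ 2)) := by
      nlinarith [mul_nonneg (sq_nonneg ‖p.2 - y‖) n2]
    have hBp := hB p hp
    simp only [G, green₁_eq, sub_zero, Real.norm_eq_abs]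
    rw [abs_mul, abs_mul, abs_mul, abs_of_nonneg n2, abs_of_pos (inv_pos.2 hx0)]
    calc _ ≤ x⁻¹ * ((C2 * Real.exp (-(1 / (16 * t) * ‖p.2‖ ^ 2))) *
            (x * (C1 * Real.exp (-(1 / (16 * t) * p.1 ^ 2)))) *
          (B * Real.exp (1 / (32 * t) * (p.1 ^ 2 + ‖p.2‖ ^ 2)))) := by gcongr
      _ = C1 * C2 * B * (Real.exp (-(1 / (16 * t) * p.1 ^ 2)) *
            Real.exp (-(1 / (16 * t) * ‖p.2‖ ^ 2)) *
            Real.exp (1 / (32 * t) * (p.1 ^ 2 + ‖p.2‖ ^ 2))) := by field_simp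
      _ = _ := by rw [exp_mul_exp_mul_exp_eq_gaussWeight]
  have hGm : ∀ x, AEStronglyMeasurable (G x) (volume.restrict (halfSpace d)) := by
    intro x
    refine (AEStronglyMeasurable.mul ?_ hm).const_mul _
    simp only [green₁_eq, sub_zero]
    exact (((contDiff_heatKernel d t).continuous.comp (by fun_prop)).mul
      ((continuous_dirichletKernel x t).comp continuous_fst)).aestronglyMeasurable
  have hG0m : AEStronglyMeasurable G0 (volume.restrict (halfSpace d)) :=
    aestronglyMeasurable_of_tendsto_ae (𝓝[>] (0 : ℝ)) hGm
      ((ae_restrict_iff' hD).2 (ae_of_all _ hlim))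
  constructor
  · refine hW.mono' hG0m ((ae_restrict_iff' hD).2 (ae_of_all _ fun p hp => ?_))
    refine le_of_tendsto (hlim p hp).norm ?_
    filter_upwards [hbd] with x hx using hx p hp
  · have := tendsto_integral_filter_of_dominated_convergence _ (Eventually.of_forall hGm)
      (hbd.mono fun x hx => (ae_restrict_iff' hD).2 (ae_of_all _ hx)) hW
      ((ae_restrict_iff' hD).2 (ae_of_all _ hlim))
    simp only [G, integral_const_mul] at this
    exact this

end Endpoints

/-! ### The representation formula and its normal derivative -/

section Duhamel

variable {d : ℕ} {F : ℝ → ℝ} {h : ℝ → Tan d → ℝ} {u : ℝ → Tan d → ℝ → ℝ}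
  {f : Tan d → ℝ → ℝ} {C t : ℝ}

theorem integral_green_mul {x : ℝ} (hx : 0 ≤ x) (y : Tan d) {τ : ℝ} (hτ : τ < t) :
    ∫ p in halfSpace d, dirichletKernel x p.1 (t - τ) * heatKernel d (‖p.2 - y‖ ^ 2) (t - τ) *
      f p.2 τ = erf (x / (2 * √(t - τ))) * heatMean f y t τ := by
  rw [← integral_dirichletKernel hx (sub_pos.2 hτ), heatMean, ← setIntegral_univ (μ := volume)
    (f := fun η : Tan d => heatKernel d (‖η - y‖ ^ 2) (t - τ) * f η τ), ← setIntegral_prod_mul]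
  simp only [mul_assoc]
  rfl

/-- A weight with an inverse square root singularity at `τ = t` may be integrated against the
tangential mean. -/
theorem intervalIntegrable_mul_heatMean (ht : 0 < t)
    (hf : ContinuousOn (fun q : Tan d × ℝ => f q.1 q.2) (univ ×ˢ Ioi 0))
    (hC : ∀ η τ, 0 < τ → τ ≤ t → |f η τ| ≤ C * Real.exp (1 / (32 * t) * ‖η‖ ^ 2))
    (y : Tan d) {g : ℝ → ℝ} {B : ℝ} (hB : 0 ≤ B)
    (hgm : AEStronglyMeasurable g (volume.restrict (Ioo 0 t)))
    (hg : ∀ τ ∈ Ioo 0 t, |g τ| ≤ B * (√(Real.pi * (t - τ)))⁻¹) :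
    IntervalIntegrable (fun τ => g τ * heatMean f y t τ) volume 0 t := by
  have h1 := (intervalIntegrable_inv_sqrt_sub ht.le).const_mul
    (B * (C * Real.exp (1 / (16 * t) * ‖y‖ ^ 2) * √2 ^ d))
  rw [intervalIntegrable_iff_integrableOn_Ioo_of_le ht.le] at h1 ⊢
  refine h1.mono' (hgm.mul (aestronglyMeasurable_heatMean hf y))
    ((ae_restrict_iff' measurableSet_Ioo).2 (ae_of_all _ fun τ hτ => ?_))
  rw [norm_mul]
  calc _ ≤ B * (√(Real.pi * (t - τ)))⁻¹ * (C * Real.exp (1 / (16 * t) * ‖y‖ ^ 2) * √2 ^ d) := by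
        gcongr
        · exact hg τ hτ
        · exact (integrable_heatKernel_mul_and_abs_heatMean_le hf hC y hτ.1 hτ.2).2
    _ = _ := by ring

theorem abs_erf_div_le {x : ℝ} (hx : 0 ≤ x) {σ : ℝ} (hσ : 0 < σ) :
    |erf (x / (2 * √σ))| ≤ x * (√(Real.pi * σ))⁻¹ := by
  refine (abs_erf_le _).trans (le_of_eq ?_)
  have := Real.sqrt_pos.2 hσ
  have := Real.sqrt_pos.2 Real.pi_pos
  rw [abs_of_nonneg (by positivity), Real.sqrt_mul Real.pi_pos.le]
  field_simp

theorem continuousOn_erf_div (x t : ℝ) :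
    ContinuousOn (fun τ => erf (x / (2 * √(t - τ)))) (Ioo 0 t) := by
  refine continuous_erf.comp_continuousOn (ContinuousOn.div (by fun_prop) (by fun_prop) ?_)
  intro τ hτ
  have := Real.sqrt_pos.2 (sub_pos.2 hτ.2)
  positivity

/-- The Duhamel term divided by `x`: the integrand is dominated by `1 / √(π (t - τ))`, uniformly in
`x`. -/
theorem tendsto_inv_mul_integral_erf (ht : 0 < t)
    (hf : ContinuousOn (fun q : Tan d × ℝ => f q.1 q.2) (univ ×ˢ Ioi 0))
    (hC : ∀ η τ, 0 < τ → τ ≤ t → |f η τ| ≤ C * Real.exp (1 / (32 * t) * ‖η‖ ^ 2)) (y : Tan d) :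
    Tendsto (fun x => x⁻¹ * ∫ τ in (0 : ℝ)..t, erf (x / (2 * √(t - τ))) * heatMean f y t τ)
      (𝓝[>] 0) (𝓝 (∫ τ in (0 : ℝ)..t, (√(Real.pi * (t - τ)))⁻¹ * heatMean f y t τ)) := by
  have h1 := (intervalIntegrable_inv_sqrt_sub ht.le).const_mul
    (C * Real.exp (1 / (16 * t) * ‖y‖ ^ 2) * √2 ^ d)
  have hrw : ∀ x, x⁻¹ * ∫ τ in (0 : ℝ)..t, erf (x / (2 * √(t - τ))) * heatMean f y t τ =
      ∫ τ in Ioo 0 t, x⁻¹ * (erf (x / (2 * √(t - τ))) * heatMean f y t τ) := fun x => by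
    rw [← intervalIntegral.integral_const_mul, intervalIntegral.integral_of_le ht.le,
      integral_Ioc_eq_integral_Ioo]
  simp only [hrw]
  rw [intervalIntegral.integral_of_le ht.le, integral_Ioc_eq_integral_Ioo]
  rw [intervalIntegrable_iff_integrableOn_Ioo_of_le ht.le] at h1
  refine tendsto_integral_filter_of_dominated_convergence _ ?_ ?_ h1 ?_
  · exact Eventually.of_forall fun x => (((continuousOn_erf_div x t).aestronglyMeasurable
      measurableSet_Ioo).mul (aestronglyMeasurable_heatMean hf y)).const_mul _
  · filter_upwards [self_mem_nhdsWithin] with x hx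
    have hx0 : 0 < x := hx
    refine (ae_restrict_iff' measurableSet_Ioo).2 (ae_of_all _ fun τ hτ => ?_)
    have hσ : 0 < t - τ := sub_pos.2 hτ.2
    have k1 := (integrable_heatKernel_mul_and_abs_heatMean_le hf hC y hτ.1 hτ.2).2
    have k2 := abs_erf_div_le hx0.le hσ
    rw [norm_mul, norm_mul, Real.norm_eq_abs, Real.norm_eq_abs, Real.norm_eq_abs,
      abs_of_pos (inv_pos.2 hx0)]
    calc _ ≤ x⁻¹ * (x * (√(Real.pi * (t - τ)))⁻¹ *
          (C * Real.exp (1 / (16 * t) * ‖y‖ ^ 2) * √2 ^ d)) := by gcongr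
      _ = _ := by field_simp
  · refine (ae_restrict_iff' measurableSet_Ioo).2 (ae_of_all _ fun τ hτ => ?_)
    have hσ : 0 < t - τ := sub_pos.2 hτ.2
    have hs := Real.sqrt_pos.2 hσ
    have hπ := Real.sqrt_pos.2 Real.pi_pos
    have hd : HasDerivAt (fun x => erf (x / (2 * √(t - τ)))) ((√(Real.pi * (t - τ)))⁻¹) 0 := by
      have e0 : HasDerivAt erf (2 / √Real.pi) (id 0 / (2 * √(t - τ))) := by
        simpa using hasDerivAt_erf_zero
      refine (e0.comp 0 ((hasDerivAt_id (0 : ℝ)).div_const (2 * √(t - τ)))).congr_deriv ?_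
      rw [Real.sqrt_mul Real.pi_pos.le]
      field_simp
    have h2 := hd.hasDerivWithinAt (s := Ioi 0)
    rw [hasDerivWithinAt_iff_tendsto_slope' self_notMem_Ioi] at h2
    refine (h2.mul_const (heatMean f y t τ)).congr fun x => ?_
    have h3 : erf 0 = 0 := by simp [erf]
    simp only [slope_def_field, sub_zero, zero_div, h3]
    ring

/-- The representation formula, with the tangential integrals abbreviated. -/
theorem IsSolution.eq_u₀_sub_integral (hsol : IsSolution F h u)
    (hu : ∀ a > 0, ∀ T > 0, ∃ C : ℝ, ∀ (x : ℝ) (y : Tan d) (t : ℝ), 0 < x → 0 < t → t ≤ T →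
      |u x y t| ≤ C * Real.exp (a * (x ^ 2 + ‖y‖ ^ 2)))
    (hF : ∀ a > 0, ∀ T > 0, ∃ C : ℝ, ∀ (y : Tan d) (t : ℝ), 0 < t → t ≤ T →
      |source F (flux u) y t| ≤ C * Real.exp (a * ‖y‖ ^ 2))
    {x : ℝ} (hx : 0 < x) (y : Tan d) (ht : 0 < t) :
    IntervalIntegrable
      (fun τ => erf (x / (2 * √(t - τ))) * heatMean (source F (flux u)) y t τ) volume 0 t ∧
    u x y t = u₀ h x y t -
      ∫ τ in (0 : ℝ)..t, erf (x / (2 * √(t - τ))) * heatMean (source F (flux u)) y t τ := by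
  obtain ⟨C, hC⟩ := hF (1 / (32 * t)) (by positivity) t ht
  set q : ℝ → ℝ := fun τ => erf (x / (2 * √(t - τ))) * heatMean (source F (flux u)) y t τ with hq
  have hqi : IntervalIntegrable q volume 0 t :=
    intervalIntegrable_mul_heatMean ht hsol.continuousOn_source hC y hx.le
      ((continuousOn_erf_div x t).aestronglyMeasurable measurableSet_Ioo)
      fun τ hτ => abs_erf_div_le hx.le (sub_pos.2 hτ.2)
  refine ⟨hqi, ?_⟩
  have hid : ∀ s r, 0 < s → s ≤ r → r < t → ∫ τ in s..r, q τ =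
      (∫ p in halfSpace d, dirichletKernel x p.1 (t - s) *
        heatKernel d (‖p.2 - y‖ ^ 2) (t - s) * u p.1 p.2 s) -
      ∫ p in halfSpace d, dirichletKernel x p.1 (t - r) *
        heatKernel d (‖p.2 - y‖ ^ 2) (t - r) * u p.1 p.2 r := by
    intro s r hs hsr hrt
    rw [← hsol.green_identity hu hF hx.le y hs hsr hrt]
    refine intervalIntegral.integral_congr fun τ hτ => ?_
    rw [uIcc_of_le hsr] at hτ
    exact (integral_green_mul hx.le y (hτ.2.trans_lt hrt)).symm
  have hqI : IntegrableOn q (uIcc 0 t) := by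
    rwa [uIcc_of_le ht.le, ← intervalIntegrable_iff_integrableOn_Icc_of_le ht.le]
  have hm : t / 2 ∈ Ioo 0 t := ⟨by positivity, by linarith⟩
  have hs1 : uIcc 0 (t / 2) ⊆ uIcc 0 t := by
    rw [uIcc_of_le hm.1.le, uIcc_of_le ht.le]; exact Icc_subset_Icc_right hm.2.le
  have hs2 : uIcc (t / 2) t ⊆ uIcc 0 t := by
    rw [uIcc_of_le hm.2.le, uIcc_of_le ht.le]; exact Icc_subset_Icc_left hm.1.le
  have hq1 : IntervalIntegrable q volume 0 (t / 2) := hqi.mono_set hs1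
  have hq2 : IntervalIntegrable q volume (t / 2) t := hqi.mono_set hs2
  -- the two endpoints are approached separately, on either side of `t / 2`
  have hlow : Tendsto (fun s => ∫ τ in s..(t / 2), q τ) (𝓝[>] 0)
      (𝓝 (∫ τ in (0 : ℝ)..(t / 2), q τ)) := by
    have hc := intervalIntegral.continuousOn_primitive_interval_left
      (hqI.mono_set hs1)
    rw [uIcc_of_le hm.1.le] at hc
    exact ((hc 0 ⟨le_rfl, hm.1.le⟩).mono_of_mem_nhdsWithin
      (Icc_mem_nhdsGT hm.1)).tendsto
  have hhigh : Tendsto (fun r => ∫ τ in (t / 2)..r, q τ) (𝓝[<] t)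
      (𝓝 (∫ τ in (t / 2)..t, q τ)) := by
    have hc := intervalIntegral.continuousOn_primitive_interval
      (hqI.mono_set hs2)
    rw [uIcc_of_le hm.2.le] at hc
    exact ((hc t ⟨hm.2.le, le_rfl⟩).mono_of_mem_nhdsWithin (Icc_mem_nhdsLT hm.2)).tendsto
  have e1 := tendsto_nhds_unique hlow (((hsol.tendsto_integral_green_initial hu x y ht).2.sub
    tendsto_const_nhds).congr' (by
      filter_upwards [Ioo_mem_nhdsGT hm.1] with s hs
      exact (hid s (t / 2) hs.1 hs.2.le hm.2).symm))
  have e2 := tendsto_nhds_unique hhigh ((tendsto_const_nhds.sub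
    (hsol.tendsto_integral_green_terminal hu hx y ht)).congr' (by
      filter_upwards [Ioo_mem_nhdsLT hm.2] with r hr
      exact (hid (t / 2) r hm.1 hr.1.le hr.2).symm))
  rw [← intervalIntegral.integral_add_adjacent_intervals hq1 hq2, e1, e2]
  ring

end Duhamel

end NonclassicalHeat

open NonclassicalHeat in
theorem theorem3p1 {d : ℕ} (F : ℝ → ℝ) (h : ℝ → Tan d → ℝ) (u : ℝ → Tan d → ℝ → ℝ)
    (hsol : IsSolution F h u)
    (hu : ∀ a > 0, ∀ T > 0, ∃ C : ℝ, ∀ (x : ℝ) (y : Tan d) (t : ℝ), 0 < x → 0 < t → t ≤ T →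
      |u x y t| ≤ C * Real.exp (a * (x ^ 2 + ‖y‖ ^ 2)))
    (hF : ∀ a > 0, ∀ T > 0, ∃ C : ℝ, ∀ (y : Tan d) (t : ℝ), 0 < t → t ≤ T →
      |source F (flux u) y t| ≤ C * Real.exp (a * ‖y‖ ^ 2)) :
    -- all the integrals in the two formulas converge absolutely
    (∀ (x : ℝ) (y : Tan d) (t : ℝ), 0 < x → 0 < t →
      IntegrableOn (fun p : ℝ × Tan d => green₁ x y t p.1 p.2 0 * h p.1 p.2) (halfSpace d) ∧
      IntervalIntegrable (fun τ => erf (x / (2 * √(t - τ))) / (2 * √(Real.pi * (t - τ))) ^ d *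
        ∫ η : Tan d, Real.exp (-‖y - η‖ ^ 2 / (4 * (t - τ))) * source F (flux u) η τ)
        volume 0 t) ∧
    (∀ (y : Tan d) (t : ℝ), 0 < t →
      IntegrableOn (fun p : ℝ × Tan d => green₁x 0 y t p.1 p.2 0 * h p.1 p.2) (halfSpace d) ∧
      (∀ τ, 0 < τ → τ < t → Integrable (fun η : Tan d =>
        Real.exp (-‖y - η‖ ^ 2 / (4 * (t - τ))) * source F (flux u) η τ)) ∧
      IntervalIntegrable (fun τ => 1 / (2 * √(Real.pi * (t - τ))) ^ (d + 1) *
        ∫ η : Tan d, Real.exp (-‖y - η‖ ^ 2 / (4 * (t - τ))) * source F (flux u) η τ)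
        volume 0 t) ∧
    -- integral representation of the solution
    (∀ (x : ℝ) (y : Tan d) (t : ℝ), 0 < x → 0 < t →
      u x y t = u₀ h x y t -
        ∫ τ in (0 : ℝ)..t, erf (x / (2 * √(t - τ))) / (2 * √(Real.pi * (t - τ))) ^ d *
          ∫ η : Tan d, Real.exp (-‖y - η‖ ^ 2 / (4 * (t - τ))) * source F (flux u) η τ) ∧
    -- Volterra integral equation for the boundary heat flux
    (∀ (y : Tan d) (t : ℝ), 0 < t →
      flux u y t = V₀ h y t -
        2 * ∫ τ in (0 : ℝ)..t, 1 / (2 * √(Real.pi * (t - τ))) ^ (d + 1) *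
          ∫ η : Tan d, Real.exp (-‖y - η‖ ^ 2 / (4 * (t - τ))) * source F (flux u) η τ) := by
  have hmean : ∀ (y : Tan d) (t τ : ℝ) (k : ℝ),
      k / (2 * √(Real.pi * (t - τ))) ^ d *
        ∫ η : Tan d, Real.exp (-‖y - η‖ ^ 2 / (4 * (t - τ))) * source F (flux u) η τ =
      k * heatMean (source F (flux u)) y t τ := by
    intro y t τ k
    rw [heatMean_eq]; ring
  have hmean' : ∀ (y : Tan d) (t τ : ℝ),
      1 / (2 * √(Real.pi * (t - τ))) ^ (d + 1) *
        ∫ η : Tan d, Real.exp (-‖y - η‖ ^ 2 / (4 * (t - τ))) * source F (flux u) η τ =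
      1 / 2 * ((√(Real.pi * (t - τ)))⁻¹ * heatMean (source F (flux u)) y t τ) := by
    intro y t τ
    rw [heatMean_eq, pow_succ, one_div, mul_inv, mul_inv]; ring
  simp only [hmean, hmean', intervalIntegral.integral_const_mul]
  refine ⟨fun x y t hx ht => ⟨(hsol.tendsto_integral_green_initial hu x y ht).1,
    (hsol.eq_u₀_sub_integral hu hF hx y ht).1⟩, 
    fun y t ht => ⟨(hsol.tendsto_u₀_div hu y ht).1, ?_, ?_⟩,
    fun x y t hx ht => (hsol.eq_u₀_sub_integral hu hF hx y ht).2, fun y t ht => ?_⟩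
  · intro τ hτ hτt
    obtain ⟨C, hC⟩ := hF (1 / (32 * t)) (by positivity) t (hτ.trans hτt)
    have h1 := (integrable_heatKernel_mul_and_abs_heatMean_le hsol.continuousOn_source hC y
      hτ hτt).1.const_mul ((2 * √(Real.pi * (t - τ))) ^ d)
    refine h1.congr (ae_of_all _ fun η => ?_)
    have := Real.sqrt_pos.2 (mul_pos Real.pi_pos (sub_pos.2 hτt))
    simp only [heatKernel, norm_sub_rev y η]
    field_simp
  · obtain ⟨C, hC⟩ := hF (1 / (32 * t)) (by positivity) t ht
    refine (intervalIntegrable_mul_heatMean ht hsol.continuousOn_source hC y zero_le_one ?_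
      fun τ hτ => ?_).const_mul _
    · refine Measurable.aestronglyMeasurable ?_
      fun_prop
    · rw [abs_of_nonneg (by positivity), one_mul]
  · obtain ⟨C, hC⟩ := hF (1 / (32 * t)) (by positivity) t ht
    -- both sides are the limit of `u / x` as `x → 0`
    have h1 := (hsol.flux_exists y t ht).hasDerivWithinAt
    rw [hasDerivWithinAt_iff_tendsto_slope, Ici_sdiff_left] at h1
    have h2 := (hsol.tendsto_u₀_div hu y ht).2.sub
      (tendsto_inv_mul_integral_erf ht hsol.continuousOn_source hC y)
    rw [← mul_assoc, mul_one_div_cancel two_ne_zero, one_mul]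
    refine tendsto_nhds_unique h1 (h2.congr' ?_)
    filter_upwards [self_mem_nhdsWithin] with x hx
    rw [slope_def_field, hsol.boundary y t ht, sub_zero, sub_zero,
      (hsol.eq_u₀_sub_integral hu hF hx y ht).2]
    ring
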